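/- Let $m\in\mathbb N_{>0}$, $\alpha>0$ and $t_1>\dots>t_m\ge 0$ be fixed. For $n\in\mathbb N_{>0}$ let $z_1,\dots,z_n$ be random points of the closed unit disk with joint density, with respect to Lebesgue measure on $\mathbb C^n$, proportional to $$\prod_{1\le j<k\le n}|z_k-z_j|^2\prod_{j=1}^n(1-|z_j|^2)^{\alpha-1},\qquad |z_j|\le 1,$$ let $\mathrm N(y)=\#\{j:|z_j|<y\}$, and let $r_\ell=(1-t_\ell/n)^{1/2}$ for $\ell=1,\dots,m$ (defined for $n\ge t_1$; when $1-t_\ell/n<0$ we set $r_\ell=0$). Write $\mathrm Q(a,x)=\frac1{\Gamma(a)}\int_x^{\infty}s^{a-1}e^{-s}\,ds$ and, for $\vec u\in\mathbb C^m$, $$\mathcal H_\alpha(x;\vec t,\vec u)=1+\sum_{\ell=1}^m(e^{u_\ell}-1)e^{\sum_{j=\ell+1}^m u_j}\,\mathrm Q(\alpha,t_\ell x),$$ $$\mathcal G_\alpha(x;\vec t,\vec u)=\frac1{\mathcal H_\alpha(x;\vec t,\vec u)}\frac{x^{\alpha-1}}{\Gamma(\alpha)}\sum_{\ell=1}^m(e^{u_\ell}-1)e^{\sum_{j=\ell+1}^m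 u_j}\,t_\ell^{\alpha}e^{-t_\ell x}\,\frac{1-\alpha-t_\ell x}{2},$$ $$C_1=\int_0^1\ln\mathcal H_\alpha(x;\vec t,\vec u)\,dx,\qquad C_2=\int_0^1\mathcal G_\alpha(x;\vec t,\vec u)\,dx+\frac{\ln\mathcal H_\alpha(1;\vec t,\vec u)-\sum_{j=1}^m u_j}{2},$$ where $\ln$ is the principal branch, and let $\hat\alpha=\min\{\alpha,1\}$. (1) For all $x_1,\dots,x_m\in\mathbb R$ there exists $\delta>0$ such that, whenever $|u_j-x_j|\le\delta$ for $j=1,\dots,m$, $\mathcal H_\alpha(y;\vec t,\vec u)\notin(-\infty,0]$ for all $y\in[0,1]$ and the integrals defining $C_1$ and $C_2$ converge absolutely, and $$\mathbb E\Big[\prod_{j=1}^m e^{u_j\mathrm N(r_j)}\Big]=\exp\Big(C_1n+C_2+\mathcal O\big(n^{-\frac{2\hat\alpha+\alpha}{2+\alpha}}\big)\Big),\qquad n\to+\infty,$$ uniformly for $u_1\in\{z\in\mathbb C:|z-x_1|\le\delta\},\dots,u_m\in\{z\in\mathbb C:|z-x_m|\le\delta\}$. (2) For every $n\in\mathbb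 N_{>0}$, $\mathbb E[\prod_{j}e^{u_j\mathrm N(r_j)}]$ is analytic in $(u_1,\dots,u_m)\in\mathbb C^m$ and positive for $u_1,\dots,u_m\in\mathbb R$. (3) For all $u_1,\dots,u_m\in\mathbb R$ the function $\ln\mathbb E[\prod_{j}e^{u_j\mathrm N(r_j)}]-(C_1n+C_2)$ of $\vec u$ is analytic at $(u_1,\dots,u_m)$ for every $n\in\mathbb N_{>0}$, and for all $k_1,\dots,k_m\in\mathbb N=\{0,1,2,\dots\}$, $$\partial_{u_1}^{k_1}\cdots\partial_{u_m}^{k_m}\Big\{\ln\mathbb E\Big[\prod_{j=1}^m e^{u_j\mathrm N(r_j)}\Big]-(C_1n+C_2)\Big\}=\mathcal O\big(n^{-\frac{2\hat\alpha+\alpha}{2+\alpha}}\big),\qquad n\to+\infty.$$ -/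

import Mathlib

open MeasureTheory Filter Asymptotics

noncomputable section

namespace DiskCounting

/-- Unnormalized joint density
`∏_{j<k} |z_k - z_j|² ∏_j (1 - |z_j|²)^(α-1)` on the `n`-th power of the unit disk, zero outside. -/
def gasDensity (α : ℝ) (n : ℕ) (z : Fin n → ℂ) : ℝ :=
  open Classical in
  if ∀ j, ‖z j‖ ≤ 1 then
    (∏ j : Fin n, ∏ k ∈ Finset.Ioi j, ‖z k - z j‖ ^ 2) * ∏ j : Fin n, (1 - ‖z j‖ ^ 2) ^ (α - 1)
  else 0

/-- The unnormalized law: `gasDensity` times Lebesgue measure on `ℂⁿ`. -/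
def gasWeight (α : ℝ) (n : ℕ) : Measure (Fin n → ℂ) :=
  volume.withDensity fun z => ENNReal.ofReal (gasDensity α n z)

/-- The law of the `n` points: `gasWeight` divided by its total mass. -/
def gasLaw (α : ℝ) (n : ℕ) : Measure (Fin n → ℂ) :=
  (gasWeight α n Set.univ)⁻¹ • gasWeight α n

/-- `N(y)`, the number of points of modulus smaller than `y`. -/
def count {n : ℕ} (y : ℝ) (z : Fin n → ℂ) : ℕ :=
  open Classical in
  (Finset.univ.filter fun i => ‖z i‖ < y).card

/-- The radius `(1 - t/n)^(1/2)`. -/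
def radius (t : ℝ) (n : ℕ) : ℝ := Real.sqrt (1 - t / n)

/-- The moment generating function `E[∏_j exp (u_j N(r_j))]`, with `r_j = (1 - t_j/n)^(1/2)`. -/
def mgf {m : ℕ} (α : ℝ) (t : Fin m → ℝ) (n : ℕ) (u : Fin m → ℂ) : ℂ :=
  ∫ z, ∏ j, Complex.exp (u j * (count (radius (t j) n) z : ℂ)) ∂(gasLaw α n)

/-- The normalized upper incomplete Gamma function `Q(a,x) = Γ(a,x) / Γ(a)`. -/
def gammaQ (a x : ℝ) : ℝ :=
  (∫ s in Set.Ioi x, s ^ (a - 1) * Real.exp (-s)) / Real.Gamma a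

/-- The coefficient `(exp u_ℓ - 1) exp (∑_{j > ℓ} u_j)`. -/
def coeff {m : ℕ} (u : Fin m → ℂ) (l : Fin m) : ℂ :=
  (Complex.exp (u l) - 1) * Complex.exp (∑ j ∈ Finset.Ioi l, u j)

/-- The function `H_α(x; t, u)`. -/
def H {m : ℕ} (α : ℝ) (t : Fin m → ℝ) (u : Fin m → ℂ) (x : ℝ) : ℂ :=
  1 + ∑ l, coeff u l * (gammaQ α (t l * x) : ℂ)

/-- The function `G_α(x; t, u)`. -/
def G {m : ℕ} (α : ℝ) (t : Fin m → ℝ) (u : Fin m → ℂ) (x : ℝ) : ℂ :=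
  1 / H α t u x * ((x ^ (α - 1) / Real.Gamma α : ℝ) : ℂ) *
    ∑ l, coeff u l *
      ((t l ^ α * Real.exp (-(t l * x)) * ((1 - α - t l * x) / 2) : ℝ) : ℂ)

/-- The coefficient `C₁` of `n`. -/
def C₁ {m : ℕ} (α : ℝ) (t : Fin m → ℝ) (u : Fin m → ℂ) : ℂ :=
  ∫ x in (0 : ℝ)..1, Complex.log (H α t u x)

/-- The constant term `C₂`. -/
def C₂ {m : ℕ} (α : ℝ) (t : Fin m → ℝ) (u : Fin m → ℂ) : ℂ :=
  (∫ x in (0 : ℝ)..1, G α t u x) + (Complex.log (H α t u 1) - ∑ j, u j) / 2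

/-- The rate `n^(-(2 min{α,1} + α)/(2 + α))`. -/
def rate (α : ℝ) (n : ℕ) : ℝ := (n : ℝ) ^ (-((2 * min α 1 + α) / (2 + α)))

/-- The partial derivative `∂/∂u_j`. -/
def partialD {m : ℕ} (j : Fin m) (f : (Fin m → ℂ) → ℂ) : (Fin m → ℂ) → ℂ :=
  fun u => lineDeriv ℂ f u (Pi.single j 1)

/-- The mixed partial derivative `∂_{u_1}^{k_1} ⋯ ∂_{u_m}^{k_m} f`. -/
def mixedD {m : ℕ} (k : Fin m → ℕ) (f : (Fin m → ℂ) → ℂ) : (Fin m → ℂ) → ℂ :=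
  (List.finRange m).foldr (fun j g => (partialD j)^[k j] g) f

/-- The remainder `ln E[∏_j exp (u_j N(r_j))] - (C₁ n + C₂)`, with the principal logarithm. -/
def logRemainder {m : ℕ} (α : ℝ) (t : Fin m → ℝ) (n : ℕ) (u : Fin m → ℂ) : ℂ :=
  Complex.log (mgf α t n u) - (C₁ α t u * n + C₂ α t u)

end DiskCounting

end

noncomputable section
namespace DiskCounting

/-! The density is the squared modulus of a Vandermonde determinant times a radial weight. Tilting
it by counting statistics of centred disks only changes the radial weight. When both determinants
are expanded and the angles integrated out, only diagonal terms survive: the squared moduli act as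
independent Beta(k, α) variables, k = 1, …, n. Hence the moment generating function is the product
of the factors F_k = `modulusFactor`, built from Beta tails (`mgf_eq_prod`).

The factors F_k and the limit profile H are both averages of numbers exp(partial sums of the u_l).
If the imaginary parts of the u_l add up to at most 1 in absolute value, all of them lie in one
half-plane Re z ≥ c > 0, uniformly in n, k and x (`re_one_add_sum_coeff_ge`). Principal logarithms
of the factors are then harmless.

Put h = 1/n and x = k/n, and let H₁ be `corrH`, so that G = H₁/H. Then F_k = H(x) + h H₁(x) + O(h²
x^(α-2)) (`abs_betaTail_sub_gammaP_le`). A formal Euler–Maclaurin summation gives Σ ln F_k ≈ n ∫ ln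
H + ∫ H₁/H + (ln H(1) - ln H(0))/2, and ln H(0) = Σ u_j; this is C₁ n + C₂. The difficulty is the
x^α singularity at 0: for α < 1, adding up the errors h² x^(α-2) gives only n^(-α), which is weaker
than the claim. So ln z is split at F₀ = H(0) into ln F₀ + (z - F₀)/F₀ + `logRest`. The linear part
is a sum of Beta tails with an exact closed form, and its error is O(1/n) (`sum_betaTail`,
`isBigO_sum_betaTail`). The rest vanishes to second order at F₀, so its error on a cell is O(h²
x^(2α-2)), and these errors add up within the rate (`SingularProfile.norm_sum_logRest_sub_le`,
`sum_cell_error_le`).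

Analyticity and positivity of the moment generating function are read off the finite product. C₁ and
C₂ are analytic in u because logarithm and inversion are analytic maps on the Banach algebra
C([0,1], ℂ). The remainder formed with the sum of logarithms is analytic and within the rate on a
complex polydisc independent of n, so Cauchy's estimates bound its derivatives. At real points its
germ is that of the remainder formed with the principal logarithm of the product. -/

/-! ### Vandermonde expansion and angular orthogonality -/

theorem integral_pow_mul_conj_pow_radial (w : ℝ → ℂ) {a b : ℕ} (hab : a ≠ b) :
    ∫ z : ℂ, z ^ a * (starRingEnd ℂ z) ^ b * w ‖z‖ = 0 := by
  -- Rotation by π/(a - b) preserves Lebesgue measure and multiplies the integrand by e^(iπ) = -1,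
  -- so the integral equals its own negative; integrability plays no role.
  set c : Circle := Circle.exp (Real.pi / ((a : ℝ) - b)) with hc
  have hab' : ((a : ℂ) - b) ≠ 0 := sub_ne_zero.mpr (by exact_mod_cast hab)
  have hcc : (c : ℂ) ^ a * (starRingEnd ℂ (c : ℂ)) ^ b = -1 := by
    rw [hc, Circle.coe_exp, ← Complex.exp_conj, ← Complex.exp_nat_mul, ← Complex.exp_nat_mul,
      ← Complex.exp_add, ← Complex.exp_pi_mul_I]
    congr 1
    simp only [map_mul, Complex.conj_I, Complex.conj_ofReal]
    push_cast
    field_simp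
    ring
  have hmp := (rotation c).measurePreserving
  have h := hmp.integral_comp (rotation c).toHomeomorph.measurableEmbedding
    (fun z : ℂ => z ^ a * (starRingEnd ℂ z) ^ b * w ‖z‖)
  have h2 : ∀ z : ℂ, (rotation c z) ^ a * (starRingEnd ℂ (rotation c z)) ^ b * w ‖rotation c z‖
      = - (z ^ a * (starRingEnd ℂ z) ^ b * w ‖z‖) := by
    intro z
    rw [LinearIsometryEquiv.norm_map, rotation_apply, map_mul, mul_pow, mul_pow]
    linear_combination (z ^ a * (starRingEnd ℂ z) ^ b * w ‖z‖) * hcc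
  simp only [h2, integral_neg] at h
  exact self_eq_neg.mp h.symm

/-- The left side is the squared modulus of the Vandermonde determinant. The Leibniz formula for it
and for its conjugate separates the variables. -/
theorem prod_norm_sub_sq_eq_sum {n : ℕ} (z : Fin n → ℂ) :
    (((∏ j : Fin n, ∏ k ∈ Finset.Ioi j, ‖z k - z j‖ ^ 2 : ℝ)) : ℂ) =
      ∑ σ : Equiv.Perm (Fin n), ∑ τ : Equiv.Perm (Fin n),
        ((Equiv.Perm.sign σ : ℤ) : ℂ) * ((Equiv.Perm.sign τ : ℤ) : ℂ) *
          ∏ i, ((z i) ^ (σ i : ℕ) * (starRingEnd ℂ (z i)) ^ (τ i : ℕ)) := by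
  have h1 : (((∏ j : Fin n, ∏ k ∈ Finset.Ioi j, ‖z k - z j‖ ^ 2 : ℝ)) : ℂ) =
      (Matrix.vandermonde z).det * starRingEnd ℂ (Matrix.vandermonde z).det := by
    rw [Complex.mul_conj, Matrix.det_vandermonde, Complex.normSq_eq_norm_sq, norm_prod,
      ← Finset.prod_pow]
    congr 1
    refine Finset.prod_congr rfl fun j _ => ?_
    rw [norm_prod, ← Finset.prod_pow]
  have h2 : (Matrix.vandermonde z).det = ∑ σ : Equiv.Perm (Fin n),
      ((Equiv.Perm.sign σ : ℤ) : ℂ) * ∏ i, (z i) ^ (σ i : ℕ) := by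
    rw [← Matrix.det_transpose, Matrix.det_apply']
    rfl
  rw [h1, h2, map_sum, Finset.sum_mul_sum]
  refine Finset.sum_congr rfl fun σ _ => Finset.sum_congr rfl fun τ _ => ?_
  rw [Finset.prod_mul_distrib]
  simp only [map_mul, map_prod, map_pow, map_intCast]
  ring

section RadialMoments

variable {w : ℝ → ℂ}

theorem integrable_perm_term {n : ℕ}
    (hw : ∀ a b : ℕ, Integrable fun z : ℂ => z ^ a * (starRingEnd ℂ z) ^ b * w ‖z‖)
    (σ τ : Equiv.Perm (Fin n)) :
    Integrable fun z : Fin n → ℂ =>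
      ∏ i, ((z i) ^ (σ i : ℕ) * (starRingEnd ℂ (z i)) ^ (τ i : ℕ) * w ‖z i‖) :=
  Integrable.fintype_prod (f := fun i z => z ^ (σ i : ℕ) * (starRingEnd ℂ z) ^ (τ i : ℕ) * w ‖z‖)
    (fun _ => hw _ _)

theorem vandermonde_weight_eq_sum {n : ℕ} (z : Fin n → ℂ) :
    (((∏ j : Fin n, ∏ k ∈ Finset.Ioi j, ‖z k - z j‖ ^ 2 : ℝ)) : ℂ) * ∏ i, w ‖z i‖ =
      ∑ σ : Equiv.Perm (Fin n), ∑ τ : Equiv.Perm (Fin n),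
        ((Equiv.Perm.sign σ : ℤ) : ℂ) * ((Equiv.Perm.sign τ : ℤ) : ℂ) *
          ∏ i, ((z i) ^ (σ i : ℕ) * (starRingEnd ℂ (z i)) ^ (τ i : ℕ) * w ‖z i‖) := by
  rw [prod_norm_sub_sq_eq_sum, Finset.sum_mul]
  refine Finset.sum_congr rfl fun σ _ => ?_
  rw [Finset.sum_mul]
  refine Finset.sum_congr rfl fun τ _ => ?_
  rw [mul_assoc, ← Finset.prod_mul_distrib]

theorem integrable_vandermonde_weight {n : ℕ}
    (hw : ∀ a b : ℕ, Integrable fun z : ℂ => z ^ a * (starRingEnd ℂ z) ^ b * w ‖z‖) :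
    Integrable fun z : Fin n → ℂ =>
      (((∏ j : Fin n, ∏ k ∈ Finset.Ioi j, ‖z k - z j‖ ^ 2 : ℝ)) : ℂ) * ∏ i, w ‖z i‖ := by
  simp only [vandermonde_weight_eq_sum]
  exact integrable_finsetSum _ fun σ _ => integrable_finsetSum _ fun τ _ =>
    (integrable_perm_term hw σ τ).const_mul _

theorem integral_vandermonde_weight {n : ℕ}
    (hw : ∀ a b : ℕ, Integrable fun z : ℂ => z ^ a * (starRingEnd ℂ z) ^ b * w ‖z‖) :
    ∫ z : Fin n → ℂ,
      (((∏ j : Fin n, ∏ k ∈ Finset.Ioi j, ‖z k - z j‖ ^ 2 : ℝ)) : ℂ) * ∏ i, w ‖z i‖ =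
    (n.factorial : ℂ) * ∏ k : Fin n, ∫ z : ℂ, z ^ (k : ℕ) * (starRingEnd ℂ z) ^ (k : ℕ) * w ‖z‖ := by
  simp only [vandermonde_weight_eq_sum]
  rw [integral_finsetSum _ fun σ _ => integrable_finsetSum _ fun τ _ =>
    (integrable_perm_term hw σ τ).const_mul _]
  have key : ∀ σ : Equiv.Perm (Fin n), ∫ z : Fin n → ℂ, ∑ τ : Equiv.Perm (Fin n),
        ((Equiv.Perm.sign σ : ℤ) : ℂ) * ((Equiv.Perm.sign τ : ℤ) : ℂ) *
          ∏ i, ((z i) ^ (σ i : ℕ) * (starRingEnd ℂ (z i)) ^ (τ i : ℕ) * w ‖z i‖) =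
      ∏ k : Fin n, ∫ z : ℂ, z ^ (k : ℕ) * (starRingEnd ℂ z) ^ (k : ℕ) * w ‖z‖ := by
    intro σ
    rw [integral_finsetSum _ fun τ _ => (integrable_perm_term hw σ τ).const_mul _]
    -- Only τ = σ survives: where τ i ≠ σ i, the one-point integral at i vanishes by rotation. After
    -- reindexing every σ gives the same product, whence the factor n!.
    rw [Finset.sum_eq_single σ]
    · rw [integral_const_mul, integral_fintype_prod_volume_eq_prod
        (f := fun (i : Fin n) (z : ℂ) => z ^ (σ i : ℕ) * (starRingEnd ℂ z) ^ (σ i : ℕ) * w ‖z‖)]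
      rw [← Int.cast_mul, ← Units.val_mul, Int.units_mul_self]
      simp only [Units.val_one, Int.cast_one, one_mul]
      exact Equiv.prod_comp σ (fun k : Fin n =>
        ∫ z : ℂ, z ^ (k : ℕ) * (starRingEnd ℂ z) ^ (k : ℕ) * w ‖z‖)
    · intro τ _ hτ
      obtain ⟨i, hi⟩ : ∃ i, τ i ≠ σ i := by
        by_contra! h
        exact hτ (Equiv.ext h)
      rw [integral_const_mul, integral_fintype_prod_volume_eq_prod
        (f := fun (i : Fin n) (z : ℂ) => z ^ (σ i : ℕ) * (starRingEnd ℂ z) ^ (τ i : ℕ) * w ‖z‖)]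
      rw [Finset.prod_eq_zero (Finset.mem_univ i), mul_zero]
      exact integral_pow_mul_conj_pow_radial w (fun h => hi (Fin.ext h.symm))
    · simp
  simp only [key]
  rw [Finset.sum_const, Finset.card_univ, Fintype.card_perm, Fintype.card_fin, nsmul_eq_mul]

/-- Radial moments of a weight supported in the unit disk, as integrals over `[0, 1]`. -/
theorem integral_radial_moment (f : ℝ → ℂ) (k : ℕ) :
    ∫ z : ℂ, z ^ k * (starRingEnd ℂ z) ^ k * (if ‖z‖ ≤ 1 then f (‖z‖ ^ 2) else 0) =
      (Real.pi : ℂ) * ∫ s in (0 : ℝ)..1, (s : ℂ) ^ k * f s := by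
  have h1 : ∀ z : ℂ, z ^ k * (starRingEnd ℂ z) ^ k * (if ‖z‖ ≤ 1 then f (‖z‖ ^ 2) else 0) =
      (fun r : ℝ => ((r ^ 2 : ℝ) : ℂ) ^ k * (if r ≤ 1 then f (r ^ 2) else 0)) ‖z‖ := by
    intro z
    simp only
    rw [← mul_pow, Complex.mul_conj, Complex.normSq_eq_norm_sq]
  simp only [h1]
  rw [integral_fun_norm_addHaar volume
    (fun r : ℝ => ((r ^ 2 : ℝ) : ℂ) ^ k * (if r ≤ 1 then f (r ^ 2) else 0))]
  have h2 : volume.real (Metric.ball (0 : ℂ) 1) = Real.pi := by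
    simp [Measure.real, Complex.volume_ball]
  rw [h2, Complex.finrank_real_complex]
  -- The substitution s = r² absorbs 2 r dr; the 2 is the dimension factor of the polar coordinate
  -- formula.
  have h3 := integral_comp_rpow_Ioi
    (fun s : ℝ => (Set.Ioc (0 : ℝ) 1).indicator (fun s : ℝ => (s : ℂ) ^ k * f s) s)
    (p := 2) two_ne_zero
  rw [intervalIntegral.integral_of_le zero_le_one, ← integral_indicator measurableSet_Ioc]
  have h4 : ∫ s, (Set.Ioc (0 : ℝ) 1).indicator (fun s : ℝ => (s : ℂ) ^ k * f s) s =
      ∫ s in Set.Ioi (0 : ℝ), (Set.Ioc (0 : ℝ) 1).indicator (fun s : ℝ => (s : ℂ) ^ k * f s) s := by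
    rw [setIntegral_indicator measurableSet_Ioc, integral_indicator measurableSet_Ioc,
      Set.inter_eq_right.mpr Set.Ioc_subset_Ioi_self]
  rw [h4, ← h3, ← Complex.real_smul, smul_comm]
  congr 1
  rw [nsmul_eq_mul, ← integral_const_mul]
  refine setIntegral_congr_fun measurableSet_Ioi fun r hr => ?_
  have hr0 : (0 : ℝ) < r := hr
  have hr1 : r ^ (2 : ℝ) = r ^ 2 := Real.rpow_two r
  have hr2 : r ^ (2 - 1 : ℝ) = r := by norm_num
  simp only [hr1, hr2]
  by_cases h : r ≤ 1
  · have : r ^ 2 ∈ Set.Ioc (0 : ℝ) 1 := ⟨by positivity, by nlinarith⟩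
    rw [Set.indicator_of_mem this, if_pos h]
    simp
    ring
  · have : r ^ 2 ∉ Set.Ioc (0 : ℝ) 1 := fun h' => h (by nlinarith [h'.2])
    rw [Set.indicator_of_notMem this, if_neg h]
    simp

theorem intervalIntegrable_one_sub_rpow {α : ℝ} (hα : 0 < α) :
    IntervalIntegrable (fun s : ℝ => (1 - s) ^ (α - 1)) volume 0 1 := by
  have h := (intervalIntegral.intervalIntegrable_rpow' (a := 0) (b := 1)
    (r := α - 1) (by linarith)).comp_sub_left (f := fun x : ℝ => x ^ (α - 1)) 1
  simpa using h.symm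

theorem integrable_disk_weight {α : ℝ} (hα : 0 < α) :
    Integrable fun z : ℂ => if ‖z‖ ≤ 1 then (1 - ‖z‖ ^ 2) ^ (α - 1) else 0 := by
  have h := integrable_fun_norm_addHaar (E := ℂ) volume
    (f := fun r : ℝ => if r ≤ 1 then (1 - r ^ 2) ^ (α - 1) else 0)
  refine h.mpr ?_
  have h1 : IntegrableOn ((Set.Ioc (0 : ℝ) 1).indicator fun s : ℝ => (1 - s) ^ (α - 1))
      (Set.Ioi 0) :=
    ((integrable_indicator_iff measurableSet_Ioc).mpr
      ((intervalIntegrable_iff_integrableOn_Ioc_of_le zero_le_one).mp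
        (intervalIntegrable_one_sub_rpow hα))).integrableOn
  have h2 := (integrableOn_Ioi_comp_rpow_iff
    ((Set.Ioc (0 : ℝ) 1).indicator fun s : ℝ => (1 - s) ^ (α - 1)) (p := 2) two_ne_zero).mpr h1
  refine IntegrableOn.congr_fun (f := fun r : ℝ => (1 / 2 : ℝ) * _) (h2.const_mul (1 / 2))
    (fun r hr => ?_) measurableSet_Ioi
  have hr0 : (0 : ℝ) < r := hr
  have hr1 : r ^ (2 : ℝ) = r ^ 2 := Real.rpow_two r
  have hr2 : r ^ (2 - 1 : ℝ) = r := by norm_num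
  simp only [hr1, hr2, Complex.finrank_real_complex]
  by_cases h : r ≤ 1
  · have : r ^ 2 ∈ Set.Ioc (0 : ℝ) 1 := ⟨by positivity, by nlinarith⟩
    rw [Set.indicator_of_mem this, if_pos h]
    simp
    ring
  · have : r ^ 2 ∉ Set.Ioc (0 : ℝ) 1 := fun h' => h (by nlinarith [h'.2])
    rw [Set.indicator_of_notMem this, if_neg h]
    simp

theorem integrable_disk_moment {α : ℝ} (hα : 0 < α) {g : ℝ → ℂ} (hg : Measurable g) {B : ℝ}
    (hB : ∀ s, ‖g s‖ ≤ B) (a b : ℕ) :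
    Integrable fun z : ℂ => z ^ a * (starRingEnd ℂ z) ^ b *
      (if ‖z‖ ≤ 1 then (((1 - ‖z‖ ^ 2) ^ (α - 1) : ℝ) : ℂ) * g (‖z‖ ^ 2) else 0) := by
  have hconj : Measurable fun z : ℂ => starRingEnd ℂ z := Complex.continuous_conj.measurable
  refine ((integrable_disk_weight hα).const_mul B).mono ?_ (Eventually.of_forall fun z => ?_)
  · refine Measurable.aestronglyMeasurable ?_
    refine ((measurable_id.pow_const a).mul (hconj.pow_const b)).mul ?_
    refine Measurable.ite (measurableSet_le measurable_norm measurable_const) ?_ measurable_const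
    exact (Complex.measurable_ofReal.comp (by fun_prop)).mul (hg.comp (by fun_prop))
  · by_cases h : ‖z‖ ≤ 1
    · have h0 : 0 ≤ (1 - ‖z‖ ^ 2) ^ (α - 1) := Real.rpow_nonneg (by nlinarith [norm_nonneg z]) _
      have hB0 : 0 ≤ B := (norm_nonneg _).trans (hB 0)
      simp only [if_pos h, norm_mul, norm_pow, RCLike.norm_conj, Complex.norm_real,
        Real.norm_of_nonneg h0, Real.norm_of_nonneg hB0]
      have h1 : ‖z‖ ^ a * ‖z‖ ^ b ≤ 1 :=
        mul_le_one₀ (pow_le_one₀ (norm_nonneg _) h) (by positivity) (pow_le_one₀ (norm_nonneg _) h)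
      calc ‖z‖ ^ a * ‖z‖ ^ b * ((1 - ‖z‖ ^ 2) ^ (α - 1) * ‖g (‖z‖ ^ 2)‖)
          ≤ 1 * ((1 - ‖z‖ ^ 2) ^ (α - 1) * B) := by
            gcongr
            exact hB _
        _ = _ := by ring
    · simp [if_neg h]

end RadialMoments

/-! ### Step weights and the half-plane bound -/

/-- The step function `∏_{l : s < ρ_l} exp u_l`. -/
def stepWeight {m : ℕ} (u : Fin m → ℂ) (ρ : Fin m → ℝ) (s : ℝ) : ℂ :=
  ∏ l, if s < ρ l then Complex.exp (u l) else 1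

/-- Expand ∏ (1 + a_l) and group the subsets by their smallest index l, which gives a_l ∏_{j>l} (1 +
a_j). Since ρ is monotone, s < ρ l forces s < ρ j for j > l, so the inner product is the full
exponential in `coeff`. -/
theorem stepWeight_eq_one_add {m : ℕ} (u : Fin m → ℂ) {ρ : Fin m → ℝ} (hρ : Monotone ρ) (s : ℝ) :
    stepWeight u ρ s = 1 + ∑ l, coeff u l * (if s < ρ l then 1 else 0) := by
  have h : ∀ l, (if s < ρ l then Complex.exp (u l) else 1) =
      1 + (if s < ρ l then Complex.exp (u l) - 1 else 0) := by
    intro l; split_ifs <;> ring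
  -- The ordered expansion multiplies over smaller indices; the order dual makes them the larger
  -- ones.
  have hrev := Finset.prod_one_add_ordered (ι := (Fin m)ᵒᵈ) Finset.univ
    (fun l => if s < ρ (OrderDual.ofDual l) then Complex.exp (u (OrderDual.ofDual l)) - 1 else 0)
  unfold stepWeight
  simp only [h]
  refine Eq.trans ?_ (hrev.trans ?_)
  · exact (Equiv.prod_comp OrderDual.ofDual
      (fun l : Fin m => (1 : ℂ) + if s < ρ l then Complex.exp (u l) - 1 else 0)).symm
  · congr 1
    rw [← Equiv.sum_comp OrderDual.ofDual (fun l : Fin m => coeff u l * (if s < ρ l then 1 else 0))]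
    refine Finset.sum_congr rfl fun l _ => ?_
    by_cases hl : s < ρ (OrderDual.ofDual l)
    · rw [if_pos hl, if_pos hl, mul_one, coeff, Complex.exp_sum]
      congr 1
      have : ∀ i ∈ Finset.univ.filter (fun j : (Fin m)ᵒᵈ => j < l),
          (1 : ℂ) + (if s < ρ (OrderDual.ofDual i) then
            Complex.exp (u (OrderDual.ofDual i)) - 1 else 0) =
            Complex.exp (u (OrderDual.ofDual i)) := by
        intro i hi
        have hi' : OrderDual.ofDual l < OrderDual.ofDual i := (Finset.mem_filter.mp hi).2
        rw [if_pos (hl.trans_le (hρ hi'.le))]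
        ring
      rw [Finset.prod_congr rfl this]
      refine Finset.prod_nbij' OrderDual.ofDual OrderDual.toDual ?_ ?_ ?_ ?_ ?_
      · intro i hi
        exact Finset.mem_Ioi.mpr (Finset.mem_filter.mp hi).2
      · intro i hi
        exact Finset.mem_filter.mpr ⟨Finset.mem_univ _,
          (Finset.mem_Ioi.mp hi : OrderDual.ofDual l < i)⟩
      · intro _ _; rfl
      · intro _ _; rfl
      · intro _ _; rfl
    · rw [if_neg hl, if_neg hl, zero_mul, mul_zero]

theorem measurable_stepWeight {m : ℕ} (u : Fin m → ℂ) (ρ : Fin m → ℝ) :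
    Measurable (stepWeight u ρ) := by
  unfold stepWeight
  exact Finset.measurable_prod _ fun l _ =>
    Measurable.ite measurableSet_Iio measurable_const measurable_const

theorem stepWeight_eq_exp {m : ℕ} (u : Fin m → ℂ) (ρ : Fin m → ℝ) (s : ℝ) :
    stepWeight u ρ s = Complex.exp (∑ l, if s < ρ l then u l else 0) := by
  rw [stepWeight, Complex.exp_sum]
  refine Finset.prod_congr rfl fun l _ => ?_
  split_ifs <;> simp

theorem norm_stepWeight_le {m : ℕ} (u : Fin m → ℂ) (ρ : Fin m → ℝ) (s : ℝ) :
    ‖stepWeight u ρ s‖ ≤ Real.exp (∑ l, ‖u l‖) := by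
  rw [stepWeight_eq_exp, Complex.norm_exp]
  refine Real.exp_le_exp.mpr ((Complex.re_le_norm _).trans ((norm_sum_le _ _).trans ?_))
  refine Finset.sum_le_sum fun l _ => ?_
  split_ifs <;> simp

/-- The weight is the exponential of a partial sum of the u_l, whose imaginary part stays in [-1,
1], where the cosine is at least cos 1 > 0. -/
theorem re_stepWeight_ge {m : ℕ} {u : Fin m → ℂ} {M : ℝ} (hM : ∑ l, ‖u l‖ ≤ M)
    (him : ∑ l, |(u l).im| ≤ 1) (ρ : Fin m → ℝ) (s : ℝ) :
    Real.exp (-M) * Real.cos 1 ≤ (stepWeight u ρ s).re := by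
  rw [stepWeight_eq_exp, Complex.exp_re]
  set S := ∑ l, if s < ρ l then u l else 0 with hS
  have h1 : |S.re| ≤ M := by
    refine (Complex.abs_re_le_norm _).trans ((norm_sum_le _ _).trans (le_trans ?_ hM))
    refine Finset.sum_le_sum fun l _ => ?_
    split_ifs <;> simp
  have h2 : |S.im| ≤ 1 := by
    rw [hS, Complex.im_sum]
    refine (Finset.abs_sum_le_sum_abs _ _).trans (le_trans ?_ him)
    refine Finset.sum_le_sum fun l _ => ?_
    split_ifs <;> simp
  have h3 : Real.cos 1 ≤ Real.cos S.im := by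
    rw [← Real.cos_abs S.im]
    exact Real.cos_le_cos_of_nonneg_of_le_pi (abs_nonneg _) (by linarith [Real.pi_gt_three]) h2
  exact mul_le_mul (Real.exp_le_exp.mpr (by linarith [(abs_le.mp h1).1])) h3
    Real.cos_one_pos.le (Real.exp_pos _).le

theorem intervalIntegrable_stepWeight {m : ℕ} (u : Fin m → ℂ) (ρ : Fin m → ℝ) (a b : ℝ) :
    IntervalIntegrable (stepWeight u ρ) volume a b :=
  (intervalIntegrable_const (c := Real.exp (∑ l, ‖u l‖))).mono_fun
    (measurable_stepWeight u ρ).aestronglyMeasurable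
    (Eventually.of_forall fun s => by
      simpa [abs_of_pos (Real.exp_pos _)] using norm_stepWeight_le u ρ s)

theorem integral_indicator_lt {f : ℝ → ℂ} {ρ : ℝ} (h0 : 0 ≤ ρ) (h1 : ρ ≤ 1) :
    ∫ s in (0 : ℝ)..1, f s * (if s < ρ then 1 else 0) = ∫ s in (0 : ℝ)..ρ, f s := by
  rw [intervalIntegral.integral_of_le zero_le_one, intervalIntegral.integral_of_le h0,
    integral_Ioc_eq_integral_Ioo (x := (0 : ℝ)) (y := ρ), ← integral_indicator measurableSet_Ioc,
    ← integral_indicator measurableSet_Ioo]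
  congr 1
  ext s
  by_cases hs : s < ρ
  · by_cases hs0 : 0 < s
    · rw [Set.indicator_of_mem (show s ∈ Set.Ioc (0 : ℝ) 1 from ⟨hs0, by linarith⟩),
        Set.indicator_of_mem (show s ∈ Set.Ioo (0 : ℝ) ρ from ⟨hs0, hs⟩), if_pos hs, mul_one]
    · rw [Set.indicator_of_notMem (fun h => hs0 h.1), Set.indicator_of_notMem (fun h => hs0 h.1)]
  · rw [Set.indicator_of_notMem (s := Set.Ioo (0 : ℝ) ρ) (fun h => hs h.2)]
    by_cases hs1 : s ∈ Set.Ioc (0 : ℝ) 1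
    · rw [Set.indicator_of_mem hs1, if_neg hs, mul_zero]
    · rw [Set.indicator_of_notMem hs1]

theorem intervalIntegrable_mul_indicator_lt {f : ℝ → ℂ} (hf : IntervalIntegrable f volume 0 1)
    (ρ : ℝ) : IntervalIntegrable (fun s => f s * (if s < ρ then (1 : ℂ) else 0)) volume 0 1 := by
  refine hf.mono_fun ?_ (Eventually.of_forall fun s => ?_)
  · exact (intervalIntegrable_iff.mp hf).aestronglyMeasurable.mul
      (Measurable.ite measurableSet_Iio measurable_const measurable_const).aestronglyMeasurable
  · simp only [norm_mul]
    refine mul_le_of_le_one_right (norm_nonneg _) ?_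
    split_ifs <;> simp

theorem integral_mul_stepWeight {m : ℕ} (u : Fin m → ℂ) {ρ : Fin m → ℝ} (hρ : Monotone ρ)
    {f : ℝ → ℂ} (hf : IntervalIntegrable f volume 0 1) :
    ∫ s in (0 : ℝ)..1, f s * stepWeight u ρ s =
      (∫ s in (0 : ℝ)..1, f s) +
        ∑ l, coeff u l * ∫ s in (0 : ℝ)..1, f s * (if s < ρ l then 1 else 0) := by
  have h : ∀ s, f s * stepWeight u ρ s =
      f s + ∑ l, coeff u l * (f s * (if s < ρ l then 1 else 0)) := by
    intro s
    rw [stepWeight_eq_one_add u hρ, mul_add, mul_one, Finset.mul_sum]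
    congr 1
    exact Finset.sum_congr rfl fun l _ => by ring
  have hi : ∀ l ∈ Finset.univ, IntervalIntegrable
      (fun s => coeff u l * (f s * (if s < ρ l then (1 : ℂ) else 0))) volume 0 1 :=
    fun l _ => (intervalIntegrable_mul_indicator_lt hf _).const_mul _
  simp only [h]
  rw [intervalIntegral.integral_add hf (by
      have := IntervalIntegrable.sum _ hi
      rwa [Finset.sum_fn] at this),
    intervalIntegral.integral_finsetSum hi]
  simp only [intervalIntegral.integral_const_mul]

/-- A combination `1 + ∑ coeff u l * Q l` with monotone `Q` in `[0, 1]` averages the step weight. -/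
theorem one_add_sum_coeff_eq_integral {m : ℕ} (u : Fin m → ℂ) {Q : Fin m → ℝ} (hQ : Monotone Q)
    (h0 : ∀ l, 0 ≤ Q l) (h1 : ∀ l, Q l ≤ 1) :
    1 + ∑ l, coeff u l * (Q l : ℂ) = ∫ s in (0 : ℝ)..1, stepWeight u Q s := by
  have h := integral_mul_stepWeight u hQ (f := fun _ => 1) intervalIntegrable_const
  simp only [one_mul] at h
  rw [h]
  simp only [intervalIntegral.integral_const, sub_zero, one_smul]
  congr 1
  refine Finset.sum_congr rfl fun l _ => ?_
  have := integral_indicator_lt (f := fun _ => 1) (h0 l) (h1 l)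
  simp only [one_mul, intervalIntegral.integral_const, sub_zero] at this
  rw [this]
  simp

/-- An average of points of a half-plane stays in it. The same constant serves for the factors at
finite n and for the limit profile. -/
theorem re_one_add_sum_coeff_ge {m : ℕ} {u : Fin m → ℂ} {M : ℝ} (hM : ∑ l, ‖u l‖ ≤ M)
    (him : ∑ l, |(u l).im| ≤ 1) {Q : Fin m → ℝ} (hQ : Monotone Q)
    (h0 : ∀ l, 0 ≤ Q l) (h1 : ∀ l, Q l ≤ 1) :
    Real.exp (-M) * Real.cos 1 ≤ (1 + ∑ l, coeff u l * (Q l : ℂ)).re := by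
  rw [one_add_sum_coeff_eq_integral u hQ h0 h1]
  have hint := intervalIntegrable_stepWeight u Q 0 1
  have h : (∫ s in (0 : ℝ)..1, stepWeight u Q s).re = ∫ s in (0 : ℝ)..1, (stepWeight u Q s).re := by
    have := Complex.reCLM.intervalIntegral_comp_comm hint
    simpa using this.symm
  rw [h]
  have h2 : ∫ s in (0 : ℝ)..1, Real.exp (-M) * Real.cos 1 ≤
      ∫ s in (0 : ℝ)..1, (stepWeight u Q s).re := by
    refine intervalIntegral.integral_mono zero_le_one intervalIntegrable_const ?_
      fun s => re_stepWeight_ge hM him Q s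
    exact ⟨hint.1.re, hint.2.re⟩
  simpa using h2

/-! ### Beta tails and factorization of the moment generating function -/

/-- Upper tail `P(X > 1 - ε)` of the Beta distribution with parameters `k` and `α`. -/
def betaTail (α ε : ℝ) (k : ℕ) : ℝ :=
  Real.Gamma (k + α) / (Real.Gamma k * Real.Gamma α) *
    ∫ v in (0 : ℝ)..ε, v ^ (α - 1) * (1 - v) ^ (k - 1)

theorem intervalIntegrable_betaTail {α : ℝ} (hα : 0 < α) (k : ℕ) (a b : ℝ) :
    IntervalIntegrable (fun v : ℝ => v ^ (α - 1) * (1 - v) ^ k) volume a b :=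
  (intervalIntegral.intervalIntegrable_rpow' (by linarith)).mul_continuousOn
    (by fun_prop)

theorem integral_beta_real {α : ℝ} (hα : 0 < α) (k : ℕ) :
    ∫ v in (0 : ℝ)..1, v ^ (α - 1) * (1 - v) ^ k =
      Real.Gamma (k + 1) * Real.Gamma α / Real.Gamma (k + 1 + α) := by
  have h := Complex.betaIntegral_eq_Gamma_mul_div (α : ℂ) ((k + 1 : ℝ) : ℂ) (by simpa using hα)
    (by rw [Complex.ofReal_re]; positivity)
  have h2 : Complex.betaIntegral (α : ℂ) ((k + 1 : ℝ) : ℂ) =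
      ((∫ v in (0 : ℝ)..1, v ^ (α - 1) * (1 - v) ^ k : ℝ) : ℂ) := by
    rw [Complex.betaIntegral, ← intervalIntegral.integral_ofReal]
    refine intervalIntegral.integral_congr fun v hv => ?_
    rw [Set.uIcc_of_le zero_le_one] at hv
    rw [Complex.ofReal_mul, Complex.ofReal_cpow hv.1]
    push_cast
    rw [add_sub_cancel_right, Complex.cpow_natCast]
  rw [h2, ← Complex.ofReal_add, Complex.Gamma_ofReal, Complex.Gamma_ofReal, Complex.Gamma_ofReal] at h
  have h3 : (∫ v in (0 : ℝ)..1, v ^ (α - 1) * (1 - v) ^ k) =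
      Real.Gamma α * Real.Gamma (k + 1) / Real.Gamma (α + (k + 1)) := by exact_mod_cast h
  rw [h3, mul_comm, add_comm α]

theorem betaTail_one {α : ℝ} (hα : 0 < α) {k : ℕ} (hk : 0 < k) : betaTail α 1 k = 1 := by
  obtain ⟨j, rfl⟩ : ∃ j, k = j + 1 := ⟨k - 1, by omega⟩
  rw [betaTail, Nat.add_sub_cancel, integral_beta_real hα]
  push_cast
  have h1 : Real.Gamma (j + 1) ≠ 0 := (Real.Gamma_pos_of_pos (by positivity)).ne'
  have h2 : Real.Gamma α ≠ 0 := (Real.Gamma_pos_of_pos hα).ne'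
  have h3 : Real.Gamma (j + 1 + α) ≠ 0 := (Real.Gamma_pos_of_pos (by positivity)).ne'
  field_simp

theorem betaTail_mono {α : ℝ} (hα : 0 < α) (k : ℕ) {ε ε' : ℝ} (h0 : 0 ≤ ε) (h : ε ≤ ε')
    (h1 : ε' ≤ 1) : betaTail α ε k ≤ betaTail α ε' k := by
  unfold betaTail
  have hc : 0 ≤ Real.Gamma (k + α) / (Real.Gamma k * Real.Gamma α) := by
    have := Real.Gamma_nonneg_of_nonneg (Nat.cast_nonneg (α := ℝ) k)
    have := Real.Gamma_pos_of_pos hα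
    have := Real.Gamma_pos_of_pos (show (0 : ℝ) < k + α by positivity)
    positivity
  refine mul_le_mul_of_nonneg_left ?_ hc
  refine intervalIntegral.integral_mono_interval le_rfl h0 h ?_
    (intervalIntegrable_betaTail hα _ _ _)
  refine (ae_restrict_iff' measurableSet_Ioc).mpr (Eventually.of_forall fun v hv => ?_)
  exact mul_nonneg (Real.rpow_nonneg hv.1.le _) (pow_nonneg (by linarith [hv.2]) _)

theorem betaTail_zero (α : ℝ) (k : ℕ) : betaTail α 0 k = 0 := by simp [betaTail]

/-- The factor contributed to the moment generating function by the modulus of order `k`. -/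
def modulusFactor {m : ℕ} (α : ℝ) (ε : Fin m → ℝ) (u : Fin m → ℂ) (k : ℕ) : ℂ :=
  1 + ∑ l, coeff u l * ((1 - betaTail α (ε l) k : ℝ) : ℂ)

theorem re_modulusFactor_ge {m : ℕ} {α : ℝ} (hα : 0 < α) {u : Fin m → ℂ} {M : ℝ}
    (hM : ∑ l, ‖u l‖ ≤ M) (him : ∑ l, |(u l).im| ≤ 1) {ε : Fin m → ℝ} (hε : Antitone ε)
    (h0 : ∀ l, 0 ≤ ε l) (h1 : ∀ l, ε l ≤ 1) {k : ℕ} (hk : 0 < k) :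
    Real.exp (-M) * Real.cos 1 ≤ (modulusFactor α ε u k).re := by
  refine re_one_add_sum_coeff_ge hM him (Q := fun l => 1 - betaTail α (ε l) k) ?_ ?_ ?_
  · exact fun l l' hl => sub_le_sub_left (betaTail_mono hα k (h0 l') (hε hl) (h1 l)) 1
  · intro l
    have := betaTail_mono hα k (h0 l) (h1 l) le_rfl
    rw [betaTail_one hα hk] at this
    linarith
  · intro l
    have := betaTail_mono hα k le_rfl (h0 l) (h1 l)
    rw [betaTail_zero] at this
    linarith

/-- Up to the normalization B(k + 1, α), this is the mean of the step weight at a Beta(k + 1, α)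
variable. The minimum with 1 covers ε l > 1: the threshold 1 - ε l is then negative, and both
indicators vanish on (0, 1]. -/
theorem integral_moment_stepWeight {m : ℕ} {α : ℝ} (hα : 0 < α) (u : Fin m → ℂ) {ε : Fin m → ℝ}
    (hε : Antitone ε) (h0 : ∀ l, 0 ≤ ε l) (k : ℕ) :
    ∫ s in (0 : ℝ)..1, (s : ℂ) ^ k * ((((1 - s) ^ (α - 1) : ℝ) : ℂ) *
        stepWeight u (fun l => 1 - ε l) s) =
      ((Real.Gamma (k + 1) * Real.Gamma α / Real.Gamma (k + 1 + α) : ℝ) : ℂ) *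
        modulusFactor α (fun l => min (ε l) 1) u (k + 1) := by
  set f : ℝ → ℝ := fun s => s ^ k * (1 - s) ^ (α - 1) with hf
  have hfi : ∀ a b, IntervalIntegrable f volume a b := by
    intro a b
    have := (intervalIntegrable_betaTail hα k (1 - a) (1 - b)).comp_sub_left
      (f := fun v : ℝ => v ^ (α - 1) * (1 - v) ^ k) 1
    simp only [sub_sub_cancel] at this
    exact this.congr (fun s _ => by simp only [hf]; ring)
  have hfl : ∀ a, ∫ s in (1 - a)..1, f s = ∫ v in (0 : ℝ)..a, v ^ (α - 1) * (1 - v) ^ k := by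
    intro a
    have := intervalIntegral.integral_comp_sub_left (a := 0) (b := a) f 1
    rw [sub_zero] at this
    rw [← this]
    exact intervalIntegral.integral_congr fun s _ => by simp only [hf, sub_sub_cancel]; ring
  have hB : ∫ s in (0 : ℝ)..1, f s =
      Real.Gamma (k + 1) * Real.Gamma α / Real.Gamma (k + 1 + α) := by
    rw [← integral_beta_real hα, ← hfl 1, sub_self]
  have hrw : ∀ s : ℝ, (s : ℂ) ^ k * ((((1 - s) ^ (α - 1) : ℝ) : ℂ) *
      stepWeight u (fun l => 1 - ε l) s) = (f s : ℂ) * stepWeight u (fun l => 1 - ε l) s := by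
    intro s; simp only [hf]; push_cast; ring
  simp only [hrw]
  rw [integral_mul_stepWeight u (fun l l' h => sub_le_sub_left (hε h) 1)
    (f := fun s => (f s : ℂ)) ⟨(hfi 0 1).1.ofReal, (hfi 0 1).2.ofReal⟩,
    modulusFactor, mul_add, mul_one, intervalIntegral.integral_ofReal, hB, Finset.mul_sum]
  congr 1
  refine Finset.sum_congr rfl fun l _ => ?_
  have hmin0 : 0 ≤ min (ε l) 1 := le_min (h0 l) zero_le_one
  have e1 : ∫ s in (0 : ℝ)..1, (f s : ℂ) * (if s < 1 - ε l then 1 else 0) =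
      ∫ s in (0 : ℝ)..1, (f s : ℂ) * (if s < 1 - min (ε l) 1 then 1 else 0) := by
    refine intervalIntegral.integral_congr_ae (Eventually.of_forall fun s hs => ?_)
    rw [Set.uIoc_of_le zero_le_one] at hs
    congr 1
    refine if_congr ?_ rfl rfl
    rcases le_total (ε l) 1 with h | h
    · rw [min_eq_left h]
    · rw [min_eq_right h]
      constructor <;> intro h' <;> linarith [hs.1]
  rw [e1, integral_indicator_lt (by linarith [min_le_right (ε l) 1]) (by linarith),
    intervalIntegral.integral_ofReal]
  have e2 : ∫ s in (0 : ℝ)..(1 - min (ε l) 1), f s =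
      (∫ s in (0 : ℝ)..1, f s) - ∫ v in (0 : ℝ)..(min (ε l) 1), v ^ (α - 1) * (1 - v) ^ k := by
    rw [← hfl, eq_sub_iff_add_eq]
    exact intervalIntegral.integral_add_adjacent_intervals (hfi _ _) (hfi _ _)
  rw [e2, hB, mul_left_comm]
  congr 1
  rw [← Complex.ofReal_mul]
  congr 1
  rw [betaTail, Nat.add_sub_cancel]
  push_cast
  have h1 : Real.Gamma (k + 1) ≠ 0 := (Real.Gamma_pos_of_pos (by positivity)).ne'
  have h2 : Real.Gamma α ≠ 0 := (Real.Gamma_pos_of_pos hα).ne'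
  have h3 : Real.Gamma (k + 1 + α) ≠ 0 := (Real.Gamma_pos_of_pos (by positivity)).ne'
  field_simp

theorem gasDensity_nonneg (α : ℝ) (n : ℕ) (z : Fin n → ℂ) : 0 ≤ gasDensity α n z := by
  unfold gasDensity
  split_ifs with h
  · refine mul_nonneg (Finset.prod_nonneg fun _ _ => Finset.prod_nonneg fun _ _ => by positivity)
      (Finset.prod_nonneg fun j _ => Real.rpow_nonneg ?_ _)
    have := h j
    nlinarith [norm_nonneg (z j)]
  · exact le_rfl

theorem measurable_gasDensity (α : ℝ) (n : ℕ) : Measurable (gasDensity α n) := by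
  unfold gasDensity
  have hset : MeasurableSet {z : Fin n → ℂ | ∀ j, ‖z j‖ ≤ 1} := by
    rw [Set.ofPred_forall]
    exact MeasurableSet.iInter fun j => measurableSet_le (by fun_prop) measurable_const
  refine Measurable.ite hset ?_ measurable_const
  refine Measurable.mul ?_ ?_
  · exact Finset.measurable_prod _ fun j _ => Finset.measurable_prod _ fun k _ => by fun_prop
  · exact Finset.measurable_prod _ fun j _ => by fun_prop

theorem exp_mul_count {n : ℕ} (u : ℂ) (y : ℝ) (z : Fin n → ℂ) :
    Complex.exp (u * (count y z : ℂ)) = ∏ i, if ‖z i‖ < y then Complex.exp u else 1 := by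
  classical
  rw [mul_comm, Complex.exp_nat_mul, count, Finset.prod_ite, Finset.prod_const_one, mul_one,
    Finset.prod_const]

/-- The radial weight of a single point, tilted by the counting statistics. -/
def tiltedWeight {m : ℕ} (α : ℝ) (u : Fin m → ℂ) (ρ : Fin m → ℝ) (r : ℝ) : ℂ :=
  if r ≤ 1 then (((1 - r ^ 2) ^ (α - 1) : ℝ) : ℂ) * stepWeight u ρ (r ^ 2) else 0

theorem gasDensity_mul_exp_count {m : ℕ} (α : ℝ) (t : Fin m → ℝ) (n : ℕ) (u : Fin m → ℂ)
    (z : Fin n → ℂ) :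
    (gasDensity α n z : ℂ) * ∏ j, Complex.exp (u j * (count (radius (t j) n) z : ℂ)) =
      (((∏ j : Fin n, ∏ k ∈ Finset.Ioi j, ‖z k - z j‖ ^ 2 : ℝ)) : ℂ) *
        ∏ i, tiltedWeight α u (fun l => 1 - t l / n) ‖z i‖ := by
  have hexp : ∏ j, Complex.exp (u j * (count (radius (t j) n) z : ℂ)) =
      ∏ i, stepWeight u (fun l => 1 - t l / n) (‖z i‖ ^ 2) := by
    simp only [exp_mul_count]
    rw [Finset.prod_comm]
    refine Finset.prod_congr rfl fun i _ => Finset.prod_congr rfl fun j _ => ?_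
    exact if_congr (Real.lt_sqrt (norm_nonneg _)) rfl rfl
  rw [hexp, gasDensity]
  split_ifs with h
  · simp only [tiltedWeight, if_pos (h _)]
    rw [Finset.prod_mul_distrib]
    push_cast
    ring
  · obtain ⟨i, hi⟩ := not_forall.mp h
    have h0 : ∏ i, tiltedWeight α u (fun l => 1 - t l / n) ‖z i‖ = 0 :=
      Finset.prod_eq_zero (Finset.mem_univ i) (if_neg hi)
    rw [h0]
    simp

theorem integrable_tiltedWeight {m : ℕ} {α : ℝ} (hα : 0 < α) (u : Fin m → ℂ) (ρ : Fin m → ℝ)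
    (a b : ℕ) :
    Integrable fun z : ℂ => z ^ a * (starRingEnd ℂ z) ^ b * tiltedWeight α u ρ ‖z‖ :=
  integrable_disk_moment hα (measurable_stepWeight u ρ) (norm_stepWeight_le u ρ) a b

/-- The mean square modulus normalization `π B(k + 1, α)`. -/
def radialNorm (α : ℝ) (k : ℕ) : ℝ :=
  Real.pi * (Real.Gamma (k + 1) * Real.Gamma α / Real.Gamma (k + 1 + α))

theorem radialNorm_pos {α : ℝ} (hα : 0 < α) (k : ℕ) : 0 < radialNorm α k := by
  have h1 : 0 < Real.Gamma (k + 1) := Real.Gamma_pos_of_pos (by positivity)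
  have h2 : 0 < Real.Gamma α := Real.Gamma_pos_of_pos hα
  have h3 : 0 < Real.Gamma (k + 1 + α) := Real.Gamma_pos_of_pos (by positivity)
  have := Real.pi_pos
  unfold radialNorm
  positivity

theorem integral_gasDensity_mul_exp_count {m : ℕ} {α : ℝ} (hα : 0 < α) {t : Fin m → ℝ}
    (ht : Antitone t) (ht0 : ∀ l, 0 ≤ t l) (n : ℕ) (u : Fin m → ℂ) :
    ∫ z : Fin n → ℂ,
        (gasDensity α n z : ℂ) * ∏ j, Complex.exp (u j * (count (radius (t j) n) z : ℂ)) =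
      (((n.factorial : ℝ) * ∏ k : Fin n, radialNorm α k : ℝ) : ℂ) *
        ∏ k ∈ Finset.range n, modulusFactor α (fun l => min (t l / n) 1) u (k + 1) := by
  simp only [gasDensity_mul_exp_count]
  rw [integral_vandermonde_weight (integrable_tiltedWeight hα u _),
    ← Fin.prod_univ_eq_prod_range (fun k => modulusFactor α (fun l => min (t l / n) 1) u (k + 1))]
  push_cast
  rw [mul_assoc, ← Finset.prod_mul_distrib]
  congr 1
  refine Finset.prod_congr rfl fun k _ => ?_
  have h := integral_radial_moment (fun s => (((1 - s) ^ (α - 1) : ℝ) : ℂ) *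
    stepWeight u (fun l => 1 - t l / n) s) k
  rw [integral_moment_stepWeight hα u (fun l l' hl => div_le_div_of_nonneg_right (ht hl)
    (Nat.cast_nonneg n)) (fun l => div_nonneg (ht0 l) (Nat.cast_nonneg n))] at h
  rw [radialNorm, Complex.ofReal_mul, mul_assoc]
  exact h

theorem integrable_gasDensity_mul_exp_count {m : ℕ} {α : ℝ} (hα : 0 < α) (t : Fin m → ℝ)
    (n : ℕ) (u : Fin m → ℂ) :
    Integrable fun z : Fin n → ℂ =>
        (gasDensity α n z : ℂ) * ∏ j, Complex.exp (u j * (count (radius (t j) n) z : ℂ)) := by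
  simp only [gasDensity_mul_exp_count]
  exact integrable_vandermonde_weight (integrable_tiltedWeight hα u _)

theorem integrable_gasDensity {α : ℝ} (hα : 0 < α) (n : ℕ) : Integrable (gasDensity α n) := by
  have h := (integrable_gasDensity_mul_exp_count hα (Fin.elim0 : Fin 0 → ℝ) n Fin.elim0).re
  simpa using h

theorem integral_gasDensity {α : ℝ} (hα : 0 < α) (n : ℕ) :
    ∫ z, gasDensity α n z = (n.factorial : ℝ) * ∏ k : Fin n, radialNorm α k := by
  -- The normalizing constant is the tilted integral with no radii, m = 0.
  have h := integral_gasDensity_mul_exp_count hα (t := (Fin.elim0 : Fin 0 → ℝ))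
    (fun i => i.elim0) (fun i => i.elim0) n Fin.elim0
  simp only [Finset.univ_eq_empty, Finset.prod_empty, mul_one, modulusFactor, Finset.sum_empty,
    add_zero, Finset.prod_const_one] at h
  rw [integral_complex_ofReal] at h
  exact_mod_cast h

theorem gasWeight_univ {α : ℝ} (hα : 0 < α) (n : ℕ) :
    gasWeight α n Set.univ =
      ENNReal.ofReal ((n.factorial : ℝ) * ∏ k : Fin n, radialNorm α k) := by
  rw [gasWeight, withDensity_apply _ MeasurableSet.univ, Measure.restrict_univ,
    ← ofReal_integral_eq_lintegral_ofReal (integrable_gasDensity hα n)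
      (Eventually.of_forall (gasDensity_nonneg α n)), integral_gasDensity hα]

/-- The moment generating function factorizes over the independent moduli. -/
theorem mgf_eq_prod {m : ℕ} {α : ℝ} (hα : 0 < α) {t : Fin m → ℝ}
    (ht : Antitone t) (ht0 : ∀ l, 0 ≤ t l) (n : ℕ) (u : Fin m → ℂ) :
    mgf α t n u =
      ∏ k ∈ Finset.range n, modulusFactor α (fun l => min (t l / n) 1) u (k + 1) := by
  have hZ : 0 < (n.factorial : ℝ) * ∏ k : Fin n, radialNorm α k :=
    mul_pos (by exact_mod_cast n.factorial_pos)
      (Finset.prod_pos fun k _ => radialNorm_pos hα k)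
  rw [mgf, gasLaw, integral_smul_measure, gasWeight_univ hα, ENNReal.toReal_inv,
    ENNReal.toReal_ofReal hZ.le, gasWeight,
    integral_withDensity_eq_integral_toReal_smul
      (measurable_gasDensity α n).ennreal_ofReal (by simp)]
  have h : ∀ z : Fin n → ℂ, (ENNReal.ofReal (gasDensity α n z)).toReal •
      ∏ j, Complex.exp (u j * (count (radius (t j) n) z : ℂ)) =
      (gasDensity α n z : ℂ) * ∏ j, Complex.exp (u j * (count (radius (t j) n) z : ℂ)) := by
    intro z
    rw [ENNReal.toReal_ofReal (gasDensity_nonneg α n z), Complex.real_smul]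
  simp only [h]
  rw [integral_gasDensity_mul_exp_count hα ht ht0, Complex.real_smul, ← mul_assoc,
    ← Complex.ofReal_mul, inv_mul_cancel₀ hZ.ne', Complex.ofReal_one, one_mul]

/-! ### Analyticity and positivity of the moment generating function -/

theorem analyticOnNhd_coeff {m : ℕ} (l : Fin m) :
    AnalyticOnNhd ℂ (fun u : Fin m → ℂ => coeff u l) Set.univ := by
  have h : ∀ j : Fin m, AnalyticOnNhd ℂ (fun u : Fin m → ℂ => u j) Set.univ := fun j =>
    (ContinuousLinearMap.proj (R := ℂ) (φ := fun _ : Fin m => ℂ) j).analyticOnNhd _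
  unfold coeff
  refine AnalyticOnNhd.mul ((h l).cexp.sub analyticOnNhd_const) ?_
  exact (Finset.analyticOnNhd_fun_sum _ fun j _ => h j).cexp

theorem analyticOnNhd_modulusFactor {m : ℕ} (α : ℝ) (ε : Fin m → ℝ) (k : ℕ) :
    AnalyticOnNhd ℂ (fun u : Fin m → ℂ => modulusFactor α ε u k) Set.univ := by
  unfold modulusFactor
  exact analyticOnNhd_const.add (Finset.analyticOnNhd_fun_sum _ fun l _ =>
    (analyticOnNhd_coeff l).mul analyticOnNhd_const)

theorem analyticOnNhd_mgf {m : ℕ} {α : ℝ} (hα : 0 < α) {t : Fin m → ℝ}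
    (ht : Antitone t) (ht0 : ∀ l, 0 ≤ t l) (n : ℕ) :
    AnalyticOnNhd ℂ (mgf α t n) Set.univ := by
  have : mgf α t n = fun u => ∏ k ∈ Finset.range n,
      modulusFactor α (fun l => min (t l / n) 1) u (k + 1) :=
    funext fun u => mgf_eq_prod hα ht ht0 n u
  rw [this]
  exact Finset.analyticOnNhd_fun_prod _ fun k _ => analyticOnNhd_modulusFactor _ _ _

theorem coeff_ofReal {m : ℕ} (u : Fin m → ℝ) (l : Fin m) :
    coeff (fun j => (u j : ℂ)) l =
      (((Real.exp (u l) - 1) * Real.exp (∑ j ∈ Finset.Ioi l, u j) : ℝ) : ℂ) := by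
  unfold coeff
  push_cast
  rfl

theorem modulusFactor_ofReal {m : ℕ} {α : ℝ} (hα : 0 < α) (u : Fin m → ℝ) {ε : Fin m → ℝ}
    (hε : Antitone ε) (h0 : ∀ l, 0 ≤ ε l) (h1 : ∀ l, ε l ≤ 1) {k : ℕ} (hk : 0 < k) :
    ∃ p : ℝ, 0 < p ∧ modulusFactor α ε (fun j => (u j : ℂ)) k = p := by
  refine ⟨(modulusFactor α ε (fun j => (u j : ℂ)) k).re, ?_, ?_⟩
  · refine lt_of_lt_of_le ?_ (re_modulusFactor_ge hα le_rfl (by simp) hε h0 h1 hk)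
    exact mul_pos (Real.exp_pos _) Real.cos_one_pos
  · unfold modulusFactor
    simp only [coeff_ofReal]
    norm_cast

theorem mgf_ofReal_pos {m : ℕ} {α : ℝ} (hα : 0 < α) {t : Fin m → ℝ}
    (ht : Antitone t) (ht0 : ∀ l, 0 ≤ t l) (n : ℕ) (u : Fin m → ℝ) :
    ∃ p : ℝ, 0 < p ∧ mgf α t n (fun j => (u j : ℂ)) = p := by
  have h : ∀ k : ℕ, ∃ p : ℝ, 0 < p ∧
      modulusFactor α (fun l => min (t l / n) 1) (fun j => (u j : ℂ)) (k + 1) = p := fun k =>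
    modulusFactor_ofReal hα u (fun l l' hl => min_le_min_right _
      (div_le_div_of_nonneg_right (ht hl) (Nat.cast_nonneg n)))
      (fun l => le_min (div_nonneg (ht0 l) (Nat.cast_nonneg n)) zero_le_one)
      (fun l => min_le_right _ _) k.succ_pos
  choose p hp hp' using h
  refine ⟨∏ k ∈ Finset.range n, p k, Finset.prod_pos fun k _ => hp k, ?_⟩
  rw [mgf_eq_prod hα ht ht0]
  simp only [hp']
  push_cast
  rfl

/-! ### Asymptotics of the Gamma ratio -/

theorem abs_log_one_add_sub_le {y : ℝ} (hy : 0 ≤ y) : |Real.log (1 + y) - (y - y ^ 2 / 2)| ≤ y ^ 3 := by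
  set f : ℝ → ℝ := fun y => Real.log (1 + y) - (y - y ^ 2 / 2) with hf
  have hd : ∀ x : ℝ, 0 ≤ x → HasDerivAt f (1 / (1 + x) - (1 - x)) x := by
    intro x hx
    have h1 : HasDerivAt (fun y : ℝ => Real.log (1 + y)) (1 / (1 + x)) x :=
      ((hasDerivAt_id x).const_add 1).log (by simp; linarith)
    have h2 : HasDerivAt (fun y : ℝ => y - y ^ 2 / 2) (1 - x) x := by
      have := (hasDerivAt_id x).sub (((hasDerivAt_id x).pow 2).div_const 2)
      convert! this using 1
      simp
    exact h1.sub h2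
  have hb : ∀ x ∈ Set.Icc (0 : ℝ) y, ‖1 / (1 + x) - (1 - x)‖ ≤ y ^ 2 := by
    intro x hx
    have h1 : 1 / (1 + x) - (1 - x) = x ^ 2 / (1 + x) := by
      have : (1 + x) ≠ 0 := by linarith [hx.1]
      field_simp
      ring
    rw [h1, Real.norm_of_nonneg (by have := hx.1; positivity)]
    have h2 : x ^ 2 ≤ y ^ 2 := by nlinarith [hx.1, hx.2]
    exact (div_le_self (sq_nonneg x) (by linarith [hx.1])).trans h2
  have := (convex_Icc (0 : ℝ) y).norm_image_sub_le_of_norm_hasDerivWithin_le (f := f)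
    (fun x hx => (hd x hx.1).hasDerivWithinAt) hb ⟨le_rfl, hy⟩ ⟨hy, le_rfl⟩
  have h0 : f 0 = 0 := by simp [hf]
  rw [h0, sub_zero, sub_zero, Real.norm_eq_abs, Real.norm_of_nonneg hy] at this
  calc _ ≤ y ^ 2 * y := this
    _ = y ^ 3 := by ring

theorem Gamma_nat_add_one_add_eq_prod {α : ℝ} (hα : 0 < α) (n : ℕ) :
    Real.Gamma (n + 1 + α) = Real.Gamma α * ∏ j ∈ Finset.range (n + 1), (α + j) := by
  induction n with
  | zero => simp [add_comm (1 : ℝ), Real.Gamma_add_one hα.ne', mul_comm]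
  | succ n ih =>
    rw [Finset.prod_range_succ, ← mul_assoc, ← ih]
    push_cast
    rw [show (n : ℝ) + 1 + 1 + α = (n + 1 + α) + 1 by ring, Real.Gamma_add_one (by positivity)]
    ring

/-- The ratio `Γ(k + α) / (Γ(k) k ^ α)`. -/
def gammaRatio (α : ℝ) (k : ℕ) : ℝ := Real.Gamma (k + α) / (Real.Gamma k * (k : ℝ) ^ α)

theorem gammaRatio_pos {α : ℝ} (hα : 0 < α) {k : ℕ} (hk : 0 < k) : 0 < gammaRatio α k := by
  have hk' : (0 : ℝ) < k := by exact_mod_cast hk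
  have h1 : 0 < Real.Gamma k := Real.Gamma_pos_of_pos hk'
  have h3 : 0 < Real.Gamma (k + α) := Real.Gamma_pos_of_pos (by positivity)
  unfold gammaRatio
  positivity

/-- Euler's limit formula for Γ(α): the ratio equals Γ(α) / `Real.GammaSeq` times k/(k + α). -/
theorem tendsto_gammaRatio {α : ℝ} (hα : 0 < α) :
    Tendsto (gammaRatio α) atTop (nhds 1) := by
  have h1 := Real.GammaSeq_tendsto_Gamma α
  have hG : Real.Gamma α ≠ 0 := (Real.Gamma_pos_of_pos hα).ne'
  have h2 : Tendsto (fun k : ℕ => (k : ℝ) / (k + α)) atTop (nhds 1) :=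
    tendsto_natCast_div_add_atTop α
  have h3 := ((tendsto_const_nhds (x := Real.Gamma α)).div h1 hG).mul h2
  rw [div_self hG, one_mul] at h3
  refine h3.congr' ?_
  filter_upwards [eventually_gt_atTop 0] with k hk
  have hk' : (0 : ℝ) < k := by exact_mod_cast hk
  have h4 : Real.Gamma (k + α) = Real.Gamma (k + 1 + α) / (k + α) := by
    rw [show (k : ℝ) + 1 + α = (k + α) + 1 by ring, Real.Gamma_add_one (by positivity)]
    field_simp
  have h5 : Real.Gamma k = k.factorial / k := by
    have := Real.Gamma_add_one hk'.ne'
    rw [Real.Gamma_nat_eq_factorial] at this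
    rw [this]
    field_simp
  have h6 : ∏ j ∈ Finset.range (k + 1), (α + j) ≠ 0 :=
    Finset.prod_ne_zero_iff.mpr fun j _ => by positivity
  have h7 : (k.factorial : ℝ) ≠ 0 := by exact_mod_cast k.factorial_ne_zero
  have h8 : (k : ℝ) ^ α ≠ 0 := (Real.rpow_pos_of_pos hk' _).ne'
  rw [gammaRatio, h4, h5, Gamma_nat_add_one_add_eq_prod hα]
  simp only [Pi.div_apply, Real.GammaSeq]
  field_simp

/-- The error `T` tends to 0, and its increments are O(k⁻³): the k⁻² term of log(1 + α/k) - α log(1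
+ 1/k) is cancelled by the increment of β/k, with β = α(α - 1)/2. Summing the increments from k to
infinity gives O(k⁻²). -/
theorem abs_log_gammaRatio_sub_le {α : ℝ} (hα : 0 < α) :
    ∃ A : ℝ, 0 ≤ A ∧ ∀ k : ℕ, 0 < k →
      |Real.log (gammaRatio α k) - α * (α - 1) / 2 / k| ≤ A / (k : ℝ) ^ 2 := by
  set β := α * (α - 1) / 2 with hβ
  set T : ℕ → ℝ := fun k => Real.log (gammaRatio α k) - β / k with hT
  set A := α ^ 3 + α + |β| with hA
  have hA0 : 0 ≤ A := by positivity
  have step : ∀ k : ℕ, 0 < k → |T (k + 1) - T k| ≤ A / (k : ℝ) ^ 3 := by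
    intro k hk
    have hk' : (0 : ℝ) < k := by exact_mod_cast hk
    have hr : gammaRatio α (k + 1) = gammaRatio α k * (1 + α / k) / (1 + 1 / k) ^ α := by
      have h1 : Real.Gamma k ≠ 0 := (Real.Gamma_pos_of_pos hk').ne'
      have h2 : Real.Gamma (k + α) ≠ 0 := (Real.Gamma_pos_of_pos (by positivity)).ne'
      have h3 : (1 + 1 / (k : ℝ)) = (k + 1) / k := by field_simp
      have h8 : (k : ℝ) ^ α ≠ 0 := (Real.rpow_pos_of_pos hk' _).ne'
      have h9 : ((k : ℝ) + 1) ^ α ≠ 0 := (Real.rpow_pos_of_pos (by positivity) _).ne'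
      rw [h3, Real.div_rpow (by positivity) hk'.le, gammaRatio, gammaRatio]
      push_cast
      rw [show (k : ℝ) + 1 + α = (k + α) + 1 by ring, Real.Gamma_add_one (by positivity),
        Real.Gamma_add_one hk'.ne']
      field_simp
    have hl : T (k + 1) - T k = Real.log (1 + α / k) - α * Real.log (1 + 1 / k)
        + β / (k * (k + 1)) := by
      simp only [hT]
      rw [hr, Real.log_div (mul_pos (gammaRatio_pos hα hk) (by positivity)).ne'
        (Real.rpow_pos_of_pos (by positivity) _).ne', Real.log_mul (gammaRatio_pos hα hk).ne'
        (by positivity), Real.log_rpow (by positivity)]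
      push_cast
      field_simp
      ring
    have e1 := abs_log_one_add_sub_le (y := α / k) (by positivity)
    have e2 := abs_log_one_add_sub_le (y := 1 / k) (by positivity)
    have e3 : T (k + 1) - T k = (Real.log (1 + α / k) - (α / k - (α / k) ^ 2 / 2))
        - α * (Real.log (1 + 1 / k) - (1 / k - (1 / k) ^ 2 / 2)) - β / (k ^ 2 * (k + 1)) := by
      rw [hl, hβ]
      field_simp
      ring
    rw [e3]
    have e4 : |β / ((k : ℝ) ^ 2 * (k + 1))| ≤ |β| / (k : ℝ) ^ 3 := by
      rw [abs_div, abs_of_pos (show (0 : ℝ) < k ^ 2 * (k + 1) by positivity)]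
      refine div_le_div_of_nonneg_left (abs_nonneg _) (by positivity) ?_
      nlinarith [sq_nonneg (k : ℝ)]
    refine (abs_sub _ _).trans ((add_le_add ((abs_sub _ _).trans
      (add_le_add e1 ?_)) e4).trans_eq (?_ : (α / k) ^ 3 + α * (1 / k) ^ 3 + _ = _))
    · rw [abs_mul, abs_of_pos hα]
      exact mul_le_mul_of_nonneg_left e2 hα.le
    · rw [hA]; field_simp
  have step2 : ∀ k : ℕ, 0 < k → |T (k + 1) - T k| ≤ 2 * A / (k : ℝ) ^ 2 - 2 * A / ((k + 1 : ℕ) : ℝ) ^ 2 := by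
    intro k hk
    have hk' : (1 : ℝ) ≤ k := by exact_mod_cast hk
    refine (step k hk).trans ?_
    have : 2 * A / (k : ℝ) ^ 2 - 2 * A / ((k + 1 : ℕ) : ℝ) ^ 2 - A / (k : ℝ) ^ 3 =
        A * (3 * k ^ 2 - 1) / (k ^ 3 * (k + 1) ^ 2) := by
      push_cast
      field_simp
      ring
    have h2 : 0 ≤ A * (3 * k ^ 2 - 1) / ((k : ℝ) ^ 3 * (k + 1) ^ 2) :=
      div_nonneg (mul_nonneg hA0 (by nlinarith)) (by positivity)
    linarith
  have hTlim : Tendsto T atTop (nhds 0) := by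
    have h1 := (Real.continuousAt_log one_ne_zero).tendsto.comp (tendsto_gammaRatio hα)
    rw [Real.log_one] at h1
    simpa using h1.sub (tendsto_const_div_atTop_nhds_zero_nat β)
  have hq : Tendsto (fun k : ℕ => 2 * A / (k : ℝ) ^ 2) atTop (nhds 0) :=
    tendsto_const_nhds.div_atTop ((tendsto_pow_atTop two_ne_zero).comp tendsto_natCast_atTop_atTop)
  refine ⟨2 * A, by positivity, fun k hk => ?_⟩
  -- T - 2A/k² increases and T + 2A/k² decreases along k, and both tend to 0; hence T - 2A/k² ≤ 0 ≤
  -- T + 2A/k².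
  have mono1 : ∀ j, T (k + j) - 2 * A / ((k + j : ℕ) : ℝ) ^ 2 ≥ T k - 2 * A / (k : ℝ) ^ 2 := by
    intro j
    induction j with
    | zero => simp
    | succ j ih =>
      have := (abs_le.mp (step2 (k + j) (by omega))).1
      rw [← add_assoc]
      linarith
  have mono2 : ∀ j, T (k + j) + 2 * A / ((k + j : ℕ) : ℝ) ^ 2 ≤ T k + 2 * A / (k : ℝ) ^ 2 := by
    intro j
    induction j with
    | zero => simp
    | succ j ih =>
      have := (abs_le.mp (step2 (k + j) (by omega))).2
      rw [← add_assoc]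
      linarith
  have hsh : Tendsto (fun j : ℕ => k + j) atTop atTop := by
    simpa only [add_comm k] using tendsto_add_atTop_nat k
  have l1 := (hTlim.sub hq).comp hsh
  have l2 := (hTlim.add hq).comp hsh
  have r1 := ge_of_tendsto' l1 mono1
  have r2 := le_of_tendsto' l2 mono2
  rw [abs_le]
  constructor <;> simp only [hT] at r1 r2 <;> linarith

theorem abs_exp_sub_one_sub_le (y : ℝ) : |Real.exp y - 1 - y| ≤ y ^ 2 * Real.exp |y| := by
  have h := Complex.norm_exp_sub_sum_le_norm_mul_exp (y : ℂ) 2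
  simp only [Finset.sum_range_succ, Finset.sum_range_zero, pow_zero, Nat.factorial_zero,
    pow_one, Nat.factorial_one, Nat.cast_one, div_one, zero_add, Complex.norm_real] at h
  rw [Real.norm_eq_abs, sq_abs, ← Complex.ofReal_exp] at h
  have h2 : ‖((Real.exp y - 1 - y : ℝ) : ℂ)‖ = |Real.exp y - 1 - y| := Complex.norm_real _
  rw [← h2]
  refine le_trans (le_of_eq ?_) h
  congr 1
  push_cast
  ring

theorem abs_gammaRatio_sub_le {α : ℝ} (hα : 0 < α) :
    ∃ C : ℝ, 0 ≤ C ∧ ∀ k : ℕ, 0 < k →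
      |gammaRatio α k - (1 + α * (α - 1) / 2 / k)| ≤ C / (k : ℝ) ^ 2 := by
  obtain ⟨A, hA, h⟩ := abs_log_gammaRatio_sub_le hα
  set β := α * (α - 1) / 2
  refine ⟨(A + |β|) ^ 2 * Real.exp (A + |β|) + A, by positivity, fun k hk => ?_⟩
  have hk' : (1 : ℝ) ≤ k := by exact_mod_cast hk
  set y := Real.log (gammaRatio α k) with hy
  have hy1 : |y - β / k| ≤ A / (k : ℝ) ^ 2 := h k hk
  have hy2 : |y| ≤ (A + |β|) / k := by
    have h1 : |y| ≤ |y - β / k| + |β / k| := by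
      simpa using abs_add_le (y - β / k) (β / k)
    have h2 : A / (k : ℝ) ^ 2 ≤ A / k :=
      div_le_div_of_nonneg_left hA (by positivity) (by nlinarith)
    rw [abs_div, abs_of_nonneg (by positivity : (0 : ℝ) ≤ k)] at h1
    rw [add_div]
    linarith
  have hy3 : |y| ≤ A + |β| := hy2.trans (div_le_self (by positivity) hk')
  have he := abs_exp_sub_one_sub_le y
  rw [hy, Real.exp_log (gammaRatio_pos hα hk), ← hy] at he
  have h4 : y ^ 2 * Real.exp |y| ≤ (A + |β|) ^ 2 * Real.exp (A + |β|) / (k : ℝ) ^ 2 := by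
    rw [mul_div_right_comm, ← div_pow, ← sq_abs]
    gcongr
  calc |gammaRatio α k - (1 + β / k)|
      = |(gammaRatio α k - 1 - y) + (y - β / k)| := by congr 1; ring
    _ ≤ _ := abs_add_le _ _
    _ ≤ (A + |β|) ^ 2 * Real.exp (A + |β|) / (k : ℝ) ^ 2 + A / (k : ℝ) ^ 2 :=
        add_le_add (he.trans h4) hy1
    _ = _ := by ring

/-! ### Expansion of Beta tails around the incomplete Gamma function -/

/-- The normalized lower incomplete Gamma function. -/
def gammaP (a x : ℝ) : ℝ := (∫ s in (0 : ℝ)..x, s ^ (a - 1) * Real.exp (-s)) / Real.Gamma a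

/-- The `1 / n` correction to `gammaQ α (t * x)`. -/
def gammaCorr (α t x : ℝ) : ℝ :=
  x ^ (α - 1) / Real.Gamma α * (t ^ α * Real.exp (-(t * x)) * ((1 - α - t * x) / 2))

theorem intervalIntegrable_rpow_mul {α : ℝ} (hα : 0 < α) {f : ℝ → ℝ} (hf : Continuous f)
    (a b : ℝ) : IntervalIntegrable (fun v : ℝ => v ^ (α - 1) * f v) volume a b :=
  (intervalIntegral.intervalIntegrable_rpow' (by linarith)).mul_continuousOn hf.continuousOn

theorem integral_rpow_sub_one {α : ℝ} (hα : 0 < α) (t : ℝ) :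
    ∫ v in (0 : ℝ)..t, v ^ (α - 1) = t ^ α / α := by
  rw [integral_rpow (Or.inl (by linarith)), sub_add_cancel, Real.zero_rpow hα.ne', sub_zero]

theorem gammaQ_eq_one_sub {α : ℝ} (hα : 0 < α) {x : ℝ} (hx : 0 ≤ x) :
    gammaQ α x = 1 - gammaP α x := by
  have hG : Real.Gamma α ≠ 0 := (Real.Gamma_pos_of_pos hα).ne'
  have h := Real.GammaIntegral_convergent hα
  have hcomm : ∀ s : ℝ, s ^ (α - 1) * Real.exp (-s) = Real.exp (-s) * s ^ (α - 1) :=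
    fun s => mul_comm _ _
  have h1 := intervalIntegral.integral_interval_add_Ioi (a := 0) (b := x)
    (f := fun s : ℝ => Real.exp (-s) * s ^ (α - 1)) h
    (h.mono_set (Set.Ioi_subset_Ioi hx))
  rw [← Real.Gamma_eq_integral hα] at h1
  rw [gammaQ, gammaP, eq_sub_iff_add_eq, ← add_div, div_eq_one_iff_eq hG]
  simp only [hcomm]
  linarith

theorem rescale_integral {α c : ℝ} (hc : 0 < c) (f : ℝ → ℝ) {t : ℝ} (ht : 0 ≤ t) :
    ∫ s in (0 : ℝ)..(c * t), s ^ (α - 1) * f s =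
      c ^ α * ∫ v in (0 : ℝ)..t, v ^ (α - 1) * f (c * v) := by
  have h := intervalIntegral.mul_integral_comp_mul_left (a := 0) (b := t)
    (f := fun s : ℝ => s ^ (α - 1) * f s) c
  rw [mul_zero] at h
  rw [← h, ← intervalIntegral.integral_const_mul, ← intervalIntegral.integral_const_mul]
  refine intervalIntegral.integral_congr fun v hv => ?_
  rw [Set.uIcc_of_le ht] at hv
  rw [Real.mul_rpow hc.le hv.1, Real.rpow_sub_one hc.ne']
  field_simp

theorem gammaP_mul_eq {α x : ℝ} (hx : 0 < x) {t : ℝ} (ht : 0 ≤ t) :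
    gammaP α (t * x) =
      x ^ α * (∫ v in (0 : ℝ)..t, v ^ (α - 1) * Real.exp (-(x * v))) / Real.Gamma α := by
  rw [gammaP, mul_comm t x, rescale_integral hx (fun s => Real.exp (-s)) ht]

/-- After scaling by n, the Beta tail is an integral over [0, t] against v^(α-1), as is `gammaP` in
`gammaP_mul_eq`. What remains to compare is (1 - v/n)^(k-1) with e^(-xv), and the Gamma ratio with
1. -/
theorem betaTail_div_eq {α : ℝ} {n k : ℕ} (hn : 0 < n) (hk : 0 < k) {t : ℝ}
    (ht : 0 ≤ t) :
    betaTail α (t / n) k = ((k : ℝ) / n) ^ α * gammaRatio α k *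
      (∫ v in (0 : ℝ)..t, v ^ (α - 1) * (1 - 1 / (n : ℝ) * v) ^ (k - 1)) / Real.Gamma α := by
  have hn' : (0 : ℝ) < n := by exact_mod_cast hn
  have hk' : (0 : ℝ) < k := by exact_mod_cast hk
  have h := rescale_integral (α := α) (c := 1 / n) (by positivity) (fun s => (1 - s) ^ (k - 1)) ht
  rw [betaTail, show t / n = 1 / n * t by ring, h, gammaRatio,
    Real.div_rpow hk'.le hn'.le, Real.div_rpow zero_le_one hn'.le, Real.one_rpow]
  have h8 : (k : ℝ) ^ α ≠ 0 := (Real.rpow_pos_of_pos hk' _).ne'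
  field_simp

/-- The bracket collects the first-order terms of the Gamma ratio and of (1 - v/n)^(k-1). Its
integrand is the exact derivative of `F`, so only the boundary value at t remains. -/
theorem gammaCorr_eq_integral {α x : ℝ} (hα : 0 < α) {t : ℝ} (ht : 0 ≤ t) :
    gammaCorr α t x = -(x ^ (α - 1) / Real.Gamma α) *
      ((α * (α - 1) / 2) * (∫ v in (0 : ℝ)..t, v ^ (α - 1) * Real.exp (-(x * v))) +
      x * ∫ v in (0 : ℝ)..t, v ^ (α - 1) * (Real.exp (-(x * v)) * (v - x * v ^ 2 / 2))) := by
  have i1 := intervalIntegrable_rpow_mul hα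
    (f := fun v => Real.exp (-(x * v))) (by fun_prop) 0 t
  have i2 := intervalIntegrable_rpow_mul hα
    (f := fun v => Real.exp (-(x * v)) * (v - x * v ^ 2 / 2)) (by fun_prop) 0 t
  rw [← intervalIntegral.integral_const_mul, ← intervalIntegral.integral_const_mul,
    ← intervalIntegral.integral_add (i1.const_mul _) (i2.const_mul _)]
  set F : ℝ → ℝ := fun v => -(v ^ α * (Real.exp (-(x * v)) * ((1 - α - x * v) / 2))) with hF
  have hFc : Continuous F := by
    have h : Continuous fun v : ℝ => v ^ α := Real.continuous_rpow_const hα.le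
    exact (h.mul (by fun_prop)).neg
  have hd : ∀ v ∈ Set.Ioo (0 : ℝ) t, HasDerivAt F
      (α * (α - 1) / 2 * (v ^ (α - 1) * Real.exp (-(x * v))) +
        x * (v ^ (α - 1) * (Real.exp (-(x * v)) * (v - x * v ^ 2 / 2)))) v := by
    intro v hv
    have hv0 : (0 : ℝ) < v := hv.1
    have d1 : HasDerivAt (fun v : ℝ => v ^ α) (α * v ^ (α - 1)) v :=
      Real.hasDerivAt_rpow_const (Or.inl hv0.ne')
    have d0 : HasDerivAt (fun v : ℝ => x * v) x v := by
      simpa using (hasDerivAt_id v).const_mul x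
    have d2 : HasDerivAt (fun v : ℝ => Real.exp (-(x * v))) (Real.exp (-(x * v)) * -x) v :=
      d0.neg.exp
    have d3 : HasDerivAt (fun v : ℝ => (1 - α - x * v) / 2) (-x / 2) v :=
      (d0.const_sub (1 - α)).div_const 2
    have h := (d1.fun_mul (d2.fun_mul d3)).fun_neg
    refine h.congr_deriv ?_
    have e : v ^ α = v * v ^ (α - 1) := by
      rw [Real.rpow_sub_one hv0.ne']; field_simp
    rw [e]
    ring
  have hFTC := intervalIntegral.integral_eq_sub_of_hasDerivAt_of_le ht hFc.continuousOn hd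
    ((i1.const_mul _).add (i2.const_mul _))
  rw [hFTC]
  simp only [hF, gammaCorr, Real.zero_rpow hα.ne', mul_comm t x]
  ring

theorem abs_log_one_sub_add_le {s : ℝ} (h0 : 0 ≤ s) (h1 : s ≤ 1 / 2) :
    |Real.log (1 - s) + s + s ^ 2 / 2| ≤ 2 * s ^ 3 := by
  have h := Real.abs_log_sub_add_sum_range_le (x := s) (by rw [abs_of_nonneg h0]; linarith) 2
  simp only [Finset.sum_range_succ, Finset.sum_range_zero, abs_of_nonneg h0] at h
  norm_num at h
  have h2 : s ^ 3 / (1 - s) ≤ 2 * s ^ 3 := by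
    rw [div_le_iff₀ (by linarith)]
    nlinarith [pow_nonneg h0 3]
  refine le_trans (le_of_eq ?_) (h.trans h2)
  congr 1
  ring

set_option maxHeartbeats 1000000 in
/-- Second-order expansion of `(1 - v / n) ^ (k - 1)` around `exp (- v k / n)`. -/
theorem abs_one_sub_pow_sub_le {t : ℝ} (ht : 0 ≤ t) :
    ∃ C : ℝ, 0 ≤ C ∧ ∀ n k : ℕ, 0 < n → 2 * t ≤ n → 0 < k → k ≤ n → ∀ v ∈ Set.Icc (0 : ℝ) t,
      |(1 - 1 / (n : ℝ) * v) ^ (k - 1) - (Real.exp (-((k : ℝ) / n * v)) +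
        1 / n * (Real.exp (-((k : ℝ) / n * v)) * (v - (k : ℝ) / n * v ^ 2 / 2)))| ≤
      C * (1 / (n : ℝ)) ^ 2 := by
  set A := t ^ 2 / 2 + 2 * t ^ 3 with hA
  set B := t + t ^ 2 / 2 + A with hB
  have hA0 : 0 ≤ A := by positivity
  have hB0 : 0 ≤ B := by positivity
  refine ⟨B ^ 2 * Real.exp B + A, by positivity, fun n k hn hnt hk hkn v hv => ?_⟩
  have hn' : (1 : ℝ) ≤ n := by exact_mod_cast hn
  have hk' : (1 : ℝ) ≤ k := by exact_mod_cast hk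
  have hkn' : (k : ℝ) ≤ n := by exact_mod_cast hkn
  set h : ℝ := 1 / n with hh
  set x : ℝ := (k : ℝ) / n with hx
  have hh0 : 0 < h := by positivity
  have hh1 : h ≤ 1 := by rw [hh, div_le_one (by linarith)]; exact hn'
  have hx0 : 0 < x := by positivity
  have hx1 : x ≤ 1 := by rw [hx, div_le_one (by linarith)]; exact hkn'
  have hxk : x = k * h := by rw [hx, hh]; ring
  have hht : h * t ≤ 1 / 2 := by
    rw [hh, div_mul_eq_mul_div, one_mul, div_le_iff₀ (by linarith)]; linarith
  have hv0 := hv.1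
  have hvt := hv.2
  have hs0 : 0 ≤ h * v := by positivity
  have hs1 : h * v ≤ 1 / 2 := (mul_le_mul_of_nonneg_left hvt hh0.le).trans hht
  set r := Real.log (1 - h * v) + h * v + (h * v) ^ 2 / 2 with hr
  have hr1 : |r| ≤ 2 * (h * v) ^ 3 := abs_log_one_sub_add_le hs0 hs1
  -- `z` is (k - 1) log(1 - hv) + xv. The exponent k - 1 instead of k supplies the terms hv and
  -- h²v²/2.
  set z := h * (v - x * v ^ 2 / 2) + (h ^ 2 * v ^ 2 / 2 + (x - h) / h * r) with hz
  have hlog : (1 - h * v) ^ (k - 1) = Real.exp (-(x * v)) * Real.exp z := by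
    rw [← Real.exp_add, ← Real.exp_log (show 0 < 1 - h * v by linarith), ← Real.exp_nat_mul]
    congr 1
    rw [Nat.cast_sub hk, hz, hr, hxk]
    push_cast
    field_simp
    ring
  have hrem : |h ^ 2 * v ^ 2 / 2 + (x - h) / h * r| ≤ A * h ^ 2 := by
    refine (abs_add_le _ _).trans ?_
    have e1 : |h ^ 2 * v ^ 2 / 2| ≤ t ^ 2 / 2 * h ^ 2 := by
      rw [abs_of_nonneg (by positivity)]
      have : v ^ 2 ≤ t ^ 2 := pow_le_pow_left₀ hv0 hvt 2
      nlinarith [sq_nonneg h]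
    have hxh : 0 ≤ x - h := by
      rw [hxk]; nlinarith
    have e2 : |(x - h) / h * r| ≤ 2 * t ^ 3 * h ^ 2 := by
      rw [abs_mul, abs_of_nonneg (div_nonneg hxh hh0.le)]
      have h3 : v ^ 3 ≤ t ^ 3 := pow_le_pow_left₀ hv0 hvt 3
      calc (x - h) / h * |r| ≤ 1 / h * (2 * (h * v) ^ 3) := by
            refine mul_le_mul ?_ hr1 (abs_nonneg _) (by positivity)
            exact div_le_div_of_nonneg_right (by linarith) hh0.le
        _ = 2 * v ^ 3 * h ^ 2 := by field_simp
        _ ≤ _ := by gcongr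
    rw [hA, add_mul]
    exact add_le_add e1 e2
  have hmain : |h * (v - x * v ^ 2 / 2)| ≤ (t + t ^ 2 / 2) * h := by
    rw [abs_mul, abs_of_pos hh0, mul_comm]
    refine mul_le_mul_of_nonneg_right ?_ hh0.le
    refine (abs_sub _ _).trans ?_
    have h2 : v ^ 2 ≤ t ^ 2 := pow_le_pow_left₀ hv0 hvt 2
    rw [abs_of_nonneg hv0, abs_of_nonneg (by positivity)]
    have : x * v ^ 2 ≤ t ^ 2 := (mul_le_of_le_one_left (sq_nonneg v) hx1).trans h2
    linarith
  have hzB : |z| ≤ B * h := by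
    refine (abs_add_le _ _).trans ?_
    have : A * h ^ 2 ≤ A * h := by
      exact mul_le_mul_of_nonneg_left (pow_le_of_le_one hh0.le hh1 two_ne_zero) hA0
    rw [hB, add_mul]
    linarith
  have hzB' : |z| ≤ B := hzB.trans (mul_le_of_le_one_right hB0 hh1)
  have hez := abs_exp_sub_one_sub_le z
  have hez2 : z ^ 2 * Real.exp |z| ≤ B ^ 2 * Real.exp B * h ^ 2 := by
    rw [← sq_abs]
    calc |z| ^ 2 * Real.exp |z| ≤ (B * h) ^ 2 * Real.exp B := by gcongr
      _ = _ := by ring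
  have hE : Real.exp (-(x * v)) ≤ 1 := by
    rw [Real.exp_le_one_iff]; nlinarith
  have key : (1 - h * v) ^ (k - 1) - (Real.exp (-(x * v)) +
      h * (Real.exp (-(x * v)) * (v - x * v ^ 2 / 2))) =
      Real.exp (-(x * v)) * ((Real.exp z - 1 - z) + (h ^ 2 * v ^ 2 / 2 + (x - h) / h * r)) := by
    rw [hlog]
    have : z = h * (v - x * v ^ 2 / 2) + (h ^ 2 * v ^ 2 / 2 + (x - h) / h * r) := hz
    linear_combination (- Real.exp (-(x * v))) * this
  rw [key, abs_mul, abs_of_pos (Real.exp_pos _)]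
  calc Real.exp (-(x * v)) * |(Real.exp z - 1 - z) + (h ^ 2 * v ^ 2 / 2 + (x - h) / h * r)|
      ≤ 1 * (|Real.exp z - 1 - z| + |h ^ 2 * v ^ 2 / 2 + (x - h) / h * r|) := by
        refine mul_le_mul hE (abs_add_le _ _) (abs_nonneg _) zero_le_one
    _ ≤ 1 * (B ^ 2 * Real.exp B * h ^ 2 + A * h ^ 2) := by gcongr; exact hez.trans hez2
    _ = _ := by ring

theorem abs_integral_rpow_mul_le {α : ℝ} (hα : 0 < α) {t : ℝ} (ht : 0 ≤ t) {f : ℝ → ℝ} {B : ℝ}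
    (hf : ∀ v ∈ Set.Icc (0 : ℝ) t, |f v| ≤ B) :
    |∫ v in (0 : ℝ)..t, v ^ (α - 1) * f v| ≤ B * (t ^ α / α) := by
  have hi : IntervalIntegrable (fun v : ℝ => v ^ (α - 1) * B) volume 0 t :=
    intervalIntegrable_rpow_mul hα continuous_const 0 t
  have h := intervalIntegral.norm_integral_le_of_norm_le (μ := volume) (a := 0) (b := t)
    (f := fun v : ℝ => v ^ (α - 1) * f v) (g := fun v : ℝ => v ^ (α - 1) * B) ht
    (Eventually.of_forall fun v hv => by
      rw [norm_mul, Real.norm_of_nonneg (Real.rpow_nonneg hv.1.le _), Real.norm_eq_abs]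
      exact mul_le_mul_of_nonneg_left (hf v ⟨hv.1.le, hv.2⟩) (Real.rpow_nonneg hv.1.le _)) hi
  rw [Real.norm_eq_abs, intervalIntegral.integral_mul_const, integral_rpow_sub_one hα] at h
  linarith

set_option maxHeartbeats 1000000 in
/-- Second-order expansion of the Beta tail around the incomplete Gamma function. -/
theorem abs_betaTail_sub_gammaP_le {α : ℝ} (hα : 0 < α) {t : ℝ} (ht : 0 ≤ t) :
    ∃ C : ℝ, 0 ≤ C ∧ ∀ n k : ℕ, 0 < n → 2 * t ≤ n → 0 < k → k ≤ n →
      |betaTail α (t / n) k - gammaP α (t * ((k : ℝ) / n)) + 1 / n * gammaCorr α t ((k : ℝ) / n)| ≤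
        C * (((k : ℝ) / n) ^ (α - 2) * (1 / (n : ℝ)) ^ 2) := by
  obtain ⟨C₁, hC₁, hr⟩ := abs_gammaRatio_sub_le hα
  obtain ⟨C₂, hC₂, he⟩ := abs_one_sub_pow_sub_le ht
  have hG : 0 < Real.Gamma α := Real.Gamma_pos_of_pos hα
  set β := α * (α - 1) / 2 with hβ
  set T := t ^ α / α with hT
  have hT0 : 0 ≤ T := by have := Real.rpow_nonneg ht α; positivity
  set L := t + t ^ 2 / 2 with hL
  have hL0 : 0 ≤ L := by positivity
  set C₃ := |β| * (L * T + C₂ * T) + C₂ * T + C₁ * (T + L * T + C₂ * T) with hC₃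
  have hC₃0 : 0 ≤ C₃ := by positivity
  refine ⟨C₃ / Real.Gamma α, by positivity, fun n k hn hnt hk hkn => ?_⟩
  have hn' : (1 : ℝ) ≤ n := by exact_mod_cast hn
  have hk' : (1 : ℝ) ≤ k := by exact_mod_cast hk
  have hkn' : (k : ℝ) ≤ n := by exact_mod_cast hkn
  have hen := he n k hn hnt hk hkn
  rw [betaTail_div_eq hn hk ht]
  set h : ℝ := 1 / n with hh
  set x : ℝ := (k : ℝ) / n with hx
  have hh0 : 0 < h := by positivity
  have hh1 : h ≤ 1 := by rw [hh, div_le_one (by linarith)]; exact hn'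
  have hx0 : 0 < x := by positivity
  have hx1 : x ≤ 1 := by rw [hx, div_le_one (by linarith)]; exact hkn'
  have hxk : x = k * h := by rw [hx, hh]; ring
  rw [gammaP_mul_eq hx0 ht, gammaCorr_eq_integral hα ht]
  set K := ∫ v in (0 : ℝ)..t, v ^ (α - 1) * Real.exp (-(x * v)) with hK
  set K₁ := ∫ v in (0 : ℝ)..t, v ^ (α - 1) * (Real.exp (-(x * v)) * (v - x * v ^ 2 / 2)) with hK₁
  set J := ∫ v in (0 : ℝ)..t, v ^ (α - 1) * (1 - h * v) ^ (k - 1) with hJ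
  have hE : ∀ v ∈ Set.Icc (0 : ℝ) t, |Real.exp (-(x * v))| ≤ 1 := fun v hv => by
    rw [abs_of_pos (Real.exp_pos _), Real.exp_le_one_iff]
    nlinarith [hv.1]
  have hKb : |K| ≤ T := by
    have := abs_integral_rpow_mul_le hα ht hE
    rwa [one_mul] at this
  have hK₁b : |K₁| ≤ L * T := by
    refine abs_integral_rpow_mul_le hα ht fun v hv => ?_
    rw [abs_mul]
    refine (mul_le_of_le_one_left (abs_nonneg _) (hE v hv)).trans ((abs_sub _ _).trans ?_)
    have hv0 := hv.1
    have h2 : v ^ 2 ≤ t ^ 2 := pow_le_pow_left₀ hv0 hv.2 2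
    rw [abs_of_nonneg hv0, abs_of_nonneg (by positivity)]
    have : x * v ^ 2 ≤ t ^ 2 := (mul_le_of_le_one_left (sq_nonneg v) hx1).trans h2
    linarith [hv.2]
  set e := J - (K + h * K₁) with he'
  have heb : |e| ≤ C₂ * T * h ^ 2 := by
    have i1 := intervalIntegrable_rpow_mul hα
      (f := fun v => Real.exp (-(x * v))) (by fun_prop) 0 t
    have i2 := intervalIntegrable_rpow_mul hα
      (f := fun v => Real.exp (-(x * v)) * (v - x * v ^ 2 / 2)) (by fun_prop) 0 t
    have i3 := intervalIntegrable_rpow_mul hα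
      (f := fun v => (1 - h * v) ^ (k - 1)) (by fun_prop) 0 t
    have : e = ∫ v in (0 : ℝ)..t, v ^ (α - 1) * ((1 - h * v) ^ (k - 1) - (Real.exp (-(x * v)) +
        h * (Real.exp (-(x * v)) * (v - x * v ^ 2 / 2)))) := by
      rw [he', hJ, hK, hK₁, ← intervalIntegral.integral_const_mul,
        ← intervalIntegral.integral_add i1 (i2.const_mul h),
        ← intervalIntegral.integral_sub i3 (i1.add (i2.const_mul h))]
      exact intervalIntegral.integral_congr fun v _ => by ring
    rw [this]
    refine (abs_integral_rpow_mul_le hα ht hen).trans_eq (by ring)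
  have hJe : J = K + h * K₁ + e := by rw [he']; ring
  set r := gammaRatio α k - (1 + β / k) with hr'
  have hrb : |r| ≤ C₁ / (k : ℝ) ^ 2 := hr k hk
  have hre : gammaRatio α k = 1 + β / k + r := by rw [hr']; ring
  have hxa : x ^ (α - 1) = x ^ α / x := Real.rpow_sub_one hx0.ne' α
  have hxb : x ^ (α - 2) * h ^ 2 = x ^ α / (k : ℝ) ^ 2 := by
    rw [show α - 2 = α - (2 : ℕ) by norm_num, Real.rpow_sub_natCast hx0.ne', hxk]
    field_simp
  -- In (1 + β/k + r)(K + hK₁ + e) the terms K, βK/k and hK₁ cancel against `gammaP` and the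
  -- correction, since h x^(α-1) = x^α/k. Because h ≤ 1/k, what is left is O(k⁻²), and x^α/k² =
  -- x^(α-2) h².
  have key : x ^ α * gammaRatio α k * J / Real.Gamma α - x ^ α * K / Real.Gamma α +
      h * (-(x ^ (α - 1) / Real.Gamma α) * (β * K + x * K₁)) =
      x ^ α / Real.Gamma α * (β / k * (h * K₁ + e) + e + r * (K + h * K₁ + e)) := by
    rw [hxa, hre, hJe, hxk]
    field_simp
    ring
  rw [key, hxb, abs_mul, abs_of_pos (by positivity)]
  have hhk : h ≤ 1 / k := by
    rw [hh]; exact one_div_le_one_div_of_le (by linarith) hkn'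
  have hk1 : 1 / (k : ℝ) ≤ 1 := by rw [div_le_one (by linarith)]; exact hk'
  have hb1 : |h * K₁ + e| ≤ (L * T + C₂ * T) * (1 / k) := by
    refine (abs_add_le _ _).trans ?_
    rw [abs_mul, abs_of_pos hh0, add_mul]
    refine add_le_add ?_ (heb.trans ?_)
    · rw [mul_comm]; gcongr
    · have : h ^ 2 ≤ 1 / k := (pow_le_of_le_one hh0.le hh1 two_ne_zero).trans hhk
      gcongr
  have hb2 : |e| ≤ C₂ * T * (1 / k) ^ 2 := heb.trans (by gcongr)
  have hb3 : |K + h * K₁ + e| ≤ T + L * T + C₂ * T := by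
    rw [add_assoc]
    refine (abs_add_le _ _).trans ?_
    have : (L * T + C₂ * T) * (1 / k) ≤ L * T + C₂ * T :=
      mul_le_of_le_one_right (by positivity) hk1
    linarith
  have hfin : |β / k * (h * K₁ + e) + e + r * (K + h * K₁ + e)| ≤ C₃ * (1 / (k : ℝ)) ^ 2 := by
    refine (abs_add_le _ _).trans ((add_le_add (abs_add_le _ _) le_rfl).trans ?_)
    have p1 : |β / k * (h * K₁ + e)| ≤ |β| * (L * T + C₂ * T) * (1 / (k : ℝ)) ^ 2 := by
      rw [abs_mul, abs_div, abs_of_pos (show (0 : ℝ) < k by linarith)]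
      calc |β| / k * |h * K₁ + e| ≤ |β| / k * ((L * T + C₂ * T) * (1 / k)) := by gcongr
        _ = _ := by ring
    have p2 : |r * (K + h * K₁ + e)| ≤ C₁ * (T + L * T + C₂ * T) * (1 / (k : ℝ)) ^ 2 := by
      rw [abs_mul]
      calc |r| * |K + h * K₁ + e| ≤ C₁ / (k : ℝ) ^ 2 * (T + L * T + C₂ * T) := by gcongr
        _ = _ := by ring
    rw [hC₃]
    linarith
  calc x ^ α / Real.Gamma α * |β / k * (h * K₁ + e) + e + r * (K + h * K₁ + e)|
      ≤ x ^ α / Real.Gamma α * (C₃ * (1 / (k : ℝ)) ^ 2) := by gcongr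
    _ = _ := by ring

/-! ### Exact summation of the Beta tails -/

/-- For k > 0, integrating the derivative of v^α (1 - v)^k expresses the difference of two
consecutive tails as a boundary term. -/
theorem betaTail_succ_sub {α : ℝ} (hα : 0 < α) (ε : ℝ) (hε : 0 ≤ ε) (k : ℕ) :
    betaTail α ε (k + 1) - betaTail α ε k =
      ε ^ α * (1 - ε) ^ k * (Real.Gamma (k + α) / (Real.Gamma α * k.factorial)) := by
  have hG : Real.Gamma α ≠ 0 := (Real.Gamma_pos_of_pos hα).ne'
  rcases Nat.eq_zero_or_pos k with rfl | hk
  -- Since `Real.Gamma 0 = 0`, division by zero gives `betaTail α ε 0` the value 0, and with it the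
  -- recursion holds at k = 0 as well.
  · simp only [betaTail, zero_add, Nat.cast_one, Nat.cast_zero, Real.Gamma_zero, zero_mul, div_zero,
      sub_zero, Nat.sub_self, pow_zero, mul_one, Nat.factorial_zero]
    rw [integral_rpow_sub_one hα, add_comm, Real.Gamma_add_one hα.ne', Real.Gamma_one]
    field_simp
  · obtain ⟨j, rfl⟩ : ∃ j, k = j + 1 := ⟨k - 1, by omega⟩
    have i0 := intervalIntegrable_betaTail hα j 0 ε
    have i1 := intervalIntegrable_betaTail hα (j + 1) 0 ε
    have hFc : Continuous fun v : ℝ => v ^ α * (1 - v) ^ (j + 1) :=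
      (Real.continuous_rpow_const hα.le).mul (by fun_prop)
    have hd : ∀ v ∈ Set.Ioo (0 : ℝ) ε, HasDerivAt (fun v : ℝ => v ^ α * (1 - v) ^ (j + 1))
        ((α + (j + 1)) * (v ^ (α - 1) * (1 - v) ^ (j + 1)) -
          (j + 1) * (v ^ (α - 1) * (1 - v) ^ j)) v := by
      intro v hv
      have hv0 : (0 : ℝ) < v := hv.1
      have d1 : HasDerivAt (fun v : ℝ => v ^ α) (α * v ^ (α - 1)) v :=
        Real.hasDerivAt_rpow_const (Or.inl hv0.ne')
      have d2 : HasDerivAt (fun v : ℝ => (1 - v) ^ (j + 1)) ((j + 1 : ℕ) * (1 - v) ^ j * -1) v := by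
        have := ((hasDerivAt_id v).const_sub 1).fun_pow (j + 1)
        simpa using this
      refine (d1.fun_mul d2).congr_deriv ?_
      have e : v ^ α = v * v ^ (α - 1) := by
        rw [Real.rpow_sub_one hv0.ne']; field_simp
      rw [e]
      push_cast
      ring
    have hFTC := intervalIntegral.integral_eq_sub_of_hasDerivAt_of_le hε hFc.continuousOn hd
      ((i1.const_mul _).sub (i0.const_mul _))
    rw [intervalIntegral.integral_sub (i1.const_mul _) (i0.const_mul _),
      intervalIntegral.integral_const_mul, intervalIntegral.integral_const_mul,
      Real.zero_rpow hα.ne', zero_mul, sub_zero] at hFTC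
    have hj : Real.Gamma ((j + 1 : ℕ) : ℝ) = j.factorial := by
      push_cast; exact Real.Gamma_nat_eq_factorial j
    have hj2 : Real.Gamma ((j + 1 + 1 : ℕ) : ℝ) = (j + 1).factorial := by
      rw [Nat.cast_succ]; exact Real.Gamma_nat_eq_factorial (j + 1)
    have hj3 : Real.Gamma (((j + 1 + 1 : ℕ) : ℝ) + α) =
        (j + 1 + α) * Real.Gamma (((j + 1 : ℕ) : ℝ) + α) := by
      push_cast
      rw [show (j : ℝ) + 1 + 1 + α = (j + 1 + α) + 1 by ring, Real.Gamma_add_one (by positivity)]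
    rw [betaTail, betaTail, hj, hj2, hj3, Nat.factorial_succ, Nat.add_sub_cancel, Nat.add_sub_cancel]
    set G := Real.Gamma (((j + 1 : ℕ) : ℝ) + α)
    have hf : (j.factorial : ℝ) ≠ 0 := by exact_mod_cast j.factorial_ne_zero
    have hj0 : (j : ℝ) + 1 ≠ 0 := by positivity
    push_cast
    rw [← hFTC]
    field_simp
    ring

/-- Abel summation: k times the increment of the tail from k to k + 1 is α(1 - ε)/ε times the
increment of the tail with parameter α + 1 from k - 1 to k, so the remaining sum telescopes down to
the default value 0 at index 0. This closed form avoids adding up pointwise errors of size x^(α-2).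
-/
theorem sum_betaTail {α : ℝ} (hα : 0 < α) {ε : ℝ} (hε : 0 < ε) (n : ℕ) :
    ∑ k ∈ Finset.range (n + 1), betaTail α ε (k + 1) =
      (n + 1) * betaTail α ε (n + 1) - α * (1 - ε) / ε * betaTail (α + 1) ε n := by
  have hG : Real.Gamma α ≠ 0 := (Real.Gamma_pos_of_pos hα).ne'
  induction n with
  | zero => simp [betaTail]
  | succ n ih =>
    have h1 := betaTail_succ_sub hα ε hε.le (n + 1)
    have h2 := betaTail_succ_sub (show 0 < α + 1 by linarith) ε hε.le n
    have hf : (n.factorial : ℝ) ≠ 0 := by exact_mod_cast n.factorial_ne_zero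
    have hj0 : (n : ℝ) + 1 ≠ 0 := by positivity
    have h3 : ((n : ℝ) + 1) * (betaTail α ε (n + 1 + 1) - betaTail α ε (n + 1)) =
        α * (1 - ε) / ε * (betaTail (α + 1) ε (n + 1) - betaTail (α + 1) ε n) := by
      rw [h1, h2, Real.Gamma_add_one hα.ne', Real.rpow_add_one hε.ne', Nat.factorial_succ]
      push_cast
      rw [show (n : ℝ) + (α + 1) = n + 1 + α by ring]
      field_simp
      ring
    rw [Finset.sum_range_succ, ih]
    push_cast
    linear_combination (-1 : ℝ) * h3

theorem hasDerivAt_gammaP {α : ℝ} (hα : 0 < α) {y : ℝ} (hy : 0 < y) :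
    HasDerivAt (gammaP α) (y ^ (α - 1) * Real.exp (-y) / Real.Gamma α) y := by
  have hi := intervalIntegrable_rpow_mul hα (f := fun s => Real.exp (-s)) (by fun_prop) 0 y
  have hc : ContinuousAt (fun s : ℝ => s ^ (α - 1) * Real.exp (-s)) y :=
    (Real.continuousAt_rpow_const _ _ (Or.inl hy.ne')).mul (by fun_prop)
  have hm : StronglyMeasurableAtFilter (fun s : ℝ => s ^ (α - 1) * Real.exp (-s)) (nhds y) :=
    ⟨Set.univ, univ_mem, (Measurable.aestronglyMeasurable (by fun_prop))⟩
  exact (intervalIntegral.integral_hasDerivAt_right hi hm hc).div_const _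

theorem hasDerivAt_gammaP_mul {α : ℝ} (hα : 0 < α) {t : ℝ} (ht : 0 ≤ t) {x : ℝ} (hx : 0 < x) :
    HasDerivAt (fun x => gammaP α (t * x))
      (x ^ (α - 1) / Real.Gamma α * (t ^ α * Real.exp (-(t * x)))) x := by
  rcases ht.eq_or_lt with rfl | ht
  · simp only [zero_mul, Real.zero_rpow hα.ne', mul_zero]
    exact hasDerivAt_const _ _
  · have h := (hasDerivAt_gammaP hα (mul_pos ht hx)).comp x ((hasDerivAt_id x).const_mul t)
    refine h.congr_deriv ?_
    rw [Real.mul_rpow ht.le hx.le, Real.rpow_sub_one ht.ne']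
    field_simp

theorem continuous_gammaP {α : ℝ} (hα : 0 < α) : Continuous (gammaP α) := by
  refine Continuous.div_const ?_ _
  exact intervalIntegral.continuous_primitive
    (fun a b => intervalIntegrable_rpow_mul hα (f := fun s => Real.exp (-s)) (by fun_prop) a b) 0

theorem gammaP_zero (α : ℝ) : gammaP α 0 = 0 := by simp [gammaP]

theorem gammaP_add_one {α : ℝ} (hα : 0 < α) {t : ℝ} (ht : 0 ≤ t) :
    gammaP (α + 1) t = gammaP α t - t ^ α * Real.exp (-t) / Real.Gamma (α + 1) := by
  have hG : Real.Gamma α ≠ 0 := (Real.Gamma_pos_of_pos hα).ne'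
  have i0 := intervalIntegrable_rpow_mul hα (f := fun s => Real.exp (-s)) (by fun_prop) 0 t
  have i1 := intervalIntegrable_rpow_mul (show 0 < α + 1 by linarith)
    (f := fun s => Real.exp (-s)) (by fun_prop) 0 t
  have hFc : Continuous fun v : ℝ => v ^ α * Real.exp (-v) :=
    (Real.continuous_rpow_const hα.le).mul (by fun_prop)
  have hd : ∀ v ∈ Set.Ioo (0 : ℝ) t, HasDerivAt (fun v : ℝ => v ^ α * Real.exp (-v))
      (α * (v ^ (α - 1) * Real.exp (-v)) - v ^ (α + 1 - 1) * Real.exp (-v)) v := by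
    intro v hv
    have d1 : HasDerivAt (fun v : ℝ => v ^ α) (α * v ^ (α - 1)) v :=
      Real.hasDerivAt_rpow_const (Or.inl hv.1.ne')
    have d2 : HasDerivAt (fun v : ℝ => Real.exp (-v)) (Real.exp (-v) * -1) v :=
      (hasDerivAt_id v).fun_neg.exp
    refine (d1.fun_mul d2).congr_deriv ?_
    rw [add_sub_cancel_right]
    ring
  have hFTC := intervalIntegral.integral_eq_sub_of_hasDerivAt_of_le ht hFc.continuousOn hd
    ((i0.const_mul _).sub i1)
  rw [intervalIntegral.integral_sub (i0.const_mul _) i1, intervalIntegral.integral_const_mul,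
    Real.zero_rpow hα.ne', zero_mul, sub_zero] at hFTC
  rw [gammaP, gammaP, ← hFTC, Real.Gamma_add_one hα.ne']
  field_simp
  ring

/-- The continuous counterpart of `sum_betaTail`, with an explicit primitive. -/
theorem integral_gammaP_mul {α : ℝ} (hα : 0 < α) {t : ℝ} (ht : 0 < t) :
    ∫ x in (0 : ℝ)..1, gammaP α (t * x) = gammaP α t - α / t * gammaP (α + 1) t := by
  have hG : Real.Gamma α ≠ 0 := (Real.Gamma_pos_of_pos hα).ne'
  have hα1 : 0 < α + 1 := by linarith
  have c0 : Continuous fun x : ℝ => gammaP α (t * x) := (continuous_gammaP hα).comp (by fun_prop)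
  have c1 : Continuous fun x : ℝ => gammaP (α + 1) (t * x) :=
    (continuous_gammaP hα1).comp (by fun_prop)
  have h := intervalIntegral.integral_eq_sub_of_hasDerivAt_of_le (a := 0) (b := 1)
    (f := fun x => x * gammaP α (t * x) - α / t * gammaP (α + 1) (t * x))
    (f' := fun x => gammaP α (t * x)) zero_le_one
    ((continuous_id.mul c0).sub (c1.const_smul (α / t))).continuousOn (fun x hx => by
      have hx0 : (0 : ℝ) < x := hx.1
      have d := ((hasDerivAt_id x).fun_mul (hasDerivAt_gammaP_mul hα ht.le hx0)).fun_sub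
        ((hasDerivAt_gammaP_mul hα1 ht.le hx0).const_mul (α / t))
      refine d.congr_deriv ?_
      rw [add_sub_cancel_right, Real.Gamma_add_one hα.ne', Real.rpow_add_one ht.ne',
        Real.rpow_sub_one hx0.ne']
      simp only [id]
      field_simp
      ring) (c0.intervalIntegrable 0 1)
  rw [h]
  simp [gammaP_zero]

theorem intervalIntegrable_gammaCorr {α : ℝ} (hα : 0 < α) (t : ℝ) (a b : ℝ) :
    IntervalIntegrable (gammaCorr α t) volume a b := by
  have h := intervalIntegrable_rpow_mul hα
    (f := fun x => 1 / Real.Gamma α * (t ^ α * Real.exp (-(t * x)) * ((1 - α - t * x) / 2)))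
    (by fun_prop) a b
  refine h.congr fun x _ => ?_
  simp only [gammaCorr]
  ring

theorem integral_gammaCorr {α : ℝ} (hα : 0 < α) {t : ℝ} (ht : 0 < t) :
    ∫ x in (0 : ℝ)..1, gammaCorr α t x =
      ((1 - α) * gammaP α t - α * gammaP (α + 1) t) / 2 := by
  have hG : Real.Gamma α ≠ 0 := (Real.Gamma_pos_of_pos hα).ne'
  have hα1 : 0 < α + 1 := by linarith
  have c0 : Continuous fun x : ℝ => gammaP α (t * x) := (continuous_gammaP hα).comp (by fun_prop)
  have c1 : Continuous fun x : ℝ => gammaP (α + 1) (t * x) :=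
    (continuous_gammaP hα1).comp (by fun_prop)
  have h := intervalIntegral.integral_eq_sub_of_hasDerivAt_of_le (a := 0) (b := 1)
    (f := fun x => ((1 - α) * gammaP α (t * x) - α * gammaP (α + 1) (t * x)) / 2)
    (f' := gammaCorr α t) zero_le_one
    (((c0.const_smul (1 - α)).sub (c1.const_smul α)).div_const 2).continuousOn (fun x hx => by
      have hx0 : (0 : ℝ) < x := hx.1
      have d := (((hasDerivAt_gammaP_mul hα ht.le hx0).const_mul (1 - α)).fun_sub
        ((hasDerivAt_gammaP_mul hα1 ht.le hx0).const_mul α)).div_const 2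
      refine d.congr_deriv ?_
      rw [gammaCorr, add_sub_cancel_right, Real.Gamma_add_one hα.ne', Real.rpow_add_one ht.ne',
        Real.rpow_sub_one hx0.ne']
      field_simp) (intervalIntegrable_gammaCorr hα t 0 1)
  rw [h]
  simp [gammaP_zero]

theorem isBigO_betaTail_self {α : ℝ} (hα : 0 < α) {t : ℝ} (ht : 0 ≤ t) :
    (fun n : ℕ => (n : ℝ) * (betaTail α (t / n) n - gammaP α t) + gammaCorr α t 1)
      =O[atTop] fun n : ℕ => 1 / (n : ℝ) := by
  obtain ⟨C, hC, h⟩ := abs_betaTail_sub_gammaP_le hα ht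
  refine IsBigO.of_bound C ?_
  filter_upwards [eventually_gt_atTop 0, eventually_ge_atTop ⌈2 * t⌉₊] with n hn hnt
  have hn' : (0 : ℝ) < n := by exact_mod_cast hn
  have := h n n hn ((Nat.le_ceil _).trans (by exact_mod_cast hnt)) hn le_rfl
  rw [div_self hn'.ne', Real.one_rpow, one_mul, mul_one] at this
  have e : (n : ℝ) * (betaTail α (t / n) n - gammaP α t) + gammaCorr α t 1 =
      n * (betaTail α (t / n) n - gammaP α t + 1 / n * gammaCorr α t 1) := by
    field_simp
  rw [e, norm_mul, Real.norm_of_nonneg hn'.le,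
    Real.norm_of_nonneg (show 0 ≤ 1 / (n : ℝ) by positivity),
    Real.norm_eq_abs]
  calc (n : ℝ) * |_| ≤ n * (C * (1 / (n : ℝ)) ^ 2) := by gcongr
    _ = _ := by field_simp

theorem isBigO_gammaRatio {α : ℝ} (hα : 0 < α) :
    (fun n : ℕ => gammaRatio α n - 1) =O[atTop] fun n : ℕ => 1 / (n : ℝ) := by
  obtain ⟨C, hC, h⟩ := abs_gammaRatio_sub_le hα
  refine IsBigO.of_bound (C + |α * (α - 1) / 2|) ?_
  filter_upwards [eventually_gt_atTop 0] with n hn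
  have hn' : (1 : ℝ) ≤ n := by exact_mod_cast hn
  have e : gammaRatio α n - 1 =
      (gammaRatio α n - (1 + α * (α - 1) / 2 / n)) + α * (α - 1) / 2 / n := by ring
  rw [e, Real.norm_eq_abs, Real.norm_of_nonneg (by positivity)]
  refine (abs_add_le _ _).trans ?_
  have h2 : C / (n : ℝ) ^ 2 ≤ C / n :=
    div_le_div_of_nonneg_left hC (by positivity) (by nlinarith)
  rw [abs_div _ (n : ℝ), abs_of_nonneg (by linarith : (0 : ℝ) ≤ n)]
  calc _ ≤ C / n + |α * (α - 1) / 2| / n := add_le_add ((h n hn).trans h2) le_rfl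
    _ = _ := by ring

theorem isBigO_one_sub_pow {t : ℝ} (ht : 0 ≤ t) :
    (fun n : ℕ => (1 - t / n) ^ (n - 1) - Real.exp (-t)) =O[atTop] fun n : ℕ => 1 / (n : ℝ) := by
  obtain ⟨C, hC, h⟩ := abs_one_sub_pow_sub_le ht
  refine IsBigO.of_bound (C + |Real.exp (-t) * (t - t ^ 2 / 2)|) ?_
  filter_upwards [eventually_gt_atTop 0, eventually_ge_atTop ⌈2 * t⌉₊] with n hn hnt
  have hn' : (1 : ℝ) ≤ n := by exact_mod_cast hn
  have h0 := h n n hn ((Nat.le_ceil _).trans (by exact_mod_cast hnt)) hn le_rfl t ⟨ht, le_rfl⟩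
  rw [div_self (by linarith), one_mul, one_mul, one_div_mul_eq_div] at h0
  have e : (1 - t / n) ^ (n - 1) - Real.exp (-t) = ((1 - t / n) ^ (n - 1) -
      (Real.exp (-t) + 1 / n * (Real.exp (-t) * (t - t ^ 2 / 2)))) +
      1 / n * (Real.exp (-t) * (t - t ^ 2 / 2)) := by ring
  have h1 : C * (1 / (n : ℝ)) ^ 2 ≤ C * (1 / n) :=
    mul_le_mul_of_nonneg_left (pow_le_of_le_one (by positivity)
      (by rw [div_le_one (by linarith)]; exact hn') two_ne_zero) hC
  rw [e, Real.norm_eq_abs, Real.norm_of_nonneg (by positivity)]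
  refine (abs_add_le _ _).trans ?_
  rw [abs_mul _ (Real.exp (-t) * _), abs_of_nonneg (by positivity : (0 : ℝ) ≤ 1 / n), add_mul,
    mul_comm (1 / (n : ℝ)) |_|]
  exact add_le_add (h0.trans h1) le_rfl

/-- Needed because `sum_betaTail` evaluates the tail with parameter α + 1 at n - 1 rather than n. By
`betaTail_succ_sub` the increment is a multiple of `gammaRatio α n` times (1 - t/n)^(n-1). -/
theorem isBigO_betaTail_step {α : ℝ} (hα : 0 < α) {t : ℝ} (ht : 0 ≤ t) :
    (fun n : ℕ => (n : ℝ) * (betaTail (α + 1) (t / n) n - betaTail (α + 1) (t / n) (n - 1)) -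
        t ^ (α + 1) * Real.exp (-t) / Real.Gamma (α + 1))
      =O[atTop] fun n : ℕ => 1 / (n : ℝ) := by
  have h1 := isBigO_gammaRatio hα
  have h2 := isBigO_one_sub_pow ht
  have hone : (fun n : ℕ => 1 / (n : ℝ)) =O[atTop] fun _ => (1 : ℝ) :=
    (tendsto_const_div_atTop_nhds_zero_nat 1).isBigO_one ℝ
  have h3 : (fun n : ℕ => gammaRatio α n * (1 - t / n) ^ (n - 1) - Real.exp (-t))
      =O[atTop] fun n : ℕ => 1 / (n : ℝ) := by
    have h5 : (fun n : ℕ => 1 / (n : ℝ) * Real.exp (-t)) =O[atTop] fun n : ℕ => 1 / (n : ℝ) := by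
      exact ((isBigO_refl (fun n : ℕ => 1 / (n : ℝ)) atTop).const_mul_left (Real.exp (-t))).congr_left
        fun n => mul_comm _ _
    have h6 := ((h1.mul (h2.trans hone)).trans (by simpa only [mul_one] using isBigO_refl _ _)).add
      (((h1.mul (isBigO_refl (fun _ : ℕ => Real.exp (-t)) atTop)).trans h5).add h2)
    refine h6.congr_left fun n => ?_
    ring
  refine (h3.const_mul_left (t ^ (α + 1) / Real.Gamma (α + 1))).congr' ?_ EventuallyEq.rfl
  filter_upwards [eventually_gt_atTop 0] with n hn
  have hn' : (0 : ℝ) < n := by exact_mod_cast hn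
  obtain ⟨j, rfl⟩ : ∃ j, n = j + 1 := ⟨n - 1, by omega⟩
  have hG : Real.Gamma (α + 1) ≠ 0 := (Real.Gamma_pos_of_pos (by linarith)).ne'
  have hf : (j.factorial : ℝ) ≠ 0 := by exact_mod_cast j.factorial_ne_zero
  have hj : Real.Gamma ((j + 1 : ℕ) : ℝ) = j.factorial := by
    push_cast; exact Real.Gamma_nat_eq_factorial j
  have h8 : ((j + 1 : ℕ) : ℝ) ^ α ≠ 0 := (Real.rpow_pos_of_pos hn' _).ne'
  rw [Nat.add_sub_cancel, betaTail_succ_sub (by linarith) _ (by positivity), gammaRatio, hj,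
    Real.div_rpow ht hn'.le, Real.rpow_add_one hn'.ne',
    show (j : ℝ) + (α + 1) = ((j + 1 : ℕ) : ℝ) + α by push_cast; ring]
  field_simp

/-- The sum of Beta tails agrees with its Euler-Maclaurin approximation up to `O(1 / n)`. -/
theorem isBigO_sum_betaTail {α : ℝ} (hα : 0 < α) {t : ℝ} (ht : 0 ≤ t) :
    (fun n : ℕ => (∑ k ∈ Finset.range n, betaTail α (t / n) (k + 1)) -
        n * (∫ x in (0 : ℝ)..1, gammaP α (t * x)) + (∫ x in (0 : ℝ)..1, gammaCorr α t x) -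
        gammaP α t / 2) =O[atTop] fun n : ℕ => 1 / (n : ℝ) := by
  rcases ht.eq_or_lt with rfl | ht
  · have : ∀ x, gammaCorr α 0 x = 0 := fun x => by simp [gammaCorr, Real.zero_rpow hα.ne']
    simp only [this, zero_div, betaTail_zero, zero_mul, gammaP_zero]
    simpa using isBigO_zero _ _
  have hG : Real.Gamma α ≠ 0 := (Real.Gamma_pos_of_pos hα).ne'
  have hα1 : 0 < α + 1 := by linarith
  have a := isBigO_betaTail_self hα ht.le
  have b := isBigO_betaTail_self hα1 ht.le
  have s := isBigO_betaTail_step hα ht.le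
  have hone : (fun n : ℕ => 1 / (n : ℝ)) =O[atTop] fun _ => (1 : ℝ) :=
    (tendsto_const_div_atTop_nhds_zero_nat 1).isBigO_one ℝ
  have c : (fun n : ℕ => (n : ℝ) * (betaTail (α + 1) (t / n) n - gammaP (α + 1) t) -
      (n : ℝ) * (betaTail (α + 1) (t / n) n - betaTail (α + 1) (t / n) (n - 1)))
      =O[atTop] fun _ => (1 : ℝ) := by
    have := ((b.sub s).trans hone).sub (isBigO_const_const
      (gammaCorr (α + 1) t 1 + t ^ (α + 1) * Real.exp (-t) / Real.Gamma (α + 1))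
      (one_ne_zero (α := ℝ)) atTop)
    refine this.congr_left fun n => ?_
    ring
  have d := ((isBigO_refl (fun n : ℕ => 1 / (n : ℝ)) atTop).mul c).const_mul_left α
  simp only [mul_one] at d
  -- With ε = t/n the coefficient α(1 - ε)/ε is αn/t - α. The first part pairs with `b` and `s`; the
  -- second needs only the O(1/n) convergence of the tail at n - 1 to its limit, which is `d`.
  refine ((a.sub ((b.sub s).const_mul_left (α / t))).add d).congr' ?_ EventuallyEq.rfl
  filter_upwards [eventually_gt_atTop 0] with n hn
  have hn' : (0 : ℝ) < n := by exact_mod_cast hn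
  obtain ⟨j, rfl⟩ : ∃ j, n = j + 1 := ⟨n - 1, by omega⟩
  rw [sum_betaTail hα (div_pos ht hn'), integral_gammaP_mul hα ht, integral_gammaCorr hα ht,
    Nat.add_sub_cancel]
  have e1 : gammaCorr α t 1 = t ^ α * Real.exp (-t) / Real.Gamma α * ((1 - α - t) / 2) := by
    simp [gammaCorr]; ring
  have e2 : gammaCorr (α + 1) t 1 =
      t * (t ^ α * Real.exp (-t) / Real.Gamma α) / α * ((-α - t) / 2) := by
    simp only [gammaCorr, Real.one_rpow, mul_one]
    rw [Real.Gamma_add_one hα.ne', Real.rpow_add_one ht.ne']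
    field_simp
    ring
  have e3 : t ^ (α + 1) * Real.exp (-t) / Real.Gamma (α + 1) =
      t * (t ^ α * Real.exp (-t) / Real.Gamma α) / α := by
    rw [Real.Gamma_add_one hα.ne', Real.rpow_add_one ht.ne']
    field_simp
  have e4 : t ^ α * Real.exp (-t) / Real.Gamma α = α * (gammaP α t - gammaP (α + 1) t) := by
    rw [gammaP_add_one hα ht.le, Real.Gamma_add_one hα.ne']
    field_simp
    ring
  rw [e1, e2, e3, e4]
  push_cast at hn' ⊢
  field_simp
  ring

/-! ### The logarithm on a right half-plane -/

section HalfPlane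

variable {c : ℝ} {z w : ℂ}

theorem convex_re_ge (c : ℝ) : Convex ℝ {z : ℂ | c ≤ z.re} := convex_halfSpace_re_ge c

theorem le_norm_of_le_re (hz : c ≤ z.re) : c ≤ ‖z‖ := hz.trans (Complex.re_le_norm z)

theorem ne_zero_of_re_ge (hc : 0 < c) (hz : c ≤ z.re) : z ≠ 0 :=
  norm_pos_iff.mp (hc.trans_le (le_norm_of_le_re hz))

theorem mem_slitPlane_of_re_ge (hc : 0 < c) (hz : c ≤ z.re) : z ∈ Complex.slitPlane :=
  Or.inl (hc.trans_le hz)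

theorem norm_inv_le_of_re_ge (hc : 0 < c) (hz : c ≤ z.re) : ‖z⁻¹‖ ≤ c⁻¹ := by
  rw [norm_inv]
  exact inv_anti₀ hc (le_norm_of_le_re hz)

theorem norm_inv_sub_inv_le (hc : 0 < c) (hz : c ≤ z.re) (hw : c ≤ w.re) :
    ‖z⁻¹ - w⁻¹‖ ≤ ‖z - w‖ / c ^ 2 := by
  have hz0 := ne_zero_of_re_ge hc hz
  have hw0 := ne_zero_of_re_ge hc hw
  rw [inv_sub_inv hz0 hw0, norm_div, norm_sub_rev, norm_mul, sq]
  have h1 := le_norm_of_le_re hz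
  have h2 := le_norm_of_le_re hw
  gcongr

/-- The segment from w to z stays in the half-plane, where y⁻¹ - w⁻¹, the derivative of the
difference, is at most ‖z - w‖/c². -/
theorem norm_log_sub_log_sub_le (hc : 0 < c) (hz : c ≤ z.re) (hw : c ≤ w.re) :
    ‖Complex.log z - Complex.log w - w⁻¹ * (z - w)‖ ≤ ‖z - w‖ ^ 2 / c ^ 2 := by
  have hseg : segment ℝ w z ⊆ {z : ℂ | c ≤ z.re} := (convex_re_ge c).segment_subset hw hz
  have hd : ∀ y ∈ segment ℝ w z, HasDerivWithinAt (fun y => Complex.log y - w⁻¹ * y)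
      (y⁻¹ - w⁻¹) (segment ℝ w z) y := by
    intro y hy
    have h1 := Complex.hasDerivAt_log (mem_slitPlane_of_re_ge hc (hseg hy))
    have h2 : HasDerivAt (fun y : ℂ => w⁻¹ * y) w⁻¹ y := by
      simpa using (hasDerivAt_id y).const_mul w⁻¹
    exact (h1.sub h2).hasDerivWithinAt
  have hb : ∀ y ∈ segment ℝ w z, ‖y⁻¹ - w⁻¹‖ ≤ ‖z - w‖ / c ^ 2 := by
    intro y hy
    refine (norm_inv_sub_inv_le hc (hseg hy) hw).trans ?_
    gcongr
    exact norm_sub_le_of_mem_segment hy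
  have := (convex_segment w z).norm_image_sub_le_of_norm_hasDerivWithin_le hd hb
    (left_mem_segment ℝ w z) (right_mem_segment ℝ w z)
  calc _ = ‖Complex.log z - w⁻¹ * z - (Complex.log w - w⁻¹ * w)‖ := by congr 1; ring
    _ ≤ ‖z - w‖ / c ^ 2 * ‖z - w‖ := this
    _ = _ := by ring

end HalfPlane

/-- The logarithm with its first-order Taylor polynomial at `F₀` removed. -/
def logRest (F₀ z : ℂ) : ℂ := Complex.log z - Complex.log F₀ - F₀⁻¹ * (z - F₀)

theorem logRest_self (F₀ : ℂ) : logRest F₀ F₀ = 0 := by simp [logRest]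

theorem hasDerivAt_logRest {F₀ z : ℂ} (hz : z ∈ Complex.slitPlane) :
    HasDerivAt (logRest F₀) (z⁻¹ - F₀⁻¹) z := by
  have h := ((Complex.hasDerivAt_log hz).sub_const (Complex.log F₀)).fun_sub
    (((hasDerivAt_id z).sub_const F₀).const_mul F₀⁻¹)
  exact h.congr_deriv (by simp)

theorem norm_logRest_le {c : ℝ} (hc : 0 < c) {F₀ z : ℂ} (h₀ : c ≤ F₀.re) (hz : c ≤ z.re) :
    ‖logRest F₀ z‖ ≤ ‖z - F₀‖ ^ 2 / c ^ 2 := norm_log_sub_log_sub_le hc hz h₀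

theorem norm_logRest_sub_le {c : ℝ} (hc : 0 < c) {F₀ z w : ℂ} (hz : c ≤ z.re) (hw : c ≤ w.re) :
    ‖logRest F₀ z - logRest F₀ w - (w⁻¹ - F₀⁻¹) * (z - w)‖ ≤ ‖z - w‖ ^ 2 / c ^ 2 := by
  refine le_trans (le_of_eq ?_) (norm_log_sub_log_sub_le hc hz hw)
  congr 1
  simp only [logRest]
  ring

/-! ### Euler–Maclaurin summation with a singular endpoint -/

theorem norm_integral_sub_right_le {a b K : ℝ} (hab : a ≤ b) {γ γ' : ℝ → ℂ}
    (hd : ∀ x ∈ Set.Icc a b, HasDerivAt γ (γ' x) x) (hK : ∀ x ∈ Set.Icc a b, ‖γ' x‖ ≤ K) :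
    ‖(∫ x in a..b, γ x) - ((b - a : ℝ) : ℂ) * γ b‖ ≤ K * (b - a) ^ 2 := by
  have hK0 : 0 ≤ K := (norm_nonneg _).trans (hK a ⟨le_rfl, hab⟩)
  have hc : ContinuousOn γ (Set.uIcc a b) := by
    rw [Set.uIcc_of_le hab]
    exact fun x hx => (hd x hx).continuousAt.continuousWithinAt
  have h1 : (∫ x in a..b, γ x) - ((b - a : ℝ) : ℂ) * γ b = ∫ x in a..b, (γ x - γ b) := by
    rw [intervalIntegral.integral_sub hc.intervalIntegrable intervalIntegrable_const,
      intervalIntegral.integral_const, Complex.real_smul]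
  rw [h1]
  have h2 : ∀ x ∈ Set.uIoc a b, ‖γ x - γ b‖ ≤ K * (b - a) := by
    intro x hx
    rw [Set.uIoc_of_le hab] at hx
    have := (convex_Icc a b).norm_image_sub_le_of_norm_hasDerivWithin_le
      (fun x hx => (hd x hx).hasDerivWithinAt) hK (Set.right_mem_Icc.mpr hab) ⟨hx.1.le, hx.2⟩
    refine this.trans (mul_le_mul_of_nonneg_left ?_ hK0)
    rw [Real.norm_eq_abs, abs_sub_comm, abs_of_nonneg (by linarith [hx.2])]
    linarith [hx.1]
  have := intervalIntegral.norm_integral_le_of_norm_le_const h2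
  rw [abs_of_nonneg (by linarith)] at this
  linarith

/-- The expression vanishes on affine functions, and replacing φ by its tangent at b costs at most
K(b - a)² pointwise. Added over cells, the half-differences telescope to the boundary term of
Euler–Maclaurin. -/
theorem norm_trapezoid_le {a b K : ℝ} (hab : a < b) {φ φ' φ'' : ℝ → ℂ}
    (hd : ∀ x ∈ Set.Icc a b, HasDerivAt φ (φ' x) x)
    (hd' : ∀ x ∈ Set.Icc a b, HasDerivAt φ' (φ'' x) x)
    (hK : ∀ x ∈ Set.Icc a b, ‖φ'' x‖ ≤ K) :
    ‖((b - a : ℝ) : ℂ)⁻¹ * (∫ x in a..b, φ x) + (φ b - φ a) / 2 - φ b‖ ≤ 2 * K * (b - a) ^ 2 := by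
  have hK0 : 0 ≤ K := (norm_nonneg _).trans (hK a ⟨le_rfl, hab.le⟩)
  have hh : 0 < b - a := by linarith
  set h := b - a with hdef
  have hh' : (h : ℂ) ≠ 0 := by exact_mod_cast hh.ne'
  have lin : ∀ x ∈ Set.Icc a b, ‖φ x - (φ b + φ' b * ((x : ℂ) - b))‖ ≤ K * h ^ 2 := by
    intro x hx
    have hd2 : ∀ y ∈ Set.Icc a b, HasDerivWithinAt (fun y : ℝ => φ y - φ' b * ((y : ℂ) - b))
        (φ' y - φ' b) (Set.Icc a b) y := by
      intro y hy
      have h1 : HasDerivAt (fun y : ℝ => φ' b * ((y : ℂ) - b)) (φ' b) y := by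
        simpa using (((hasDerivAt_id y).ofReal_comp).sub_const (b : ℂ)).const_mul (φ' b)
      exact ((hd y hy).sub h1).hasDerivWithinAt
    have hb2 : ∀ y ∈ Set.Icc a b, ‖φ' y - φ' b‖ ≤ K * h := by
      intro y hy
      have := (convex_Icc a b).norm_image_sub_le_of_norm_hasDerivWithin_le
        (fun x hx => (hd' x hx).hasDerivWithinAt) hK (Set.right_mem_Icc.mpr hab.le) hy
      refine this.trans (mul_le_mul_of_nonneg_left ?_ hK0)
      rw [Real.norm_eq_abs, abs_sub_comm, abs_of_nonneg (by linarith [hy.2])]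
      linarith [hy.1]
    have := (convex_Icc a b).norm_image_sub_le_of_norm_hasDerivWithin_le hd2 hb2
      (Set.right_mem_Icc.mpr hab.le) hx
    have hxb : ‖x - b‖ ≤ h := by
      rw [Real.norm_eq_abs, abs_sub_comm, abs_of_nonneg (by linarith [hx.2])]
      linarith [hx.1]
    calc _ = ‖φ x - φ' b * ((x : ℂ) - b) - (φ b - φ' b * ((b : ℂ) - b))‖ := by congr 1; ring
      _ ≤ K * h * ‖x - b‖ := this
      _ ≤ K * h * h := by gcongr
      _ = _ := by ring
  have hc : ContinuousOn φ (Set.uIcc a b) := by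
    rw [Set.uIcc_of_le hab.le]
    exact fun x hx => (hd x hx).continuousAt.continuousWithinAt
  have hci : IntervalIntegrable (fun x : ℝ => φ b + φ' b * ((x : ℂ) - b)) volume a b :=
    Continuous.intervalIntegrable (by fun_prop) _ _
  have hlin : ∫ x in a..b, (φ b + φ' b * ((x : ℂ) - b)) = h * φ b - φ' b * (h ^ 2 / 2) := by
    have hd3 : ∀ x ∈ Set.uIcc a b, HasDerivAt
        (fun x : ℝ => φ b * (x : ℂ) + φ' b * (((x : ℂ) - b) ^ 2 / 2)) (φ b + φ' b * ((x : ℂ) - b)) x := by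
      intro x _
      have h1 := ((hasDerivAt_id x).ofReal_comp).const_mul (φ b)
      have h2 := (((((hasDerivAt_id x).ofReal_comp).sub_const (b : ℂ)).fun_pow 2).div_const 2).const_mul
        (φ' b)
      refine (h1.fun_add h2).congr_deriv ?_
      simp
    rw [intervalIntegral.integral_eq_sub_of_hasDerivAt hd3 hci, hdef]
    push_cast
    ring
  have hE : ‖(∫ x in a..b, φ x) - (h * φ b - φ' b * (h ^ 2 / 2))‖ ≤ K * h ^ 2 * h := by
    rw [← hlin, ← intervalIntegral.integral_sub hc.intervalIntegrable hci]
    have := intervalIntegral.norm_integral_le_of_norm_le_const (a := a) (b := b)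
      (f := fun x : ℝ => φ x - (φ b + φ' b * ((x : ℂ) - b))) (C := K * h ^ 2) (fun x hx => by
        rw [Set.uIoc_of_le hab.le] at hx
        exact lin x ⟨hx.1.le, hx.2⟩)
    rwa [abs_of_nonneg hh.le] at this
  have hA := lin a ⟨le_rfl, hab.le⟩
  have key : (h : ℂ)⁻¹ * (∫ x in a..b, φ x) + (φ b - φ a) / 2 - φ b =
      (h : ℂ)⁻¹ * ((∫ x in a..b, φ x) - (h * φ b - φ' b * (h ^ 2 / 2))) -
        (φ a - (φ b + φ' b * ((a : ℂ) - b))) / 2 := by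
    have : (a : ℂ) - b = -h := by rw [hdef]; push_cast; ring
    rw [this]
    field_simp
    ring
  rw [key]
  refine (norm_sub_le _ _).trans ?_
  rw [norm_mul, norm_div, norm_inv, Complex.norm_real, Real.norm_of_nonneg hh.le]
  have e1 : h⁻¹ * ‖(∫ x in a..b, φ x) - (h * φ b - φ' b * (h ^ 2 / 2))‖ ≤ K * h ^ 2 := by
    calc _ ≤ h⁻¹ * (K * h ^ 2 * h) := by gcongr
      _ = _ := by field_simp
  have e2 : ‖φ a - (φ b + φ' b * ((a : ℂ) - b))‖ / ‖(2 : ℂ)‖ ≤ K * h ^ 2 := by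
    rw [Complex.norm_ofNat]
    have : 0 ≤ K * h ^ 2 := by positivity
    linarith
  linarith

/-- A profile `H` with an `x ^ α` singularity at `0`, together with its first two derivatives
`p`, `q` and a correction `H₁` with derivative `r`. -/
structure SingularProfile (α c B : ℝ) (F₀ : ℂ) (H p q H₁ r : ℝ → ℂ) : Prop where
  re_zero : c ≤ F₀.re
  re_ge : ∀ x ∈ Set.Icc (0 : ℝ) 1, c ≤ (H x).re
  cont : ContinuousOn H (Set.Icc 0 1)
  int : IntervalIntegrable H₁ volume 0 1
  zero : H 0 = F₀
  hasDerivAt : ∀ x ∈ Set.Ioc (0 : ℝ) 1, HasDerivAt H (p x) x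
  hasDerivAt' : ∀ x ∈ Set.Ioc (0 : ℝ) 1, HasDerivAt p (q x) x
  hasDerivAt_corr : ∀ x ∈ Set.Ioc (0 : ℝ) 1, HasDerivAt H₁ (r x) x
  norm_sub_zero_le : ∀ x ∈ Set.Ioc (0 : ℝ) 1, ‖H x - F₀‖ ≤ B * x ^ α
  norm_p_le : ∀ x ∈ Set.Ioc (0 : ℝ) 1, ‖p x‖ ≤ B * x ^ (α - 1)
  norm_q_le : ∀ x ∈ Set.Ioc (0 : ℝ) 1, ‖q x‖ ≤ B * x ^ (α - 2)
  norm_corr_le : ∀ x ∈ Set.Ioc (0 : ℝ) 1, ‖H₁ x‖ ≤ B * x ^ (α - 1)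
  norm_r_le : ∀ x ∈ Set.Ioc (0 : ℝ) 1, ‖r x‖ ≤ B * x ^ (α - 2)

/-- On `[b / 2, b]` powers are comparable to those at `b`. -/
theorem rpow_le_of_half_le {x b : ℝ} (s : ℝ) (hb : 0 < b) (h1 : b / 2 ≤ x) (h2 : x ≤ b) :
    x ^ s ≤ 2 ^ |s| * b ^ s := by
  have hx : 0 < x := by linarith
  have h2s : (1 : ℝ) ≤ 2 ^ |s| := Real.one_le_rpow one_le_two (abs_nonneg s)
  rcases le_total 0 s with hs | hs
  · calc x ^ s ≤ b ^ s := Real.rpow_le_rpow hx.le h2 hs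
      _ ≤ _ := le_mul_of_one_le_left (Real.rpow_nonneg hb.le _) h2s
  · calc x ^ s ≤ (b / 2) ^ s := Real.rpow_le_rpow_of_nonpos (by linarith) h1 hs
      _ = 2 ^ |s| * b ^ s := by
        rw [Real.div_rpow hb.le zero_le_two, abs_of_nonpos hs, Real.rpow_neg zero_le_two]
        field_simp

namespace SingularProfile

variable {α c B : ℝ} {F₀ : ℂ} {H p q H₁ r : ℝ → ℂ}

/-- The gain from removing the linear part: the derivative of `logRest` along H vanishes like x^α at
0. -/
theorem norm_inv_sub_le (hP : SingularProfile α c B F₀ H p q H₁ r) (hc : 0 < c) {x : ℝ}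
    (hx : x ∈ Set.Ioc (0 : ℝ) 1) : ‖(H x)⁻¹ - F₀⁻¹‖ ≤ B / c ^ 2 * x ^ α := by
  refine (norm_inv_sub_inv_le hc (hP.re_ge x ⟨hx.1.le, hx.2⟩) hP.re_zero).trans ?_
  calc ‖H x - F₀‖ / c ^ 2 ≤ B * x ^ α / c ^ 2 := by
        gcongr
        exact hP.norm_sub_zero_le x hx
    _ = _ := by ring

theorem norm_sub_le_of_approx (hP : SingularProfile α c B F₀ H p q H₁ r) (hB : 0 ≤ B) {b h : ℝ}
    (hb : b ∈ Set.Ioc (0 : ℝ) 1) (h0 : 0 ≤ h) (hhb : h ≤ b) {F : ℂ}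
    (hF : ‖F - H b - h * H₁ b‖ ≤ B * (b ^ (α - 2) * h ^ 2)) :
    ‖F - H b‖ ≤ 2 * B * (h * b ^ (α - 1)) := by
  have e : F - H b = (F - H b - h * H₁ b) + h * H₁ b := by ring
  have h2 : b ^ (α - 2) * h ≤ b ^ (α - 1) := by
    calc b ^ (α - 2) * h ≤ b ^ (α - 2) * b := by
          have := Real.rpow_nonneg hb.1.le (α - 2)
          gcongr
      _ = b ^ (α - 1) := by
          rw [← Real.rpow_add_one hb.1.ne']
          congr 1; ring
  rw [e]
  refine (norm_add_le _ _).trans ?_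
  rw [norm_mul, Complex.norm_real, Real.norm_of_nonneg h0]
  calc _ ≤ B * (b ^ (α - 2) * h ^ 2) + h * (B * b ^ (α - 1)) := by
        gcongr
        exact hP.norm_corr_le b hb
    _ = B * h * (b ^ (α - 2) * h) + h * (B * b ^ (α - 1)) := by ring
    _ ≤ B * h * b ^ (α - 1) + h * (B * b ^ (α - 1)) := by gcongr
    _ = _ := by ring

/-- The error of the Euler-Maclaurin approximation on a cell away from `0`. -/
theorem norm_cell_le (hP : SingularProfile α c B F₀ H p q H₁ r) (hc : 0 < c) (hB : 0 ≤ B)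
    {a b : ℝ} (hab : a < b) (hb1 : b ≤ 1) (hb0 : 0 < b) (hba : b / 2 ≤ a) {F : ℂ}
    (hFre : c ≤ F.re)
    (hF : ‖F - H b - ((b - a : ℝ) : ℂ) * H₁ b‖ ≤ B * (b ^ (α - 2) * (b - a) ^ 2)) :
    ‖((b - a : ℝ) : ℂ)⁻¹ * (∫ x in a..b, logRest F₀ (H x)) +
        (∫ x in a..b, ((H x)⁻¹ - F₀⁻¹) * H₁ x) +
        (logRest F₀ (H b) - logRest F₀ (H a)) / 2 - logRest F₀ F‖ ≤
      (6 * 2 ^ |2 * α - 2| + 5) * (B ^ 2 / c ^ 2) * ((b - a) ^ 2 * b ^ (2 * α - 2)) := by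
  have hsub : ∀ x ∈ Set.Icc a b, x ∈ Set.Ioc (0 : ℝ) 1 := fun x hx =>
    ⟨by linarith [hx.1], hx.2.trans hb1⟩
  have hbm : b ∈ Set.Ioc (0 : ℝ) 1 := ⟨hb0, hb1⟩
  set E := 2 ^ |2 * α - 2| * b ^ (2 * α - 2) with hE
  have hEx : ∀ x ∈ Set.Icc a b, x ^ (2 * α - 2) ≤ E := fun x hx =>
    rpow_le_of_half_le _ hb0 (hba.trans hx.1) hx.2
  set D := B ^ 2 / c ^ 2 with hD
  have hD0 : 0 ≤ D := by positivity
  have hre : ∀ x ∈ Set.Ioc (0 : ℝ) 1, c ≤ (H x).re := fun x hx => hP.re_ge x ⟨hx.1.le, hx.2⟩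
  have pow1 : ∀ x : ℝ, 0 < x → x ^ (α - 1) * x ^ (α - 1) = x ^ (2 * α - 2) := fun x hx => by
    rw [← Real.rpow_add hx]; congr 1; ring
  have pow2 : ∀ x : ℝ, 0 < x → x ^ α * x ^ (α - 2) = x ^ (2 * α - 2) := fun x hx => by
    rw [← Real.rpow_add hx]; congr 1; ring
  have dinv : ∀ x ∈ Set.Ioc (0 : ℝ) 1,
      HasDerivAt (fun x => (H x)⁻¹ - F₀⁻¹) (-(p x) / (H x) ^ 2) x := fun x hx =>
    ((hP.hasDerivAt x hx).fun_inv (ne_zero_of_re_ge hc (hre x hx))).sub_const _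
  -- The product rule for (1/H - F₀⁻¹) f: both x^(α-1) · x^(α-1) and x^α · x^(α-2) are x^(2α-2).
  -- With f = p this bounds the second derivative of `logRest` along H; with f = H₁, the derivative
  -- of the correction integrand.
  have hmixed : ∀ f g : ℝ → ℂ, (∀ x ∈ Set.Ioc (0 : ℝ) 1, ‖f x‖ ≤ B * x ^ (α - 1)) →
      (∀ x ∈ Set.Ioc (0 : ℝ) 1, ‖g x‖ ≤ B * x ^ (α - 2)) → ∀ x ∈ Set.Icc a b,
      ‖-(p x) / (H x) ^ 2 * f x + ((H x)⁻¹ - F₀⁻¹) * g x‖ ≤ 2 * D * E := by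
    intro f g hf hg x hx
    have hx' := hsub x hx
    have hx0 := hx'.1
    have hcn := le_norm_of_le_re (hre x hx')
    refine (norm_add_le _ _).trans ?_
    rw [norm_mul, norm_mul, norm_div, norm_neg, norm_pow]
    have t1 : ‖p x‖ / ‖H x‖ ^ 2 * ‖f x‖ ≤ D * E := by
      calc ‖p x‖ / ‖H x‖ ^ 2 * ‖f x‖ ≤ (B * x ^ (α - 1)) / c ^ 2 * (B * x ^ (α - 1)) := by
            have := hP.norm_p_le x hx'
            have := hf x hx'
            have := Real.rpow_nonneg hx0.le (α - 1)
            gcongr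
        _ = D * (x ^ (α - 1) * x ^ (α - 1)) := by rw [hD]; ring
        _ ≤ D * E := by
            rw [pow1 x hx0]
            exact mul_le_mul_of_nonneg_left (hEx x hx) hD0
    have t2 : ‖(H x)⁻¹ - F₀⁻¹‖ * ‖g x‖ ≤ D * E := by
      calc ‖(H x)⁻¹ - F₀⁻¹‖ * ‖g x‖ ≤ (B / c ^ 2 * x ^ α) * (B * x ^ (α - 2)) := by
            have := hP.norm_inv_sub_le hc hx'
            have := hg x hx'
            have := Real.rpow_nonneg hx0.le α
            gcongr
        _ = D * (x ^ α * x ^ (α - 2)) := by rw [hD]; ring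
        _ ≤ D * E := by
            rw [pow2 x hx0]
            exact mul_le_mul_of_nonneg_left (hEx x hx) hD0
    linarith
  have T := norm_trapezoid_le hab (φ := fun x => logRest F₀ (H x))
    (φ' := fun x => ((H x)⁻¹ - F₀⁻¹) * p x)
    (φ'' := fun x => -(p x) / (H x) ^ 2 * p x + ((H x)⁻¹ - F₀⁻¹) * q x) (K := 2 * D * E)
    (fun x hx => (hasDerivAt_logRest
      (mem_slitPlane_of_re_ge hc (hre x (hsub x hx)))).comp x (hP.hasDerivAt x (hsub x hx)))
    (fun x hx => (dinv x (hsub x hx)).fun_mul (hP.hasDerivAt' x (hsub x hx)))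
    (hmixed p q hP.norm_p_le hP.norm_q_le)
  have R := norm_integral_sub_right_le hab.le (γ := fun x => ((H x)⁻¹ - F₀⁻¹) * H₁ x)
    (γ' := fun x => -(p x) / (H x) ^ 2 * H₁ x + ((H x)⁻¹ - F₀⁻¹) * r x) (K := 2 * D * E)
    (fun x hx => (dinv x (hsub x hx)).fun_mul (hP.hasDerivAt_corr x (hsub x hx)))
    (hmixed H₁ r hP.norm_corr_le hP.norm_r_le)
  have hab0 : 0 ≤ b - a := by linarith
  have hFH := hP.norm_sub_le_of_approx hB hbm hab0 (by linarith) hF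
  have L := norm_logRest_sub_le (F₀ := F₀) hc hFre (hre b hbm)
  have L1 : ‖F - H b‖ ^ 2 / c ^ 2 ≤ 4 * D * ((b - a) ^ 2 * b ^ (2 * α - 2)) := by
    calc ‖F - H b‖ ^ 2 / c ^ 2 ≤ (2 * B * ((b - a) * b ^ (α - 1))) ^ 2 / c ^ 2 := by gcongr
      _ = 4 * D * ((b - a) ^ 2 * (b ^ (α - 1) * b ^ (α - 1))) := by rw [hD]; ring
      _ = _ := by rw [pow1 b hb0]
  have L2 : ‖((H b)⁻¹ - F₀⁻¹) * (F - H b - ((b - a : ℝ) : ℂ) * H₁ b)‖ ≤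
      D * ((b - a) ^ 2 * b ^ (2 * α - 2)) := by
    rw [norm_mul]
    calc _ ≤ (B / c ^ 2 * b ^ α) * (B * (b ^ (α - 2) * (b - a) ^ 2)) := by
          have := hP.norm_inv_sub_le hc hbm
          have := Real.rpow_nonneg hb0.le α
          gcongr
      _ = D * ((b - a) ^ 2 * (b ^ α * b ^ (α - 2))) := by rw [hD]; ring
      _ = _ := by rw [pow2 b hb0]
  set I₁ := ((b - a : ℝ) : ℂ)⁻¹ * (∫ x in a..b, logRest F₀ (H x))
  set I₂ := ∫ x in a..b, ((H x)⁻¹ - F₀⁻¹) * H₁ x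
  -- Four errors: trapezoidal rule, right-endpoint rule, Taylor expansion of `logRest` at H b, and
  -- the approximation of F. They contribute 4 and 2 times 2^|2α-2|, then 4 and 1.
  have split : I₁ + I₂ + (logRest F₀ (H b) - logRest F₀ (H a)) / 2 - logRest F₀ F =
      (I₁ + (logRest F₀ (H b) - logRest F₀ (H a)) / 2 - logRest F₀ (H b)) +
      (I₂ - ((b - a : ℝ) : ℂ) * (((H b)⁻¹ - F₀⁻¹) * H₁ b)) -
      (logRest F₀ F - logRest F₀ (H b) - ((H b)⁻¹ - F₀⁻¹) * (F - H b)) -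
      ((H b)⁻¹ - F₀⁻¹) * (F - H b - ((b - a : ℝ) : ℂ) * H₁ b) := by ring
  rw [split]
  refine (norm_sub_le _ _).trans ((add_le_add ((norm_sub_le _ _).trans
    (add_le_add ((norm_add_le _ _).trans (add_le_add T R)) (L.trans L1))) L2).trans_eq ?_)
  rw [hE]
  ring

theorem norm_logRest_comp_le (hP : SingularProfile α c B F₀ H p q H₁ r) (hc : 0 < c)
    {x : ℝ} (hx : x ∈ Set.Ioc (0 : ℝ) 1) :
    ‖logRest F₀ (H x)‖ ≤ B ^ 2 / c ^ 2 * x ^ (2 * α) := by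
  refine (norm_logRest_le hc hP.re_zero (hP.re_ge x ⟨hx.1.le, hx.2⟩)).trans ?_
  have e : x ^ (2 * α) = (x ^ α) ^ 2 := by
    rw [← Real.rpow_natCast, ← Real.rpow_mul hx.1.le]; congr 1; push_cast; ring
  calc ‖H x - F₀‖ ^ 2 / c ^ 2 ≤ (B * x ^ α) ^ 2 / c ^ 2 := by
        gcongr
        exact hP.norm_sub_zero_le x hx
    _ = _ := by rw [e]; ring

/-- The error of the Euler-Maclaurin approximation on the cell at `0`. -/
theorem norm_first_cell_le (hP : SingularProfile α c B F₀ H p q H₁ r) (hα : 0 < α) (hc : 0 < c)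
    (hB : 0 ≤ B) {h : ℝ} (h0 : 0 < h) (h1 : h ≤ 1) {F : ℂ} (hFre : c ≤ F.re)
    (hF : ‖F - H h - (h : ℂ) * H₁ h‖ ≤ B * (h ^ (α - 2) * h ^ 2)) :
    ‖(h : ℂ)⁻¹ * (∫ x in (0 : ℝ)..h, logRest F₀ (H x)) +
        (∫ x in (0 : ℝ)..h, ((H x)⁻¹ - F₀⁻¹) * H₁ x) +
        (logRest F₀ (H h) - logRest F₀ (H 0)) / 2 - logRest F₀ F‖ ≤
      (11 + 1 / (2 * α)) * (B ^ 2 / c ^ 2) * (h ^ 2 * h ^ (2 * α - 2)) := by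
  have hhm : h ∈ Set.Ioc (0 : ℝ) 1 := ⟨h0, h1⟩
  have hp : h ^ 2 * h ^ (2 * α - 2) = h ^ (2 * α) := by
    rw [← Real.rpow_natCast, ← Real.rpow_add h0]; congr 1; push_cast; ring
  have hpa : h ^ (2 * α) = h ^ α * h ^ α := by
    rw [← Real.rpow_add h0]; congr 1; ring
  set D := B ^ 2 / c ^ 2 with hD
  have hD0 : 0 ≤ D := by positivity
  set E := h ^ (2 * α) with hE
  have hE0 : 0 ≤ E := Real.rpow_nonneg h0.le _
  -- The bounds on derivatives may blow up at 0, so no cancellation is sought here: since H 0 = F₀,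
  -- each of the four terms is already O(h^(2α)).
  have b1 : ‖(h : ℂ)⁻¹ * (∫ x in (0 : ℝ)..h, logRest F₀ (H x))‖ ≤ D * E := by
    have := intervalIntegral.norm_integral_le_of_norm_le_const (a := 0) (b := h)
      (f := fun x : ℝ => logRest F₀ (H x)) (C := D * E) (fun x hx => by
        rw [Set.uIoc_of_le h0.le] at hx
        refine (hP.norm_logRest_comp_le hc ⟨hx.1, hx.2.trans h1⟩).trans ?_
        exact mul_le_mul_of_nonneg_left
          (Real.rpow_le_rpow hx.1.le hx.2 (by positivity)) hD0)
    rw [sub_zero, abs_of_pos h0] at this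
    rw [norm_mul, norm_inv, Complex.norm_real, Real.norm_of_nonneg h0.le]
    calc _ ≤ h⁻¹ * (D * E * h) := by gcongr
      _ = _ := by field_simp
  have b2 : ‖∫ x in (0 : ℝ)..h, ((H x)⁻¹ - F₀⁻¹) * H₁ x‖ ≤ D * (E / (2 * α)) := by
    have hi : IntervalIntegrable (fun x : ℝ => D * x ^ (2 * α - 1)) volume 0 h :=
      (intervalIntegral.intervalIntegrable_rpow' (by linarith)).const_mul _
    have := intervalIntegral.norm_integral_le_of_norm_le (μ := volume) (a := 0) (b := h)
      (f := fun x : ℝ => ((H x)⁻¹ - F₀⁻¹) * H₁ x) h0.le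
      (Eventually.of_forall fun x hx => by
        have hx' : x ∈ Set.Ioc (0 : ℝ) 1 := ⟨hx.1, hx.2.trans h1⟩
        rw [norm_mul]
        calc ‖(H x)⁻¹ - F₀⁻¹‖ * ‖H₁ x‖ ≤ (B / c ^ 2 * x ^ α) * (B * x ^ (α - 1)) := by
              have := hP.norm_inv_sub_le hc hx'
              have := hP.norm_corr_le x hx'
              have := Real.rpow_nonneg hx'.1.le α
              gcongr
          _ = D * (x ^ α * x ^ (α - 1)) := by rw [hD]; ring
          _ = D * x ^ (2 * α - 1) := by
              rw [← Real.rpow_add hx'.1]; congr 2; ring) hi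
    rwa [intervalIntegral.integral_const_mul, integral_rpow_sub_one (by positivity)] at this
  have b3 : ‖(logRest F₀ (H h) - logRest F₀ (H 0)) / 2‖ ≤ D * E := by
    rw [hP.zero, logRest_self, sub_zero, norm_div, Complex.norm_ofNat]
    have := hP.norm_logRest_comp_le hc hhm
    have : 0 ≤ D * E := by positivity
    linarith
  have b4 : ‖logRest F₀ F‖ ≤ 9 * (D * E) := by
    have h2 := hP.norm_sub_le_of_approx hB hhm h0.le le_rfl hF
    have h3 : h * h ^ (α - 1) = h ^ α := by rw [Real.rpow_sub_one h0.ne']; field_simp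
    rw [h3] at h2
    have h4 : ‖F - F₀‖ ≤ 3 * B * h ^ α := by
      have := norm_add_le (F - H h) (H h - F₀)
      rw [sub_add_sub_cancel] at this
      have := hP.norm_sub_zero_le h hhm
      linarith
    refine (norm_logRest_le hc hP.re_zero hFre).trans ?_
    calc ‖F - F₀‖ ^ 2 / c ^ 2 ≤ (3 * B * h ^ α) ^ 2 / c ^ 2 := by gcongr
      _ = 9 * (D * (h ^ α * h ^ α)) := by rw [hD]; ring
      _ = _ := by rw [hpa]
  refine (norm_sub_le _ _).trans ((add_le_add ((norm_add_le _ _).trans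
    (add_le_add ((norm_add_le _ _).trans (add_le_add b1 b2)) b3)) b4).trans_eq ?_)
  rw [hp]
  ring

theorem continuousOn_logRest (hP : SingularProfile α c B F₀ H p q H₁ r) (hc : 0 < c) :
    ContinuousOn (fun x => logRest F₀ (H x)) (Set.Icc 0 1) := by
  intro x hx
  exact (hasDerivAt_logRest
    (mem_slitPlane_of_re_ge hc (hP.re_ge x hx))).continuousAt.comp_continuousWithinAt (hP.cont x hx)

theorem intervalIntegrable_inv_mul (hP : SingularProfile α c B F₀ H p q H₁ r) (hc : 0 < c) (w : ℂ) :
    IntervalIntegrable (fun x => ((H x)⁻¹ - w) * H₁ x) volume 0 1 := by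
  refine hP.int.continuousOn_mul ?_
  rw [Set.uIcc_of_le zero_le_one]
  exact (hP.cont.inv₀ fun x hx => ne_zero_of_re_ge hc (hP.re_ge x hx)).sub continuousOn_const

/-- The cell estimates are added over [k/n, (k + 1)/n], each factor being attached to the right
endpoint. The half-differences telescope to logRest(H 1)/2, as `logRest` vanishes at H 0 = F₀. -/
theorem norm_sum_logRest_sub_le (hP : SingularProfile α c B F₀ H p q H₁ r) (hα : 0 < α)
    (hc : 0 < c) (hB : 0 ≤ B) {n : ℕ} (hn : 0 < n) {F : ℕ → ℂ}
    (hFre : ∀ k, 0 < k → k ≤ n → c ≤ (F k).re)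
    (hF : ∀ k, 0 < k → k ≤ n → ‖F k - H ((k : ℝ) / n) - ((1 / n : ℝ) : ℂ) * H₁ ((k : ℝ) / n)‖ ≤
      B * (((k : ℝ) / n) ^ (α - 2) * (1 / (n : ℝ)) ^ 2)) :
    ‖(n : ℂ) * (∫ x in (0 : ℝ)..1, logRest F₀ (H x)) +
        (∫ x in (0 : ℝ)..1, ((H x)⁻¹ - F₀⁻¹) * H₁ x) + logRest F₀ (H 1) / 2 -
        ∑ k ∈ Finset.range n, logRest F₀ (F (k + 1))‖ ≤
      (6 * 2 ^ |2 * α - 2| + 11 + 1 / (2 * α)) * (B ^ 2 / c ^ 2) *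
        ∑ k ∈ Finset.range n, (1 / (n : ℝ)) ^ 2 * (((k + 1 : ℕ) : ℝ) / n) ^ (2 * α - 2) := by
  have hn' : (0 : ℝ) < n := by exact_mod_cast hn
  set a : ℕ → ℝ := fun k => (k : ℝ) / n with ha
  have ha0 : a 0 = 0 := by simp [ha]
  have han : a n = 1 := by simp only [ha]; exact div_self hn'.ne'
  have hstep : ∀ k, a (k + 1) - a k = 1 / n := fun k => by
    simp only [ha]; push_cast; field_simp; ring
  have hsubint : ∀ k < n, Set.uIcc (a k) (a (k + 1)) ⊆ Set.uIcc (0 : ℝ) 1 := by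
    intro k hk
    have h1 : a k ≤ a (k + 1) := by
      have := hstep k
      have : (0 : ℝ) < 1 / n := by positivity
      linarith
    rw [Set.uIcc_of_le h1, Set.uIcc_of_le zero_le_one]
    refine Set.Icc_subset_Icc (by simp only [ha]; positivity) ?_
    simp only [ha]
    rw [div_le_one hn']
    exact_mod_cast hk
  have hc1 : IntervalIntegrable (fun x => logRest F₀ (H x)) volume 0 1 := by
    refine ContinuousOn.intervalIntegrable ?_
    rw [Set.uIcc_of_le zero_le_one]
    exact hP.continuousOn_logRest hc
  have hc2 := hP.intervalIntegrable_inv_mul hc F₀⁻¹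
  have s1 := intervalIntegral.sum_integral_adjacent_intervals (a := a) (n := n)
    (fun k hk => hc1.mono_set (hsubint k hk))
  have s2 := intervalIntegral.sum_integral_adjacent_intervals (a := a) (n := n)
    (fun k hk => hc2.mono_set (hsubint k hk))
  have s3 := Finset.sum_range_sub (fun k => logRest F₀ (H (a k))) n
  rw [ha0, han] at s1 s2 s3
  rw [hP.zero, logRest_self, sub_zero] at s3
  have hnC : (n : ℂ) = (((1 / n : ℝ)) : ℂ)⁻¹ := by push_cast; rw [one_div, inv_inv]
  rw [← s1, ← s2, ← s3, Finset.sum_div, Finset.mul_sum, ← Finset.sum_add_distrib,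
    ← Finset.sum_add_distrib, ← Finset.sum_sub_distrib, Finset.mul_sum]
  refine (norm_sum_le _ _).trans (Finset.sum_le_sum fun k hk => ?_)
  have hkn : k + 1 ≤ n := Finset.mem_range.mp hk
  have hFk := hF (k + 1) k.succ_pos hkn
  have hFrek := hFre (k + 1) k.succ_pos hkn
  have hle1 : a (k + 1) ≤ 1 := by
    simp only [ha]
    rw [div_le_one hn']
    exact_mod_cast hkn
  have hpos : 0 < a (k + 1) := by simp only [ha]; positivity
  have hX : 0 ≤ B ^ 2 / c ^ 2 * ((1 / (n : ℝ)) ^ 2 * (((k + 1 : ℕ) : ℝ) / n) ^ (2 * α - 2)) := by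
    have := Real.rpow_nonneg hpos.le (2 * α - 2)
    simp only [ha] at this
    positivity
  have h2 : (0 : ℝ) ≤ 2 ^ |2 * α - 2| := by positivity
  have h3 : 0 ≤ 1 / (2 * α) := by positivity
  -- The cell at 0 is separate; for k ≥ 1 the left endpoint is at least half the right one.
  rcases Nat.eq_zero_or_pos k with rfl | hk0
  · have e1 : a (0 + 1) = 1 / n := by simp [ha]
    have := hP.norm_first_cell_le hα hc hB (h := 1 / n) (by positivity) (e1 ▸ hle1) hFrek
      (by simpa using hFk)
    rw [ha0, e1, hnC]
    refine this.trans ?_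
    rw [show (((0 + 1 : ℕ) : ℝ) / n) = 1 / n by simp] at hX ⊢
    nlinarith
  · have := hP.norm_cell_le hc hB (a := a k) (b := a (k + 1)) (F := F (k + 1))
      (by have := hstep k; have : (0 : ℝ) < 1 / n := by positivity
          linarith) hle1 hpos (by
        simp only [ha]
        rw [div_div, div_le_div_iff₀ (by positivity) hn']
        push_cast
        have : (1 : ℝ) ≤ k := by exact_mod_cast hk0
        nlinarith) hFrek (by rw [hstep]; exact hFk)
    rw [hstep] at this
    rw [hnC]
    refine this.trans ?_
    change _ * (B ^ 2 / c ^ 2) * ((1 / (n : ℝ)) ^ 2 * (((k + 1 : ℕ) : ℝ) / n) ^ (2 * α - 2)) ≤ _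
    nlinarith

end SingularProfile

/-! ### Total cell error and the rate -/

theorem rate_nonneg (α : ℝ) (n : ℕ) : 0 ≤ rate α n := Real.rpow_nonneg (Nat.cast_nonneg n) _

theorem one_div_le_rate {α : ℝ} (hα : 0 < α) {n : ℕ} (hn : 0 < n) : 1 / (n : ℝ) ≤ rate α n := by
  have hn' : (1 : ℝ) ≤ n := by exact_mod_cast hn
  rw [one_div, ← Real.rpow_neg_one, rate]
  refine Real.rpow_le_rpow_of_exponent_le hn' (neg_le_neg ?_)
  rw [div_le_one (by linarith)]
  linarith [min_le_right α 1]

/-- For α ≥ 1 every power is at most 1 and the rate is 1/n. For α < 1 the exponent 2α is lowered to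
β = 3α/(2 + α), the exponent of the rate: β ≤ 2α keeps the termwise bound, and β < 1 makes Σ k^(β-2)
converge, so α = 1/2 produces no logarithm. -/
theorem sum_cell_error_le {α : ℝ} (hα : 0 < α) :
    ∃ C : ℝ, 0 ≤ C ∧ ∀ n : ℕ, 0 < n →
      ∑ k ∈ Finset.range n, (1 / (n : ℝ)) ^ 2 * (((k + 1 : ℕ) : ℝ) / n) ^ (2 * α - 2) ≤
        C * rate α n := by
  have hx : ∀ n k : ℕ, 0 < n → k ∈ Finset.range n →
      0 < ((k + 1 : ℕ) : ℝ) / n ∧ ((k + 1 : ℕ) : ℝ) / n ≤ 1 := by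
    intro n k hn hk
    have hn' : (0 : ℝ) < n := by exact_mod_cast hn
    refine ⟨by positivity, ?_⟩
    rw [div_le_one hn']
    exact_mod_cast Finset.mem_range.mp hk
  rcases le_or_gt 1 α with h1 | h1
  · refine ⟨1, zero_le_one, fun n hn => ?_⟩
    have hn' : (0 : ℝ) < n := by exact_mod_cast hn
    rw [one_mul]
    refine le_trans ?_ (one_div_le_rate hα hn)
    calc _ ≤ ∑ k ∈ Finset.range n, (1 / (n : ℝ)) ^ 2 * 1 := by
          refine Finset.sum_le_sum fun k hk => ?_
          obtain ⟨h2, h3⟩ := hx n k hn hk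
          exact mul_le_mul_of_nonneg_left
            (Real.rpow_le_one h2.le h3 (by linarith)) (by positivity)
      _ = 1 / (n : ℝ) := by
          rw [Finset.sum_const, Finset.card_range, nsmul_eq_mul]
          field_simp
  · set β := (2 * min α 1 + α) / (2 + α) with hβ
    have hmin : min α 1 = α := min_eq_left h1.le
    have hβ1 : β < 1 := by
      rw [hβ, hmin, div_lt_one (by linarith)]; linarith
    have hβ2 : β ≤ 2 * α := by
      rw [hβ, hmin, div_le_iff₀ (by linarith)]; nlinarith
    have hsum : Summable fun k : ℕ => ((k + 1 : ℕ) : ℝ) ^ (β - 2) := by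
      exact (summable_nat_add_iff 1).mpr (Real.summable_nat_rpow.mpr (by linarith))
    refine ⟨∑' k : ℕ, ((k + 1 : ℕ) : ℝ) ^ (β - 2),
      tsum_nonneg fun k => Real.rpow_nonneg (Nat.cast_nonneg _) _, fun n hn => ?_⟩
    have hn' : (0 : ℝ) < n := by exact_mod_cast hn
    have hterm : ∀ k ∈ Finset.range n,
        (1 / (n : ℝ)) ^ 2 * (((k + 1 : ℕ) : ℝ) / n) ^ (2 * α - 2) ≤
          ((k + 1 : ℕ) : ℝ) ^ (β - 2) * rate α n := by
      intro k hk
      obtain ⟨h2, h3⟩ := hx n k hn hk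
      calc _ ≤ (1 / (n : ℝ)) ^ 2 * (((k + 1 : ℕ) : ℝ) / n) ^ (β - 2) := by
            refine mul_le_mul_of_nonneg_left ?_ (by positivity)
            exact Real.rpow_le_rpow_of_exponent_ge h2 h3 (by linarith)
        _ = _ := by
            rw [Real.div_rpow (by positivity) hn'.le, rate, ← hβ,
              show -β = -(β - 2) - (2 : ℕ) by push_cast; ring, Real.rpow_sub_natCast hn'.ne',
              Real.rpow_neg hn'.le]
            field_simp
    calc _ ≤ ∑ k ∈ Finset.range n, ((k + 1 : ℕ) : ℝ) ^ (β - 2) * rate α n :=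
          Finset.sum_le_sum hterm
      _ = (∑ k ∈ Finset.range n, ((k + 1 : ℕ) : ℝ) ^ (β - 2)) * rate α n := by
          rw [Finset.sum_mul]
      _ ≤ _ := by
          refine mul_le_mul_of_nonneg_right ?_ (rate_nonneg α n)
          exact hsum.sum_le_tsum _ fun k _ => Real.rpow_nonneg (Nat.cast_nonneg _) _

/-! ### The limit profile and its singular bounds -/

/-- The derivative of `x ↦ gammaP α (t * x)`. -/
def gammaDens (α t x : ℝ) : ℝ := x ^ (α - 1) / Real.Gamma α * (t ^ α * Real.exp (-(t * x)))

/-- The second derivative of `x ↦ gammaP α (t * x)`. -/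
def gammaDensDeriv (α t x : ℝ) : ℝ :=
  ((α - 1) * x ^ (α - 2) - t * x ^ (α - 1)) / Real.Gamma α * (t ^ α * Real.exp (-(t * x)))

theorem hasDerivAt_gammaDens (α t : ℝ) {x : ℝ} (hx : 0 < x) :
    HasDerivAt (gammaDens α t) (gammaDensDeriv α t x) x := by
  have d1 : HasDerivAt (fun x : ℝ => x ^ (α - 1)) ((α - 1) * x ^ (α - 1 - 1)) x :=
    Real.hasDerivAt_rpow_const (Or.inl hx.ne')
  have d0 : HasDerivAt (fun x : ℝ => t * x) t x := by simpa using (hasDerivAt_id x).const_mul t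
  have d2 : HasDerivAt (fun x : ℝ => Real.exp (-(t * x))) (Real.exp (-(t * x)) * -t) x := d0.neg.exp
  refine ((d1.div_const (Real.Gamma α)).fun_mul (d2.const_mul (t ^ α))).congr_deriv ?_
  rw [gammaDensDeriv, show α - 1 - 1 = α - 2 by ring]
  ring

theorem gammaCorr_eq (α t x : ℝ) : gammaCorr α t x = gammaDens α t x * ((1 - α - t * x) / 2) := by
  rw [gammaCorr, gammaDens]; ring

theorem hasDerivAt_gammaCorr (α t : ℝ) {x : ℝ} (hx : 0 < x) :
    HasDerivAt (gammaCorr α t)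
      (gammaDensDeriv α t x * ((1 - α - t * x) / 2) - gammaDens α t x * (t / 2)) x := by
  have d0 : HasDerivAt (fun x : ℝ => t * x) t x := by simpa using (hasDerivAt_id x).const_mul t
  have h := (hasDerivAt_gammaDens α t hx).fun_mul ((d0.const_sub (1 - α)).div_const 2)
  have e : gammaCorr α t = fun x => gammaDens α t x * ((1 - α - t * x) / 2) :=
    funext (gammaCorr_eq α t)
  rw [e]
  refine h.congr_deriv ?_
  ring

theorem exists_singular_bounds {α : ℝ} (hα : 0 < α) {t : ℝ} (ht : 0 ≤ t) :
    ∃ A : ℝ, 0 ≤ A ∧ ∀ x ∈ Set.Ioc (0 : ℝ) 1,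
      |gammaP α (t * x)| ≤ A * x ^ α ∧ |gammaDens α t x| ≤ A * x ^ (α - 1) ∧
      |gammaDensDeriv α t x| ≤ A * x ^ (α - 2) ∧ |gammaCorr α t x| ≤ A * x ^ (α - 1) ∧
      |gammaDensDeriv α t x * ((1 - α - t * x) / 2) - gammaDens α t x * (t / 2)| ≤
        A * x ^ (α - 2) := by
  have hG : 0 < Real.Gamma α := Real.Gamma_pos_of_pos hα
  have hta : 0 ≤ t ^ α := Real.rpow_nonneg ht _
  set A₁ := t ^ α / α / Real.Gamma α with hA₁
  set A₂ := t ^ α / Real.Gamma α with hA₂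
  set A₃ := (|α - 1| + t) * A₂ with hA₃
  set L := (1 + α + t) / 2 with hL
  have h1 : 0 ≤ A₁ := by positivity
  have h2 : 0 ≤ A₂ := by positivity
  have h3 : 0 ≤ A₃ := by positivity
  have hL0 : 0 ≤ L := by positivity
  refine ⟨A₁ + A₂ + A₃ + A₂ * L + A₃ * L + A₂ * (t / 2), by positivity, fun x hx => ?_⟩
  have hx0 := hx.1
  have hE : Real.exp (-(t * x)) ≤ 1 := by
    rw [Real.exp_le_one_iff]; nlinarith
  have hpow : x ^ (α - 1) ≤ x ^ (α - 2) :=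
    Real.rpow_le_rpow_of_exponent_ge hx0 hx.2 (by linarith)
  have p0 := Real.rpow_nonneg hx0.le α
  have p1 := Real.rpow_nonneg hx0.le (α - 1)
  have p2 := Real.rpow_nonneg hx0.le (α - 2)
  have b1 : |gammaP α (t * x)| ≤ A₁ * x ^ α := by
    have := abs_integral_rpow_mul_le hα ht (f := fun v => Real.exp (-(x * v))) (B := 1)
      (fun v hv => by
        rw [abs_of_pos (Real.exp_pos _), Real.exp_le_one_iff]; nlinarith [hv.1])
    rw [gammaP_mul_eq hx0 ht, abs_div, abs_mul, abs_of_pos hG, abs_of_nonneg p0]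
    calc _ ≤ x ^ α * (1 * (t ^ α / α)) / Real.Gamma α := by gcongr
      _ = _ := by rw [hA₁]; ring
  have b2 : |gammaDens α t x| ≤ A₂ * x ^ (α - 1) := by
    rw [gammaDens, abs_of_nonneg (by positivity)]
    calc _ ≤ x ^ (α - 1) / Real.Gamma α * (t ^ α * 1) := by gcongr
      _ = _ := by rw [hA₂]; ring
  have b3 : |gammaDensDeriv α t x| ≤ A₃ * x ^ (α - 2) := by
    rw [gammaDensDeriv, abs_mul, abs_div, abs_of_pos hG,
      abs_of_nonneg (show 0 ≤ t ^ α * Real.exp (-(t * x)) by positivity)]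
    have : |(α - 1) * x ^ (α - 2) - t * x ^ (α - 1)| ≤ (|α - 1| + t) * x ^ (α - 2) := by
      refine (abs_sub _ _).trans ?_
      rw [abs_mul, abs_mul, abs_of_nonneg p1, abs_of_nonneg p2, abs_of_nonneg ht, add_mul]
      gcongr
    calc _ ≤ (|α - 1| + t) * x ^ (α - 2) / Real.Gamma α * (t ^ α * 1) := by gcongr
      _ = _ := by rw [hA₃, hA₂]; ring
  have bL : |(1 - α - t * x) / 2| ≤ L := by
    rw [abs_div, abs_of_pos (zero_lt_two (α := ℝ)), hL]
    have : t * x ≤ t := mul_le_of_le_one_right ht hx.2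
    have : 0 ≤ t * x := by positivity
    have : |1 - α - t * x| ≤ 1 + α + t := by
      rw [abs_le]; constructor <;> linarith
    linarith
  have b4 : |gammaCorr α t x| ≤ A₂ * L * x ^ (α - 1) := by
    rw [gammaCorr_eq, abs_mul]
    calc _ ≤ A₂ * x ^ (α - 1) * L := by gcongr
      _ = _ := by ring
  have b5 : |gammaDensDeriv α t x * ((1 - α - t * x) / 2) - gammaDens α t x * (t / 2)| ≤
      (A₃ * L + A₂ * (t / 2)) * x ^ (α - 2) := by
    refine (abs_sub _ _).trans ?_
    rw [abs_mul, abs_mul, abs_of_nonneg (show 0 ≤ t / 2 by positivity)]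
    calc _ ≤ A₃ * x ^ (α - 2) * L + A₂ * x ^ (α - 1) * (t / 2) := by gcongr
      _ ≤ A₃ * x ^ (α - 2) * L + A₂ * x ^ (α - 2) * (t / 2) := by gcongr
      _ = _ := by ring
  have q1 : 0 ≤ A₂ * L := by positivity
  have q2 : 0 ≤ A₃ * L := by positivity
  have q3 : 0 ≤ A₂ * (t / 2) := by positivity
  refine ⟨b1.trans ?_, b2.trans ?_, b3.trans ?_, b4.trans ?_, b5.trans ?_⟩ <;>
    exact mul_le_mul_of_nonneg_right (by linarith) (by assumption)

section Profile

variable {m : ℕ}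

theorem norm_sum_coeff_mul_le {u : Fin m → ℂ} {M : ℝ} (hM : ∀ l, ‖coeff u l‖ ≤ M) {f A : Fin m → ℝ}
    {X : ℝ} (hf : ∀ l, |f l| ≤ A l * X) :
    ‖∑ l, coeff u l * (f l : ℂ)‖ ≤ M * (∑ l, A l) * X := by
  refine (norm_sum_le _ _).trans ?_
  rw [Finset.mul_sum, Finset.sum_mul]
  refine Finset.sum_le_sum fun l _ => ?_
  rw [norm_mul, Complex.norm_real, Real.norm_eq_abs]
  have h0 : 0 ≤ M := (norm_nonneg _).trans (hM l)
  calc ‖coeff u l‖ * |f l| ≤ M * (A l * X) := by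
        have := hM l
        have := hf l
        gcongr
    _ = _ := by ring

theorem norm_coeff_le {u : Fin m → ℂ} {M : ℝ} (hM : ∑ l, ‖u l‖ ≤ M) (l : Fin m) :
    ‖coeff u l‖ ≤ (Real.exp M + 1) * Real.exp M := by
  have h1 : ‖u l‖ ≤ M :=
    (Finset.single_le_sum (f := fun l => ‖u l‖) (fun _ _ => norm_nonneg _) (Finset.mem_univ l)).trans hM
  have h2 : ‖∑ j ∈ Finset.Ioi l, u j‖ ≤ M :=
    (norm_sum_le _ _).trans ((Finset.sum_le_sum_of_subset_of_nonneg (Finset.subset_univ _)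
      (fun _ _ _ => norm_nonneg _)).trans hM)
  have h3 : ∀ z : ℂ, ‖z‖ ≤ M → ‖Complex.exp z‖ ≤ Real.exp M := fun z hz => by
    rw [Complex.norm_exp]
    exact Real.exp_le_exp.mpr ((Complex.re_le_norm z).trans hz)
  rw [coeff, norm_mul]
  have h4 : ‖Complex.exp (u l) - 1‖ ≤ Real.exp M + 1 :=
    (norm_sub_le _ _).trans (by rw [norm_one]; exact add_le_add (h3 _ h1) le_rfl)
  exact mul_le_mul h4 (h3 _ h2) (norm_nonneg _) (by positivity)

/-- The step weight at a point below all thresholds: every factor is active. -/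
theorem one_add_sum_coeff (u : Fin m → ℂ) : 1 + ∑ l, coeff u l = Complex.exp (∑ l, u l) := by
  have h1 := stepWeight_eq_one_add u (ρ := fun _ => 1) monotone_const 0
  have h2 := stepWeight_eq_exp u (fun _ => 1) 0
  simp only [zero_lt_one, if_true, mul_one] at h1 h2
  rw [← h1, h2]

/-- This is ln H(0), the source of -Σ u_j in C₂. The imaginary part of the sum is at most 1 < π, so
the branch is the right one. -/
theorem log_one_add_sum_coeff {u : Fin m → ℂ} (him : ∑ l, |(u l).im| ≤ 1) :
    Complex.log (1 + ∑ l, coeff u l) = ∑ l, u l := by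
  have h : |(∑ l, u l).im| ≤ 1 := by
    rw [Complex.im_sum]
    exact (Finset.abs_sum_le_sum_abs _ _).trans him
  have hpi := Real.pi_gt_three
  rw [one_add_sum_coeff, Complex.log_exp] <;> linarith [(abs_le.mp h).1, (abs_le.mp h).2]

/-- `H`, written through the lower incomplete Gamma function. -/
def lowerH (α : ℝ) (t : Fin m → ℝ) (u : Fin m → ℂ) (x : ℝ) : ℂ :=
  (1 + ∑ l, coeff u l) - ∑ l, coeff u l * (gammaP α (t l * x) : ℂ)

theorem H_eq_lowerH {α : ℝ} (hα : 0 < α) {t : Fin m → ℝ} (ht0 : ∀ l, 0 ≤ t l) (u : Fin m → ℂ)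
    {x : ℝ} (hx : 0 ≤ x) : H α t u x = lowerH α t u x := by
  rw [H, lowerH, add_sub_assoc, ← Finset.sum_sub_distrib]
  congr 1
  refine Finset.sum_congr rfl fun l _ => ?_
  rw [gammaQ_eq_one_sub hα (mul_nonneg (ht0 l) hx)]
  push_cast
  ring

theorem continuous_lowerH {α : ℝ} (hα : 0 < α) (t : Fin m → ℝ) (u : Fin m → ℂ) :
    Continuous (lowerH α t u) := by
  unfold lowerH
  refine continuous_const.sub (continuous_finsetSum _ fun l _ => continuous_const.mul ?_)
  exact Complex.continuous_ofReal.comp ((continuous_gammaP hα).comp (by fun_prop))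

theorem gammaP_nonneg {α : ℝ} (hα : 0 < α) {y : ℝ} (hy : 0 ≤ y) : 0 ≤ gammaP α y := by
  refine div_nonneg (intervalIntegral.integral_nonneg hy fun s hs => ?_)
    (Real.Gamma_pos_of_pos hα).le
  have := Real.rpow_nonneg hs.1 (α - 1)
  positivity

theorem gammaP_mono {α : ℝ} (hα : 0 < α) {y y' : ℝ} (hy : 0 ≤ y) (h : y ≤ y') :
    gammaP α y ≤ gammaP α y' := by
  refine div_le_div_of_nonneg_right ?_ (Real.Gamma_pos_of_pos hα).le
  refine intervalIntegral.integral_mono_interval le_rfl hy h ?_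
    (intervalIntegrable_rpow_mul hα (f := fun s => Real.exp (-s)) (by fun_prop) _ _)
  refine (ae_restrict_iff' measurableSet_Ioc).mpr (Eventually.of_forall fun v hv => ?_)
  have := Real.rpow_nonneg hv.1.le (α - 1)
  simp only [Pi.zero_apply]
  positivity

theorem gammaP_le_one {α : ℝ} (hα : 0 < α) {y : ℝ} (hy : 0 ≤ y) : gammaP α y ≤ 1 := by
  have h := gammaQ_eq_one_sub hα hy
  have h2 : 0 ≤ gammaQ α y := by
    refine div_nonneg (setIntegral_nonneg measurableSet_Ioi fun s hs => ?_)
      (Real.Gamma_pos_of_pos hα).le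
    have := Real.rpow_nonneg (hy.trans (le_of_lt hs)) (α - 1)
    positivity
  linarith

theorem re_H_ge {α : ℝ} (hα : 0 < α) {t : Fin m → ℝ} (ht : Antitone t) (ht0 : ∀ l, 0 ≤ t l)
    {u : Fin m → ℂ} {M : ℝ} (hM : ∑ l, ‖u l‖ ≤ M) (him : ∑ l, |(u l).im| ≤ 1) {x : ℝ}
    (hx : 0 ≤ x) : Real.exp (-M) * Real.cos 1 ≤ (H α t u x).re := by
  have hnn : ∀ l, 0 ≤ t l * x := fun l => mul_nonneg (ht0 l) hx
  refine re_one_add_sum_coeff_ge hM him (Q := fun l => gammaQ α (t l * x)) ?_ ?_ ?_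
  · intro l l' hl
    have := gammaP_mono hα (hnn l') (mul_le_mul_of_nonneg_right (ht hl) hx)
    change gammaQ α (t l * x) ≤ gammaQ α (t l' * x)
    rw [gammaQ_eq_one_sub hα (hnn l), gammaQ_eq_one_sub hα (hnn l')]
    linarith
  · intro l
    rw [gammaQ_eq_one_sub hα (hnn l)]
    linarith [gammaP_le_one hα (hnn l)]
  · intro l
    rw [gammaQ_eq_one_sub hα (hnn l)]
    linarith [gammaP_nonneg hα (hnn l)]

/-- The numerator of `G`. -/
def corrH (α : ℝ) (t : Fin m → ℝ) (u : Fin m → ℂ) (x : ℝ) : ℂ :=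
  ∑ l, coeff u l * (gammaCorr α (t l) x : ℂ)

theorem G_eq (α : ℝ) (t : Fin m → ℝ) (u : Fin m → ℂ) (x : ℝ) :
    G α t u x = (H α t u x)⁻¹ * corrH α t u x := by
  rw [G, corrH, one_div, mul_assoc]
  congr 1
  rw [Finset.mul_sum]
  refine Finset.sum_congr rfl fun l _ => ?_
  rw [gammaCorr]
  push_cast
  ring

theorem intervalIntegrable_corrH {α : ℝ} (hα : 0 < α) (t : Fin m → ℝ) (u : Fin m → ℂ) :
    IntervalIntegrable (corrH α t u) volume 0 1 := by
  have h : ∀ l ∈ Finset.univ, IntervalIntegrable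
      (fun x => coeff u l * (gammaCorr α (t l) x : ℂ)) volume 0 1 := fun l _ => by
    have := intervalIntegrable_gammaCorr hα (t l) 0 1
    exact (IntervalIntegrable.const_mul ⟨this.1.ofReal, this.2.ofReal⟩ _)
  have := IntervalIntegrable.sum _ h
  rwa [Finset.sum_fn] at this

/-- The vector u enters the bounds only through the coefficients, which are controlled by M; hence
one constant B for all such u. -/
theorem exists_singularProfile {α : ℝ} (hα : 0 < α) {t : Fin m → ℝ} (ht : Antitone t)
    (ht0 : ∀ l, 0 ≤ t l) (M : ℝ) :
    ∃ B : ℝ, 0 ≤ B ∧ ∀ u : Fin m → ℂ, ∑ l, ‖u l‖ ≤ M → ∑ l, |(u l).im| ≤ 1 →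
      SingularProfile α (Real.exp (-M) * Real.cos 1) B (1 + ∑ l, coeff u l) (lowerH α t u)
        (fun x => -∑ l, coeff u l * (gammaDens α (t l) x : ℂ))
        (fun x => -∑ l, coeff u l * (gammaDensDeriv α (t l) x : ℂ))
        (corrH α t u)
        (fun x => ∑ l, coeff u l * ((gammaDensDeriv α (t l) x * ((1 - α - t l * x) / 2) -
          gammaDens α (t l) x * (t l / 2) : ℝ) : ℂ)) := by
  choose A hA0 hA using fun l => exists_singular_bounds hα (ht0 l)
  refine ⟨(Real.exp M + 1) * Real.exp M * ∑ l, A l,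
    mul_nonneg (by positivity) (Finset.sum_nonneg fun l _ => hA0 l), fun u hM him => ?_⟩
  have hc := fun l => norm_coeff_le hM l
  have hsum : ∀ (f f' : Fin m → ℝ → ℝ) (x : ℝ), (∀ l, HasDerivAt (f l) (f' l x) x) →
      HasDerivAt (fun x => ∑ l, coeff u l * (f l x : ℂ)) (∑ l, coeff u l * (f' l x : ℂ)) x :=
    fun f f' x h => HasDerivAt.fun_sum fun l _ => ((h l).ofReal_comp).const_mul _
  refine ⟨?_, ?_, (continuous_lowerH hα t u).continuousOn, intervalIntegrable_corrH hα t u, ?_,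
    ?_, ?_, ?_, ?_, ?_, ?_, ?_, ?_⟩
  · have := re_H_ge hα ht ht0 hM him le_rfl
    rw [H_eq_lowerH hα ht0 u le_rfl] at this
    simpa [lowerH, gammaP_zero] using this
  · intro x hx
    rw [← H_eq_lowerH hα ht0 u hx.1]
    exact re_H_ge hα ht ht0 hM him hx.1
  · simp [lowerH, gammaP_zero]
  · intro x hx
    exact (hsum (fun l x => gammaP α (t l * x)) (fun l x => gammaDens α (t l) x) x
      (fun l => hasDerivAt_gammaP_mul hα (ht0 l) hx.1)).const_sub _
  · intro x hx
    exact (hsum _ _ x (fun l => hasDerivAt_gammaDens α (t l) hx.1)).fun_neg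
  · intro x hx
    exact hsum (fun l => gammaCorr α (t l)) (fun l x => _) x
      (fun l => hasDerivAt_gammaCorr α (t l) hx.1)
  · intro x hx
    rw [lowerH, sub_sub_cancel_left, norm_neg]
    exact norm_sum_coeff_mul_le hc fun l => (hA l x hx).1
  · intro x hx
    rw [norm_neg]
    exact norm_sum_coeff_mul_le hc fun l => (hA l x hx).2.1
  · intro x hx
    rw [norm_neg]
    exact norm_sum_coeff_mul_le hc fun l => (hA l x hx).2.2.1
  · intro x hx
    exact norm_sum_coeff_mul_le hc fun l => (hA l x hx).2.2.2.1
  · intro x hx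
    exact norm_sum_coeff_mul_le hc fun l => (hA l x hx).2.2.2.2

theorem modulusFactor_eq (α : ℝ) (ε : Fin m → ℝ) (u : Fin m → ℂ) (k : ℕ) :
    modulusFactor α ε u k = (1 + ∑ l, coeff u l) - ∑ l, coeff u l * (betaTail α (ε l) k : ℂ) := by
  rw [modulusFactor, add_sub_assoc, ← Finset.sum_sub_distrib]
  congr 1
  refine Finset.sum_congr rfl fun l _ => ?_
  push_cast
  ring

theorem exists_norm_modulusFactor_sub_le {α : ℝ} (hα : 0 < α) {t : Fin m → ℝ}
    (ht0 : ∀ l, 0 ≤ t l) (M : ℝ) :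
    ∃ B : ℝ, 0 ≤ B ∧ ∀ u : Fin m → ℂ, ∑ l, ‖u l‖ ≤ M → ∀ n k : ℕ, 0 < n → (∀ l, 2 * t l ≤ n) →
      0 < k → k ≤ n →
      ‖modulusFactor α (fun l => t l / n) u k - lowerH α t u ((k : ℝ) / n) -
        ((1 / n : ℝ) : ℂ) * corrH α t u ((k : ℝ) / n)‖ ≤
      B * (((k : ℝ) / n) ^ (α - 2) * (1 / (n : ℝ)) ^ 2) := by
  choose A hA0 hA using fun l => abs_betaTail_sub_gammaP_le hα (ht0 l)
  refine ⟨(Real.exp M + 1) * Real.exp M * ∑ l, A l,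
    mul_nonneg (by positivity) (Finset.sum_nonneg fun l _ => hA0 l),
    fun u hM n k hn hnt hk hkn => ?_⟩
  have h := norm_sum_coeff_mul_le (fun l => norm_coeff_le hM l)
    (fun l => hA l n k hn (hnt l) hk hkn)
  refine le_trans (le_of_eq ?_) h
  rw [modulusFactor_eq, lowerH, corrH, ← norm_neg]
  congr 1
  rw [Finset.mul_sum, sub_sub_sub_cancel_left, neg_sub, ← Finset.sum_sub_distrib,
    ← Finset.sum_sub_distrib]
  refine Finset.sum_congr rfl fun l _ => ?_
  push_cast
  ring

end Profile

/-! ### Expansion of the sum of logarithms -/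

variable {m : ℕ}

theorem log_eq_logRest (F₀ z : ℂ) :
    Complex.log z = Complex.log F₀ + F₀⁻¹ * (z - F₀) + logRest F₀ z := by
  rw [logRest]; ring

theorem integral_sum_coeff_mul {f : Fin m → ℝ → ℝ} (u : Fin m → ℂ)
    (hf : ∀ l, IntervalIntegrable (f l) volume 0 1) :
    ∫ x in (0 : ℝ)..1, ∑ l, coeff u l * (f l x : ℂ) =
      ∑ l, coeff u l * ((∫ x in (0 : ℝ)..1, f l x : ℝ) : ℂ) := by
  rw [intervalIntegral.integral_finsetSum fun l _ =>
    (IntervalIntegrable.const_mul ⟨(hf l).1.ofReal, (hf l).2.ofReal⟩ _)]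
  refine Finset.sum_congr rfl fun l _ => ?_
  rw [intervalIntegral.integral_const_mul, intervalIntegral.integral_ofReal]

/-- The linear part of the Euler-Maclaurin error. -/
theorem exists_norm_linear_error_le {α : ℝ} (hα : 0 < α) {t : Fin m → ℝ}
    (ht0 : ∀ l, 0 ≤ t l) (M : ℝ) :
    ∃ (K : ℝ) (n₀ : ℕ), 0 ≤ K ∧ ∀ n : ℕ, n₀ ≤ n → ∀ u : Fin m → ℂ, ∑ l, ‖u l‖ ≤ M →
      ‖(∑ k ∈ Finset.range n, (modulusFactor α (fun l => t l / n) u (k + 1) - (1 + ∑ l, coeff u l))) -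
        n * (∫ x in (0 : ℝ)..1, (lowerH α t u x - (1 + ∑ l, coeff u l))) -
        (∫ x in (0 : ℝ)..1, corrH α t u x) -
        (lowerH α t u 1 - (1 + ∑ l, coeff u l)) / 2‖ ≤ K * (1 / (n : ℝ)) := by
  -- The quantity is linear in the coefficients, so the estimate for each single t l suffices, and
  -- uniformity in u comes from `norm_coeff_le`.
  choose A hA0 hA using fun l => (isBigO_sum_betaTail hα (ht0 l)).exists_nonneg
  have hev : ∀ᶠ n : ℕ in atTop, ∀ l, ‖(∑ k ∈ Finset.range n, betaTail α (t l / n) (k + 1)) -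
        n * (∫ x in (0 : ℝ)..1, gammaP α (t l * x)) + (∫ x in (0 : ℝ)..1, gammaCorr α (t l) x) -
        gammaP α (t l) / 2‖ ≤ A l * ‖1 / (n : ℝ)‖ :=
    eventually_all.mpr fun l => (hA l).bound
  obtain ⟨n₀, hn₀⟩ := eventually_atTop.mp hev
  refine ⟨(Real.exp M + 1) * Real.exp M * ∑ l, A l, n₀,
    mul_nonneg (by positivity) (Finset.sum_nonneg fun l _ => hA0 l), fun n hn u hM => ?_⟩
  have h := norm_sum_coeff_mul_le (X := 1 / (n : ℝ)) (A := A) (fun l => norm_coeff_le hM l)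
    (fun l => by
      have := hn₀ n hn l
      rwa [Real.norm_of_nonneg (show 0 ≤ 1 / (n : ℝ) by positivity), Real.norm_eq_abs] at this)
  refine le_trans (le_of_eq ?_) h
  have e1 : ∀ k, modulusFactor α (fun l => t l / n) u (k + 1) - (1 + ∑ l, coeff u l) =
      -∑ l, coeff u l * (betaTail α (t l / n) (k + 1) : ℂ) := fun k => by
    rw [modulusFactor_eq]; ring
  have e2 : ∀ x, lowerH α t u x - (1 + ∑ l, coeff u l) =
      -∑ l, coeff u l * (gammaP α (t l * x) : ℂ) := fun x => by
    rw [lowerH]; ring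
  simp only [e1, e2, corrH, intervalIntegral.integral_neg, Finset.sum_neg_distrib, mul_one]
  rw [integral_sum_coeff_mul (f := fun l x => gammaP α (t l * x)) u fun l =>
      ((continuous_gammaP hα).comp (continuous_const.mul continuous_id)).intervalIntegrable 0 1,
    integral_sum_coeff_mul u fun l => intervalIntegrable_gammaCorr hα (t l) 0 1,
    Finset.sum_comm, ← norm_neg]
  congr 1
  rw [mul_neg, neg_div, Finset.mul_sum, Finset.sum_div]
  simp only [sub_neg_eq_add, ← Finset.sum_neg_distrib,
    ← Finset.sum_sub_distrib]
  refine Finset.sum_congr rfl fun l _ => ?_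
  rw [Finset.sum_neg_distrib, ← Finset.mul_sum]
  push_cast
  ring

/-- The Euler-Maclaurin expansion of the sum of the logarithms of the factors. -/
theorem exists_norm_sum_log_sub_le {α : ℝ} (hα : 0 < α) {t : Fin m → ℝ} (ht : Antitone t)
    (ht0 : ∀ l, 0 ≤ t l) (M : ℝ) :
    ∃ (K : ℝ) (n₀ : ℕ), 0 < n₀ ∧ ∀ n : ℕ, n₀ ≤ n → ∀ u : Fin m → ℂ, ∑ l, ‖u l‖ ≤ M →
      ∑ l, |(u l).im| ≤ 1 →
      ‖(∑ k ∈ Finset.range n,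
          Complex.log (modulusFactor α (fun l => min (t l / n) 1) u (k + 1))) -
        (C₁ α t u * n + C₂ α t u)‖ ≤ K * rate α n := by
  obtain ⟨B₁, hB₁, hprof⟩ := exists_singularProfile hα ht ht0 M
  obtain ⟨B₂, hB₂, happ⟩ := exists_norm_modulusFactor_sub_le hα ht0 M
  obtain ⟨K₁, n₁, hK₁, hlin⟩ := exists_norm_linear_error_le hα ht0 M
  obtain ⟨K₂, hK₂, hsum⟩ := sum_cell_error_le hα
  set c := Real.exp (-M) * Real.cos 1 with hc
  have hc0 : 0 < c := mul_pos (Real.exp_pos _) Real.cos_one_pos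
  set B := B₁ + B₂ with hB
  have hB0 : 0 ≤ B := by positivity
  set Q := (6 * 2 ^ |2 * α - 2| + 11 + 1 / (2 * α)) * (B ^ 2 / c ^ 2) with hQ
  have hQ0 : 0 ≤ Q := by positivity
  have hn₂ : ∀ᶠ n : ℕ in atTop, ∀ l, 2 * t l ≤ n :=
    eventually_all.mpr fun l => tendsto_natCast_atTop_atTop.eventually_ge_atTop (2 * t l)
  obtain ⟨n₂, hn₂⟩ := eventually_atTop.mp hn₂
  refine ⟨Q * K₂ + c⁻¹ * K₁, max 1 (max n₁ n₂), by simp, fun n hn u hM him => ?_⟩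
  have hn1 : 0 < n := (le_max_left _ _).trans hn
  have hnn1 : n₁ ≤ n := ((le_max_left _ _).trans (le_max_right _ _)).trans hn
  have hnn2 : n₂ ≤ n := ((le_max_right _ _).trans (le_max_right _ _)).trans hn
  have hn' : (0 : ℝ) < n := by exact_mod_cast hn1
  have ht2 := hn₂ n hnn2
  -- Once n ≥ 2 t l for all l, the truncation at 1 is inactive.
  have hmin : (fun l => min (t l / n) 1) = fun l => t l / (n : ℝ) := by
    funext l
    refine min_eq_left ?_
    rw [div_le_one hn']
    linarith [ht2 l, ht0 l]
  rw [hmin]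
  have hP₁ := hprof u hM him
  have hPre : ∀ k, 0 < k → c ≤ (modulusFactor α (fun l => t l / n) u k).re := by
    intro k hk
    rw [← hmin]
    exact re_modulusFactor_ge hα hM him (fun l l' hl => min_le_min_right _
      (div_le_div_of_nonneg_right (ht hl) (Nat.cast_nonneg n)))
      (fun l => le_min (div_nonneg (ht0 l) (Nat.cast_nonneg n)) zero_le_one)
      (fun l => min_le_right _ _) hk
  have hmono : ∀ {x s : ℝ}, 0 ≤ x → B₁ * x ^ s ≤ B * x ^ s := fun hx =>
    mul_le_mul_of_nonneg_right (by linarith) (Real.rpow_nonneg hx _)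
  have hP : SingularProfile α c B _ _ _ _ _ _ := { hP₁ with
    norm_sub_zero_le := fun x hx => (hP₁.norm_sub_zero_le x hx).trans (hmono hx.1.le)
    norm_p_le := fun x hx => (hP₁.norm_p_le x hx).trans (hmono hx.1.le)
    norm_q_le := fun x hx => (hP₁.norm_q_le x hx).trans (hmono hx.1.le)
    norm_corr_le := fun x hx => (hP₁.norm_corr_le x hx).trans (hmono hx.1.le)
    norm_r_le := fun x hx => (hP₁.norm_r_le x hx).trans (hmono hx.1.le) }
  have hnl := hP.norm_sum_logRest_sub_le hα hc0 hB0 hn1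
    (F := modulusFactor α (fun l => t l / n) u) (fun k hk _ => hPre k hk) (fun k hk hkn =>
      (happ u hM n k hn1 ht2 hk hkn).trans (mul_le_mul_of_nonneg_right (by linarith)
        (mul_nonneg (Real.rpow_nonneg (by positivity) _) (by positivity))))
  have hl := hlin n hnn1 u hM
  set F₀ := 1 + ∑ l, coeff u l with hF₀
  set Hl := lowerH α t u with hHl
  have hcont : ContinuousOn Hl (Set.uIcc 0 1) := (continuous_lowerH hα t u).continuousOn
  have i1 : IntervalIntegrable (fun x => Hl x - F₀) volume 0 1 :=
    (hcont.sub continuousOn_const).intervalIntegrable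
  have i2 : IntervalIntegrable (fun x => logRest F₀ (Hl x)) volume 0 1 := by
    refine ContinuousOn.intervalIntegrable ?_
    rw [Set.uIcc_of_le zero_le_one]
    exact hP.continuousOn_logRest hc0
  have i3 := hP.intervalIntegrable_inv_mul hc0 F₀⁻¹
  have i4 := intervalIntegrable_corrH hα t u
  have eC₁ : C₁ α t u = Complex.log F₀ + F₀⁻¹ * (∫ x in (0 : ℝ)..1, (Hl x - F₀)) +
      ∫ x in (0 : ℝ)..1, logRest F₀ (Hl x) := by
    have : C₁ α t u = ∫ x in (0 : ℝ)..1,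
        (Complex.log F₀ + F₀⁻¹ * (Hl x - F₀) + logRest F₀ (Hl x)) := by
      refine intervalIntegral.integral_congr fun x hx => ?_
      rw [Set.uIcc_of_le zero_le_one] at hx
      rw [H_eq_lowerH hα ht0 u hx.1]
      exact log_eq_logRest _ _
    rw [this, intervalIntegral.integral_add (intervalIntegrable_const.add (i1.const_mul _)) i2,
      intervalIntegral.integral_add intervalIntegrable_const (i1.const_mul _),
      intervalIntegral.integral_const_mul]
    simp
  have eG : (∫ x in (0 : ℝ)..1, G α t u x) =
      (∫ x in (0 : ℝ)..1, ((Hl x)⁻¹ - F₀⁻¹) * corrH α t u x) +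
        F₀⁻¹ * ∫ x in (0 : ℝ)..1, corrH α t u x := by
    rw [← intervalIntegral.integral_const_mul, ← intervalIntegral.integral_add i3 (i4.const_mul _)]
    refine intervalIntegral.integral_congr fun x hx => ?_
    rw [Set.uIcc_of_le zero_le_one] at hx
    rw [G_eq, H_eq_lowerH hα ht0 u hx.1]
    ring
  have elog : Complex.log (H α t u 1) = Complex.log F₀ + F₀⁻¹ * (Hl 1 - F₀) + logRest F₀ (Hl 1) := by
    rw [H_eq_lowerH hα ht0 u zero_le_one]
    exact log_eq_logRest _ _
  -- In C₂ this cancels the term log F₀ coming from log H(1); the terms n log F₀ cancel between the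
  -- sum and C₁ n.
  have eu : ∑ j, u j = Complex.log F₀ := (log_one_add_sum_coeff him).symm
  have esum : ∑ k ∈ Finset.range n, Complex.log (modulusFactor α (fun l => t l / n) u (k + 1)) =
      n * Complex.log F₀ +
      F₀⁻¹ * (∑ k ∈ Finset.range n, (modulusFactor α (fun l => t l / n) u (k + 1) - F₀)) +
      ∑ k ∈ Finset.range n, logRest F₀ (modulusFactor α (fun l => t l / n) u (k + 1)) := by
    simp only [log_eq_logRest F₀ (modulusFactor _ _ _ _)]
    rw [Finset.sum_add_distrib, Finset.sum_add_distrib, Finset.sum_const, Finset.card_range,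
      nsmul_eq_mul, Finset.mul_sum]
  -- The remainder is F₀⁻¹ times the linear error, which is O(1/n), minus the error of the `logRest`
  -- part.
  have key : (∑ k ∈ Finset.range n,
      Complex.log (modulusFactor α (fun l => t l / n) u (k + 1))) -
        (C₁ α t u * n + C₂ α t u) =
      F₀⁻¹ * ((∑ k ∈ Finset.range n, (modulusFactor α (fun l => t l / n) u (k + 1) - F₀)) -
        n * (∫ x in (0 : ℝ)..1, (Hl x - F₀)) -
        (∫ x in (0 : ℝ)..1, corrH α t u x) - (Hl 1 - F₀) / 2) -
      ((n : ℂ) * (∫ x in (0 : ℝ)..1, logRest F₀ (Hl x)) +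
        (∫ x in (0 : ℝ)..1, ((Hl x)⁻¹ - F₀⁻¹) * corrH α t u x) + logRest F₀ (Hl 1) / 2 -
        ∑ k ∈ Finset.range n, logRest F₀ (modulusFactor α (fun l => t l / n) u (k + 1))) := by
    rw [C₂, eC₁, eG, elog, eu, esum]
    ring
  rw [key]
  refine (norm_sub_le _ _).trans ?_
  rw [norm_mul]
  have hr := one_div_le_rate hα hn1
  have b1 : ‖F₀⁻¹‖ * ‖(∑ k ∈ Finset.range n, (modulusFactor α (fun l => t l / n) u (k + 1) - F₀)) -
        n * (∫ x in (0 : ℝ)..1, (Hl x - F₀)) -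
        (∫ x in (0 : ℝ)..1, corrH α t u x) - (Hl 1 - F₀) / 2‖ ≤ c⁻¹ * (K₁ * rate α n) :=
    mul_le_mul (norm_inv_le_of_re_ge hc0 hP.re_zero)
      (hl.trans (mul_le_mul_of_nonneg_left hr hK₁)) (norm_nonneg _) (by positivity)
  have b2 := hnl.trans (mul_le_mul_of_nonneg_left (hsum n hn1) hQ0)
  calc _ ≤ c⁻¹ * (K₁ * rate α n) + Q * (K₂ * rate α n) := add_le_add b1 b2
    _ = _ := by ring

/-! ### Analyticity of C₁ and C₂ through C([0,1], ℂ) -/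

section FunctionAlgebra

variable {X : Type*} [TopologicalSpace X] [CompactSpace X]

/-- The Taylor series of `log (1 + ·)` in the algebra of continuous functions. -/
def logSeries (X : Type*) [TopologicalSpace X] [CompactSpace X] :
    FormalMultilinearSeries ℂ C(X, ℂ) C(X, ℂ) :=
  FormalMultilinearSeries.ofScalars C(X, ℂ) fun n : ℕ => ((-1) ^ (n + 1) / n : ℂ)

theorem one_le_radius_logSeries : 1 ≤ (logSeries X).radius := by
  have h := FormalMultilinearSeries.inv_le_ofScalars_radius_of_tendsto C(X, ℂ)
    (fun n : ℕ => ((-1) ^ (n + 1) / n : ℂ)) (r := 1) one_ne_zero ?_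
  · rwa [inv_one, ENNReal.coe_one] at h
  · have h1 := tendsto_natCast_div_add_atTop (𝕜 := ℝ) 1
    refine h1.congr fun n => ?_
    simp only [norm_div, norm_pow, norm_neg, norm_one, one_pow, Complex.norm_natCast]
    push_cast
    -- The coefficient of index 0 is a division by zero, hence 0, the correct constant term of log(1
    -- + y).
    rcases Nat.eq_zero_or_pos n with rfl | hn
    · simp
    · field_simp

theorem logSeries_sum_apply {y : C(X, ℂ)} (hy : ‖y‖ < 1) (x : X) :
    (logSeries X).sum y x = Complex.log (1 + y x) := by
  have hmem : y ∈ Metric.eball (0 : C(X, ℂ)) (logSeries X).radius := by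
    refine Metric.eball_subset_eball one_le_radius_logSeries ?_
    rw [mem_eball_zero_iff, ← ofReal_norm, ENNReal.ofReal_lt_one]
    exact hy
  have h := ((logSeries X).hasSum hmem).mapL (ContinuousMap.evalCLM ℂ x)
  have h2 := Complex.hasSum_taylorSeries_log (z := y x) ((y.norm_coe_le_norm x).trans_lt hy)
  refine h.unique (h2.congr_fun fun n => ?_)
  simp [logSeries, FormalMultilinearSeries.ofScalars_apply_eq]
  ring

/-- The pointwise logarithm is analytic on functions with values in a right half-plane. -/
theorem exists_analyticAt_log {f₀ : C(X, ℂ)} (h₀ : ∀ x, 0 < (f₀ x).re) :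
    ∃ Λ : C(X, ℂ) → C(X, ℂ), AnalyticAt ℂ Λ f₀ ∧
      ∀ᶠ f in nhds f₀, ∀ x, Λ f x = Complex.log (f x) := by
  have hne : ∀ x, f₀ x ≠ 0 := fun x h => by simpa [h] using h₀ x
  set g : C(X, ℂ) := ⟨fun x => (f₀ x)⁻¹, f₀.continuous.inv₀ hne⟩ with hg
  set L : C(X, ℂ) := ⟨fun x => Complex.log (f₀ x),
    f₀.continuous.clog fun x => Or.inl (h₀ x)⟩ with hL
  have hg0 : f₀ * g - 1 = 0 := by
    ext x
    simp [hg, hne x]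
  have hlin : AnalyticAt ℂ (fun f : C(X, ℂ) => f * g - 1) f₀ :=
    (analyticAt_id.mul analyticAt_const).sub analyticAt_const
  refine ⟨fun f => L + (logSeries X).sum (f * g - 1), analyticAt_const.add ?_, ?_⟩
  · have hS : AnalyticAt ℂ (logSeries X).sum 0 :=
      ((logSeries X).hasFPowerSeriesOnBall
        (zero_lt_one.trans_le one_le_radius_logSeries)).analyticAt
    exact AnalyticAt.comp_of_eq hS hlin hg0
  · have hnear : ∀ᶠ f in nhds f₀, ‖f * g - 1‖ < 1 := by
      have := hlin.continuousAt.norm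
      refine this.eventually_lt continuousAt_const ?_
      rw [hg0, norm_zero]
      exact zero_lt_one
    filter_upwards [hnear] with f hf x
    rw [ContinuousMap.add_apply, logSeries_sum_apply hf]
    have hy : ‖(f * g - 1) x‖ < 1 := ((f * g - 1).norm_coe_le_norm x).trans_lt hf
    have hre : 0 < (1 + (f * g - 1) x).re := by
      have := (abs_lt.mp ((Complex.abs_re_le_norm _).trans_lt hy)).1
      rw [Complex.add_re, Complex.one_re]
      linarith
    have hprod : f x = f₀ x * (1 + (f * g - 1) x) := by
      have := hne x
      simp [hg]
      field_simp
    -- Both f₀ x and 1 + y, with y = f x / f₀ x - 1, lie in the open right half-plane. Their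
    -- arguments add up to less than π in absolute value, so the principal logarithm of the product
    -- splits.
    have a1 := abs_lt.mp (Complex.abs_arg_lt_pi_div_two_iff.mpr (Or.inl (h₀ x)))
    have a2 := abs_lt.mp (Complex.abs_arg_lt_pi_div_two_iff.mpr (Or.inl hre))
    rw [hprod, Complex.log_mul (hne x) (fun h => by rw [h, Complex.zero_re] at hre; exact hre.false)
      ⟨by linarith [a1.1, a2.1], by linarith [a1.2, a2.2]⟩]
    rfl

/-- Inversion is analytic at the units of a Banach algebra, and the units of C(X, ℂ) are the
functions without zeros, an open set. -/
theorem exists_analyticAt_inv {f₀ : C(X, ℂ)} (h₀ : ∀ x, f₀ x ≠ 0) :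
    ∃ Λ : C(X, ℂ) → C(X, ℂ), AnalyticAt ℂ Λ f₀ ∧
      ∀ᶠ f in nhds f₀, ∀ x, Λ f x = (f x)⁻¹ := by
  have hu : IsUnit f₀ := (ContinuousMap.isUnit_iff_forall_ne_zero f₀).mpr h₀
  refine ⟨Ring.inverse, ?_, ?_⟩
  · obtain ⟨z, hz⟩ := hu
    rw [← hz]
    exact analyticAt_inverse z
  · filter_upwards [Units.isOpen.mem_nhds hu] with f hf x
    have h1 : f * Ring.inverse f = 1 := Ring.mul_inverse_cancel f hf
    have h2 : f x * (Ring.inverse f) x = 1 := by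
      rw [← ContinuousMap.mul_apply, h1]; rfl
    exact eq_inv_of_mul_eq_one_right h2

end FunctionAlgebra

/-- Integration over `[0, 1]` against an integrable weight. -/
theorem exists_integral_clm {ω : ℝ → ℂ} (hω : IntervalIntegrable ω volume 0 1) :
    ∃ J : C(Set.Icc (0 : ℝ) 1, ℂ) →L[ℂ] ℂ, ∀ f : C(Set.Icc (0 : ℝ) 1, ℂ),
      J f = ∫ x in (0 : ℝ)..1, f (Set.projIcc 0 1 zero_le_one x) * ω x := by
  have hi : ∀ f : C(Set.Icc (0 : ℝ) 1, ℂ), IntervalIntegrable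
      (fun x => f (Set.projIcc 0 1 zero_le_one x) * ω x) volume 0 1 := fun f =>
    hω.continuousOn_mul (f.continuous.comp continuous_projIcc).continuousOn
  refine ⟨LinearMap.mkContinuous
    { toFun := fun f => ∫ x in (0 : ℝ)..1, f (Set.projIcc 0 1 zero_le_one x) * ω x
      map_add' := fun f g => ?_
      map_smul' := fun a f => ?_ } (∫ x in (0 : ℝ)..1, ‖ω x‖) fun f => ?_, fun f => rfl⟩
  · rw [← intervalIntegral.integral_add (hi f) (hi g)]
    exact intervalIntegral.integral_congr fun x _ => by simp [add_mul]
  · rw [RingHom.id_apply, smul_eq_mul, ← intervalIntegral.integral_const_mul]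
    exact intervalIntegral.integral_congr fun x _ => by simp [mul_assoc]
  · have := intervalIntegral.norm_integral_le_of_norm_le (μ := volume) (a := 0) (b := 1)
      (f := fun x => f (Set.projIcc 0 1 zero_le_one x) * ω x) (g := fun x => ‖f‖ * ‖ω x‖)
      zero_le_one (Eventually.of_forall fun x _ => by
        rw [norm_mul]
        exact mul_le_mul_of_nonneg_right (f.norm_coe_le_norm _) (norm_nonneg _))
      (hω.norm.const_mul _)
    rw [intervalIntegral.integral_const_mul, mul_comm] at this
    exact this

/-- `H` as an element of the algebra of continuous functions on `[0, 1]`. -/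
def continuousH {α : ℝ} (hα : 0 < α) (t : Fin m → ℝ) (u : Fin m → ℂ) :
    C(Set.Icc (0 : ℝ) 1, ℂ) :=
  1 + ∑ l, coeff u l • ⟨fun x => ((1 - gammaP α (t l * x) : ℝ) : ℂ),
    Complex.continuous_ofReal.comp (continuous_const.sub
      ((continuous_gammaP hα).comp (continuous_const.mul continuous_subtype_val)))⟩

theorem continuousH_apply {α : ℝ} (hα : 0 < α) {t : Fin m → ℝ} (ht0 : ∀ l, 0 ≤ t l)
    (u : Fin m → ℂ) (x : Set.Icc (0 : ℝ) 1) : continuousH hα t u x = H α t u x := by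
  rw [continuousH, H, ContinuousMap.add_apply, ContinuousMap.sum_apply]
  congr 1
  refine Finset.sum_congr rfl fun l _ => ?_
  rw [gammaQ_eq_one_sub hα (mul_nonneg (ht0 l) x.2.1)]
  rfl

theorem analyticAt_coeff (l : Fin m) (u : Fin m → ℂ) :
    AnalyticAt ℂ (fun u : Fin m → ℂ => coeff u l) u :=
  analyticOnNhd_coeff l u (Set.mem_univ u)

theorem analyticAt_continuousH {α : ℝ} (hα : 0 < α) (t : Fin m → ℝ) (u : Fin m → ℂ) :
    AnalyticAt ℂ (continuousH hα t) u := by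
  unfold continuousH
  exact analyticAt_const.add (Finset.analyticAt_fun_sum _ fun l _ =>
    (analyticAt_coeff l u).smul analyticAt_const)

theorem re_H_pos {α : ℝ} (hα : 0 < α) {t : Fin m → ℝ} (ht : Antitone t) (ht0 : ∀ l, 0 ≤ t l)
    {u : Fin m → ℂ} (him : ∑ l, |(u l).im| ≤ 1) {x : ℝ} (hx : 0 ≤ x) : 0 < (H α t u x).re :=
  (mul_pos (Real.exp_pos _) Real.cos_one_pos).trans_le (re_H_ge hα ht ht0 le_rfl him hx)

/-- C₁ is a composition of analytic maps: u ↦ H in C([0,1], ℂ), the pointwise logarithm, and a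
continuous linear functional. No differentiation under the integral sign is needed. -/
theorem analyticAt_C₁ {α : ℝ} (hα : 0 < α) {t : Fin m → ℝ} (ht : Antitone t)
    (ht0 : ∀ l, 0 ≤ t l) {u : Fin m → ℂ} (him : ∑ l, |(u l).im| ≤ 1) :
    AnalyticAt ℂ (C₁ α t) u := by
  obtain ⟨Λ, hΛ, hlog⟩ := exists_analyticAt_log (f₀ := continuousH hα t u) fun x => by
    rw [continuousH_apply hα ht0]; exact re_H_pos hα ht ht0 him x.2.1
  obtain ⟨J, hJ⟩ := exists_integral_clm (ω := fun _ => 1) intervalIntegrable_const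
  have hcont := (analyticAt_continuousH hα t u)
  have han : AnalyticAt ℂ (fun u => J (Λ (continuousH hα t u))) u :=
    (J.analyticAt _).comp (AnalyticAt.comp (f := continuousH hα t) hΛ hcont)
  refine han.congr ?_
  filter_upwards [hcont.continuousAt.eventually hlog] with v hv
  rw [hJ, C₁]
  refine intervalIntegral.integral_congr fun x hx => ?_
  rw [Set.uIcc_of_le zero_le_one] at hx
  simp only [mul_one]
  rw [hv, continuousH_apply hα ht0, Set.projIcc_of_mem _ hx]

/-- The singular weights `gammaCorr` are integrable and do not depend on u, so they are absorbed
into the functionals `J l`; only the coefficients and the continuous function 1/H vary with u. -/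
theorem analyticAt_C₂ {α : ℝ} (hα : 0 < α) {t : Fin m → ℝ} (ht : Antitone t)
    (ht0 : ∀ l, 0 ≤ t l) {u : Fin m → ℂ} (him : ∑ l, |(u l).im| ≤ 1) :
    AnalyticAt ℂ (C₂ α t) u := by
  have hre : ∀ {x : ℝ}, 0 ≤ x → 0 < (H α t u x).re := fun hx => re_H_pos hα ht ht0 him hx
  have hcoord : ∀ j : Fin m, AnalyticAt ℂ (fun u : Fin m → ℂ => u j) u := fun j =>
    (ContinuousLinearMap.proj (R := ℂ) (φ := fun _ : Fin m => ℂ) j).analyticAt _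
  have hH1 : AnalyticAt ℂ (fun u => H α t u 1) u := by
    unfold H
    exact analyticAt_const.add (Finset.analyticAt_fun_sum _ fun l _ =>
      (analyticAt_coeff l u).mul analyticAt_const)
  have hlast : AnalyticAt ℂ (fun u => (Complex.log (H α t u 1) - ∑ j, u j) / 2) u :=
    ((hH1.clog (Or.inl (hre zero_le_one))).sub
      (Finset.analyticAt_fun_sum _ fun j _ => hcoord j)).div_const
  have hint : AnalyticAt ℂ (fun u => ∫ x in (0 : ℝ)..1, G α t u x) u := by
    obtain ⟨Λ, hΛ, hinv⟩ := exists_analyticAt_inv (f₀ := continuousH hα t u) fun x h => by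
      have := hre x.2.1
      rw [← continuousH_apply hα ht0, h] at this
      simp at this
    have hω : ∀ l, IntervalIntegrable (fun x => (gammaCorr α (t l) x : ℂ)) volume 0 1 := fun l => by
      have := intervalIntegrable_gammaCorr hα (t l) 0 1
      exact ⟨this.1.ofReal, this.2.ofReal⟩
    choose J hJ using fun l => exists_integral_clm (hω l)
    have hcont := (analyticAt_continuousH hα t u)
    have han : AnalyticAt ℂ (fun u => ∑ l, coeff u l * J l (Λ (continuousH hα t u))) u :=
      Finset.analyticAt_fun_sum _ fun l _ => (analyticAt_coeff l u).mul
        (((J l).analyticAt _).comp (AnalyticAt.comp (f := continuousH hα t) hΛ hcont))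
    refine han.congr ?_
    filter_upwards [hcont.continuousAt.eventually hinv] with v hv
    have hi : ∀ l ∈ Finset.univ, IntervalIntegrable (fun x => coeff v l *
        (Λ (continuousH hα t v) (Set.projIcc 0 1 zero_le_one x) * (gammaCorr α (t l) x : ℂ)))
        volume 0 1 := fun l _ =>
      ((hω l).continuousOn_mul
        ((Λ (continuousH hα t v)).continuous.comp continuous_projIcc).continuousOn).const_mul _
    simp only [hJ, ← intervalIntegral.integral_const_mul]
    rw [← intervalIntegral.integral_finsetSum hi]
    refine intervalIntegral.integral_congr fun x hx => ?_
    rw [Set.uIcc_of_le zero_le_one] at hx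
    rw [G_eq, corrH, Finset.mul_sum, hv, continuousH_apply hα ht0, Set.projIcc_of_mem _ hx]
    exact Finset.sum_congr rfl fun l _ => by ring
  exact hint.add hlast

/-! ### Locality and Cauchy estimates for mixed derivatives -/

section Operators

/-- An operator on functions that only depends on germs. -/
def IsLocalOperator (T : ((Fin m → ℂ) → ℂ) → (Fin m → ℂ) → ℂ) : Prop :=
  ∀ (f g : (Fin m → ℂ) → ℂ) (u : Fin m → ℂ), f =ᶠ[nhds u] g → T f =ᶠ[nhds u] T g

/-- An operator that preserves analyticity on balls and satisfies Cauchy estimates. -/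
def HasCauchyEstimates (T : ((Fin m → ℂ) → ℂ) → (Fin m → ℂ) → ℂ) : Prop :=
  ∀ ρ' ρ : ℝ, ρ' < ρ → ∃ K : ℝ, ∀ (x : Fin m → ℂ) (f : (Fin m → ℂ) → ℂ) (B : ℝ),
    AnalyticOnNhd ℂ f (Metric.ball x ρ) → (∀ u ∈ Metric.ball x ρ, ‖f u‖ ≤ B) →
    AnalyticOnNhd ℂ (T f) (Metric.ball x ρ') ∧ ∀ u ∈ Metric.ball x ρ', ‖T f u‖ ≤ K * B

theorem IsLocalOperator.comp {S T : ((Fin m → ℂ) → ℂ) → (Fin m → ℂ) → ℂ}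
    (hS : IsLocalOperator S) (hT : IsLocalOperator T) : IsLocalOperator (S ∘ T) :=
  fun f g u h => hS _ _ u (hT f g u h)

theorem isLocalOperator_id : IsLocalOperator (m := m) id := fun _ _ _ h => h

theorem isLocalOperator_partialD (j : Fin m) : IsLocalOperator (partialD j) := by
  intro f g u h
  filter_upwards [h.eventuallyEq_nhds] with v hv
  exact hv.lineDeriv_eq

theorem HasCauchyEstimates.comp {S T : ((Fin m → ℂ) → ℂ) → (Fin m → ℂ) → ℂ}
    (hS : HasCauchyEstimates S) (hT : HasCauchyEstimates T) : HasCauchyEstimates (S ∘ T) := by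
  intro ρ' ρ hρ
  -- Each of the two operators uses up half of the loss of radius.
  obtain ⟨K₁, h₁⟩ := hT ((ρ' + ρ) / 2) ρ (by linarith)
  obtain ⟨K₂, h₂⟩ := hS ρ' ((ρ' + ρ) / 2) (by linarith)
  refine ⟨K₂ * K₁, fun x f B hf hB => ?_⟩
  obtain ⟨a₁, b₁⟩ := h₁ x f B hf hB
  rw [mul_assoc]
  exact h₂ x (T f) _ a₁ b₁

theorem hasCauchyEstimates_id : HasCauchyEstimates (m := m) id := by
  intro ρ' ρ hρ
  refine ⟨1, fun x f B hf hB => ?_⟩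
  have hsub := Metric.ball_subset_ball (x := x) hρ.le
  exact ⟨hf.mono hsub, fun u hu => by rw [one_mul]; exact hB u (hsub hu)⟩

/-- The one-variable Cauchy inequality on the complex line in direction j: from a point of the
smaller ball, a disc of radius (ρ - ρ')/2 stays inside the larger one. -/
theorem hasCauchyEstimates_partialD (j : Fin m) : HasCauchyEstimates (partialD j) := by
  intro ρ' ρ hρ
  refine ⟨((ρ - ρ') / 2)⁻¹, fun x f B hf hB => ?_⟩
  have hsub := Metric.ball_subset_ball (x := x) hρ.le
  constructor
  · refine AnalyticOnNhd.mono ?_ hsub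
    have h : AnalyticOnNhd ℂ (fun u => fderiv ℂ f u (Pi.single j 1)) (Metric.ball x ρ) :=
      fun u hu => ((ContinuousLinearMap.apply ℂ ℂ (Pi.single j (1 : ℂ) : Fin m → ℂ)).analyticAt
        _).comp (hf.fderiv u hu)
    refine h.congr Metric.isOpen_ball fun u hu => ?_
    exact ((hf u hu).differentiableAt.lineDeriv_eq_fderiv).symm
  · intro u hu
    have hs : 0 < (ρ - ρ') / 2 := by linarith
    have hline : ∀ s : ℂ, ‖s‖ ≤ (ρ - ρ') / 2 →
        u + s • (Pi.single j (1 : ℂ) : Fin m → ℂ) ∈ Metric.ball x ρ := by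
      intro s hs'
      rw [Metric.mem_ball] at hu ⊢
      have h1 : dist (u + s • (Pi.single j (1 : ℂ) : Fin m → ℂ)) u ≤ (ρ - ρ') / 2 := by
        rw [dist_eq_norm, add_sub_cancel_left, norm_smul]
        have : ‖(Pi.single j (1 : ℂ) : Fin m → ℂ)‖ ≤ 1 := by
          rw [pi_norm_le_iff_of_nonneg zero_le_one]
          intro i
          by_cases hi : i = j
          · subst hi; simp
          · simp [Pi.single_eq_of_ne hi]
        calc ‖s‖ * ‖(Pi.single j (1 : ℂ) : Fin m → ℂ)‖ ≤ ‖s‖ * 1 := by gcongr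
          _ ≤ _ := by rw [mul_one]; exact hs'
      linarith [dist_triangle (u + s • (Pi.single j (1 : ℂ) : Fin m → ℂ)) u x]
    have hd : DifferentiableOn ℂ (fun s : ℂ => f (u + s • (Pi.single j (1 : ℂ) : Fin m → ℂ)))
        (Metric.closedBall 0 ((ρ - ρ') / 2)) := by
      intro s hs'
      refine DifferentiableAt.differentiableWithinAt ?_
      refine DifferentiableAt.comp s
        (hf _ (hline s (by simpa using hs'))).differentiableAt (by fun_prop)
    have := Complex.norm_deriv_le_of_forall_mem_sphere_norm_le hs
      (hd.diffContOnCl_ball (subset_refl _)) (C := B)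
      (fun s hs' => hB _ (hline s (le_of_eq (by simpa using hs'))))
    rw [inv_mul_eq_div]
    exact this

theorem isLocalOperator_mixedD (k : Fin m → ℕ) : IsLocalOperator (mixedD k) := by
  have hit : ∀ (j : Fin m) (N : ℕ), IsLocalOperator ((partialD j)^[N]) := by
    intro j N
    induction N with
    | zero => exact isLocalOperator_id
    | succ N ih =>
      rw [Function.iterate_succ]
      exact ih.comp (isLocalOperator_partialD j)
  have hl : ∀ L : List (Fin m),
      IsLocalOperator fun f => L.foldr (fun j g => (partialD j)^[k j] g) f := by
    intro L
    induction L with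
    | nil => exact isLocalOperator_id
    | cons j L ih => exact (hit j (k j)).comp ih
  exact hl (List.finRange m)

theorem hasCauchyEstimates_mixedD (k : Fin m → ℕ) : HasCauchyEstimates (mixedD k) := by
  have hit : ∀ (j : Fin m) (N : ℕ), HasCauchyEstimates ((partialD j)^[N]) := by
    intro j N
    induction N with
    | zero => exact hasCauchyEstimates_id
    | succ N ih =>
      rw [Function.iterate_succ]
      exact ih.comp (hasCauchyEstimates_partialD j)
  have hl : ∀ L : List (Fin m),
      HasCauchyEstimates fun f => L.foldr (fun j g => (partialD j)^[k j] g) f := by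
    intro L
    induction L with
    | nil => exact hasCauchyEstimates_id
    | cons j L ih => exact (hit j (k j)).comp ih
  exact hl (List.finRange m)

end Operators

/-! ### The remainder and its derivatives at real points -/

/-- The remainder with the logarithm of the product replaced by the sum of the logarithms. -/
def sumLogRemainder (α : ℝ) (t : Fin m → ℝ) (n : ℕ) (u : Fin m → ℂ) : ℂ :=
  (∑ k ∈ Finset.range n, Complex.log (modulusFactor α (fun l => min (t l / n) 1) u (k + 1))) -
    (C₁ α t u * n + C₂ α t u)

variable {α : ℝ} {t : Fin m → ℝ}

theorem re_modulusFactor_pos (hα : 0 < α) (ht : Antitone t) (ht0 : ∀ l, 0 ≤ t l) (n k : ℕ)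
    {u : Fin m → ℂ} (him : ∑ l, |(u l).im| ≤ 1) :
    0 < (modulusFactor α (fun l => min (t l / n) 1) u (k + 1)).re :=
  (mul_pos (Real.exp_pos _) Real.cos_one_pos).trans_le (re_modulusFactor_ge hα le_rfl him
    (fun _ _ hl => min_le_min_right _ (div_le_div_of_nonneg_right (ht hl) (Nat.cast_nonneg n)))
    (fun l => le_min (div_nonneg (ht0 l) (Nat.cast_nonneg n)) zero_le_one)
    (fun _ => min_le_right _ _) k.succ_pos)

theorem exp_sum_log_modulusFactor (hα : 0 < α) (ht : Antitone t) (ht0 : ∀ l, 0 ≤ t l) (n : ℕ)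
    {u : Fin m → ℂ} (him : ∑ l, |(u l).im| ≤ 1) :
    Complex.exp (∑ k ∈ Finset.range n,
      Complex.log (modulusFactor α (fun l => min (t l / n) 1) u (k + 1))) = mgf α t n u := by
  rw [mgf_eq_prod hα ht ht0, Complex.exp_sum]
  refine Finset.prod_congr rfl fun k _ => Complex.exp_log fun h => ?_
  have := re_modulusFactor_pos hα ht ht0 n k him
  rw [h, Complex.zero_re] at this
  exact this.false

theorem analyticAt_sum_log_modulusFactor (hα : 0 < α) (ht : Antitone t) (ht0 : ∀ l, 0 ≤ t l)
    (n : ℕ) {u : Fin m → ℂ} (him : ∑ l, |(u l).im| ≤ 1) :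
    AnalyticAt ℂ (fun u => ∑ k ∈ Finset.range n,
      Complex.log (modulusFactor α (fun l => min (t l / n) 1) u (k + 1))) u :=
  Finset.analyticAt_fun_sum _ fun k _ => (analyticOnNhd_modulusFactor α _ (k + 1) u
    (Set.mem_univ u)).clog (Or.inl (re_modulusFactor_pos hα ht ht0 n k him))

theorem analyticAt_sumLogRemainder (hα : 0 < α) (ht : Antitone t) (ht0 : ∀ l, 0 ≤ t l)
    (n : ℕ) {u : Fin m → ℂ} (him : ∑ l, |(u l).im| ≤ 1) :
    AnalyticAt ℂ (sumLogRemainder α t n) u :=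
  (analyticAt_sum_log_modulusFactor hα ht ht0 n him).sub
    (((analyticAt_C₁ hα ht ht0 him).mul analyticAt_const).add (analyticAt_C₂ hα ht ht0 him))

theorem sum_abs_im_ofReal (u : Fin m → ℝ) : ∑ l, |((u l : ℂ)).im| ≤ 1 := by simp

theorem analyticAt_logRemainder (hα : 0 < α) (ht : Antitone t) (ht0 : ∀ l, 0 ≤ t l)
    (n : ℕ) (u : Fin m → ℝ) :
    AnalyticAt ℂ (logRemainder α t n) (fun j => (u j : ℂ)) := by
  have him := sum_abs_im_ofReal u
  refine AnalyticAt.sub (AnalyticAt.clog (analyticOnNhd_mgf hα ht ht0 n _ (Set.mem_univ _)) ?_)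
    (((analyticAt_C₁ hα ht ht0 him).mul analyticAt_const).add (analyticAt_C₂ hα ht ht0 him))
  obtain ⟨p, hp, hp'⟩ := mgf_ofReal_pos hα ht ht0 n u
  rw [hp']
  exact Complex.ofReal_mem_slitPlane.mpr hp

/-- At real points both versions of the remainder have the same germ. -/
theorem logRemainder_eventuallyEq (hα : 0 < α) (ht : Antitone t) (ht0 : ∀ l, 0 ≤ t l)
    (n : ℕ) (u : Fin m → ℝ) :
    logRemainder α t n =ᶠ[nhds fun j => (u j : ℂ)] sumLogRemainder α t n := by
  have him := sum_abs_im_ofReal u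
  have hc := (analyticAt_sum_log_modulusFactor hα ht ht0 n him).continuousAt
  -- At a real point all factors are positive, so the sum of logarithms is real. By continuity its
  -- imaginary part stays in (-π, π) nearby, where it is the principal logarithm of the product.
  -- This neighbourhood may depend on n, so only germs are compared here and the estimates are made
  -- on `sumLogRemainder`.
  have h0 : (∑ k ∈ Finset.range n, Complex.log
      (modulusFactor α (fun l => min (t l / n) 1) (fun j => (u j : ℂ)) (k + 1))).im = 0 := by
    rw [Complex.im_sum]
    refine Finset.sum_eq_zero fun k _ => ?_
    obtain ⟨p, hp, hp'⟩ := modulusFactor_ofReal hα u (ε := fun l => min (t l / n) 1)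
      (fun l l' hl => min_le_min_right _
        (div_le_div_of_nonneg_right (ht hl) (Nat.cast_nonneg n)))
      (fun l => le_min (div_nonneg (ht0 l) (Nat.cast_nonneg n)) zero_le_one)
      (fun l => min_le_right _ _) k.succ_pos
    rw [hp', ← Complex.ofReal_log hp.le, Complex.ofReal_im]
  have hcim := (Complex.continuous_im.continuousAt.comp hc)
  have e1 := hcim.eventually_lt (g := fun _ => Real.pi) continuousAt_const (by
    simp only [Function.comp_apply, h0]; exact Real.pi_pos)
  have e2 := ContinuousAt.eventually_lt (f := fun _ => -Real.pi) continuousAt_const hcim (by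
    simp only [Function.comp_apply, h0]; linarith [Real.pi_pos])
  have him : ContinuousAt (fun v : Fin m → ℂ => ∑ l, |(v l).im|) (fun j => (u j : ℂ)) :=
    Continuous.continuousAt (continuous_finsetSum _ fun l _ =>
      (Complex.continuous_im.comp (continuous_apply l)).abs)
  have e3 := him.eventually_lt (g := fun _ => (1 : ℝ)) continuousAt_const (by simp)
  filter_upwards [e1, e2, e3] with v h1 h2 h3
  rw [logRemainder, sumLogRemainder, ← exp_sum_log_modulusFactor hα ht ht0 n h3.le,
    Complex.log_exp h2 h1.le]

theorem sum_norm_le_of_near {x : Fin m → ℝ} {u : Fin m → ℂ}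
    (hu : ∀ j, ‖u j - (x j : ℂ)‖ ≤ 1 / ((m : ℝ) + 1)) : ∑ l, ‖u l‖ ≤ (∑ l, |x l|) + 1 := by
  have h1 : ∀ l, ‖u l‖ ≤ |x l| + 1 / ((m : ℝ) + 1) := fun l => by
    have := norm_add_le (u l - (x l : ℂ)) (x l : ℂ)
    rw [sub_add_cancel, Complex.norm_real, Real.norm_eq_abs] at this
    linarith [hu l]
  refine (Finset.sum_le_sum fun l _ => h1 l).trans ?_
  rw [Finset.sum_add_distrib, Finset.sum_const, Finset.card_univ, Fintype.card_fin, nsmul_eq_mul]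
  have : (m : ℝ) * (1 / ((m : ℝ) + 1)) ≤ 1 := by
    rw [mul_one_div, div_le_one (by positivity)]; linarith
  linarith

/-- The radius 1/(m + 1) is chosen so that m displacements add up to at most 1, the margin required
by the half-plane bound. -/
theorem sum_abs_im_le_of_near {x : Fin m → ℝ} {u : Fin m → ℂ}
    (hu : ∀ j, ‖u j - (x j : ℂ)‖ ≤ 1 / ((m : ℝ) + 1)) : ∑ l, |(u l).im| ≤ 1 := by
  have h1 : ∀ l, |(u l).im| ≤ 1 / ((m : ℝ) + 1) := fun l => by
    have := (Complex.abs_im_le_norm _).trans (hu l)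
    rwa [Complex.sub_im, Complex.ofReal_im, sub_zero] at this
  refine (Finset.sum_le_sum fun l _ => h1 l).trans ?_
  rw [Finset.sum_const, Finset.card_univ, Fintype.card_fin, nsmul_eq_mul]
  rw [mul_one_div, div_le_one (by positivity)]; linarith

theorem exists_norm_sumLogRemainder_le (hα : 0 < α) (ht : Antitone t) (ht0 : ∀ l, 0 ≤ t l)
    (x : Fin m → ℝ) :
    ∃ (K : ℝ) (n₀ : ℕ), ∀ n : ℕ, n₀ ≤ n → ∀ u : Fin m → ℂ,
      (∀ j, ‖u j - (x j : ℂ)‖ ≤ 1 / ((m : ℝ) + 1)) →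
      ‖sumLogRemainder α t n u‖ ≤ K * rate α n := by
  obtain ⟨K, n₀, -, h⟩ := exists_norm_sum_log_sub_le hα ht ht0 ((∑ l, |x l|) + 1)
  exact ⟨K, n₀, fun n hn u hu => h n hn u (sum_norm_le_of_near hu) (sum_abs_im_le_of_near hu)⟩

theorem intervalIntegrable_log_H (hα : 0 < α) (ht : Antitone t) (ht0 : ∀ l, 0 ≤ t l)
    {u : Fin m → ℂ} (him : ∑ l, |(u l).im| ≤ 1) :
    IntervalIntegrable (fun y => Complex.log (H α t u y)) volume 0 1 := by
  refine ContinuousOn.intervalIntegrable ?_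
  rw [Set.uIcc_of_le zero_le_one]
  refine ContinuousOn.clog ?_ fun y hy => Or.inl (re_H_pos hα ht ht0 him hy.1)
  exact (continuous_lowerH hα t u).continuousOn.congr fun y hy => H_eq_lowerH hα ht0 u hy.1

theorem intervalIntegrable_G (hα : 0 < α) (ht : Antitone t) (ht0 : ∀ l, 0 ≤ t l)
    {u : Fin m → ℂ} (him : ∑ l, |(u l).im| ≤ 1) :
    IntervalIntegrable (G α t u) volume 0 1 := by
  have : G α t u = fun x => (H α t u x)⁻¹ * corrH α t u x := funext (G_eq α t u)
  rw [this]
  refine (intervalIntegrable_corrH hα t u).continuousOn_mul ?_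
  rw [Set.uIcc_of_le zero_le_one]
  refine ContinuousOn.inv₀ ?_ fun y hy h => ?_
  · exact (continuous_lowerH hα t u).continuousOn.congr fun y hy => H_eq_lowerH hα ht0 u hy.1
  · have := re_H_pos hα ht ht0 him hy.1
    rw [h, Complex.zero_re] at this
    exact this.false

/-- Cauchy's estimates apply to `sumLogRemainder` on a ball whose radius does not depend on n;
equality of germs at the real centre carries the bound over. -/
theorem isBigO_mixedD_logRemainder (hα : 0 < α) (ht : Antitone t) (ht0 : ∀ l, 0 ≤ t l)
    (u : Fin m → ℝ) (k : Fin m → ℕ) :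
    (fun n : ℕ => mixedD k (logRemainder α t n) (fun j => (u j : ℂ))) =O[atTop] rate α := by
  obtain ⟨K, n₀, h⟩ := exists_norm_sumLogRemainder_le hα ht ht0 u
  have hδ : (0 : ℝ) < 1 / ((m : ℝ) + 1) := by positivity
  obtain ⟨K', h'⟩ := hasCauchyEstimates_mixedD k (1 / ((m : ℝ) + 1) / 2) (1 / ((m : ℝ) + 1))
    (by linarith)
  refine IsBigO.of_bound (K' * K) ?_
  filter_upwards [eventually_ge_atTop n₀] with n hn
  have hball : ∀ v ∈ Metric.ball (fun j => (u j : ℂ)) (1 / ((m : ℝ) + 1)),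
      ∀ j, ‖v j - (u j : ℂ)‖ ≤ 1 / ((m : ℝ) + 1) := fun v hv j => by
    rw [← dist_eq_norm]
    exact ((dist_pi_lt_iff hδ).mp hv j).le
  obtain ⟨-, hb⟩ := h' (fun j => (u j : ℂ)) (sumLogRemainder α t n) (K * rate α n)
    (fun v hv => analyticAt_sumLogRemainder hα ht ht0 n (sum_abs_im_le_of_near (hball v hv)))
    (fun v hv => h n hn v (hball v hv))
  rw [(isLocalOperator_mixedD k _ _ _ (logRemainder_eventuallyEq hα ht ht0 n u)).eq_of_nhds,
    Real.norm_of_nonneg (rate_nonneg α n), mul_assoc]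
  exact hb _ (Metric.mem_ball_self (by positivity))

end DiskCounting
end

theorem theorem1p2 (m : ℕ) (hm : 0 < m) (α : ℝ) (hα : 0 < α) (t : Fin m → ℝ)
    (ht : StrictAnti t) (ht0 : ∀ l, 0 ≤ t l) :
    (∀ x : Fin m → ℝ, ∃ δ : ℝ, 0 < δ ∧
      (∀ u : Fin m → ℂ, (∀ j, ‖u j - (x j : ℂ)‖ ≤ δ) →
        (∀ y ∈ Set.Icc (0 : ℝ) 1, DiskCounting.H α t u y ∈ Complex.slitPlane) ∧
        IntervalIntegrable (fun y => Complex.log (DiskCounting.H α t u y)) volume 0 1 ∧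
        IntervalIntegrable (DiskCounting.G α t u) volume 0 1) ∧
      ∃ (K : ℝ) (n₀ : ℕ), ∀ n : ℕ, n₀ ≤ n →
        ∀ u : Fin m → ℂ, (∀ j, ‖u j - (x j : ℂ)‖ ≤ δ) →
          ∃ R : ℂ, ‖R‖ ≤ K * DiskCounting.rate α n ∧
            DiskCounting.mgf α t n u =
              Complex.exp (DiskCounting.C₁ α t u * n + DiskCounting.C₂ α t u + R)) ∧
    (∀ n : ℕ, 0 < n →
      AnalyticOnNhd ℂ (DiskCounting.mgf α t n) Set.univ ∧
      ∀ u : Fin m → ℝ, ∃ p : ℝ, 0 < p ∧ DiskCounting.mgf α t n (fun j => (u j : ℂ)) = p) ∧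
    (∀ u : Fin m → ℝ,
      (∀ n : ℕ, 0 < n → AnalyticAt ℂ (DiskCounting.logRemainder α t n) (fun j => (u j : ℂ))) ∧
      ∀ k : Fin m → ℕ,
        (fun n : ℕ => DiskCounting.mixedD k (DiskCounting.logRemainder α t n)
            (fun j => (u j : ℂ))) =O[atTop] DiskCounting.rate α) := by
  have hta : Antitone t := ht.antitone
  refine ⟨fun x => ⟨1 / ((m : ℝ) + 1), by positivity, fun u hu => ?_, ?_⟩, fun n _ => ?_, fun u => ?_⟩
  · have him := DiskCounting.sum_abs_im_le_of_near hu
    exact ⟨fun y hy => Or.inl (DiskCounting.re_H_pos hα hta ht0 him hy.1),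
      DiskCounting.intervalIntegrable_log_H hα hta ht0 him,
      DiskCounting.intervalIntegrable_G hα hta ht0 him⟩
  · obtain ⟨K, n₀, h⟩ := DiskCounting.exists_norm_sumLogRemainder_le hα hta ht0 x
    -- Exponentiating the sum of logarithms recovers the product exactly, so `sumLogRemainder` is an
    -- admissible R whatever the branch of the logarithm of the product.
    refine ⟨K, n₀, fun n hn u hu => ⟨DiskCounting.sumLogRemainder α t n u, h n hn u hu, ?_⟩⟩
    rw [DiskCounting.sumLogRemainder, add_sub_cancel,
      DiskCounting.exp_sum_log_modulusFactor hα hta ht0 n (DiskCounting.sum_abs_im_le_of_near hu)]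
  · exact ⟨DiskCounting.analyticOnNhd_mgf hα hta ht0 n,
      DiskCounting.mgf_ofReal_pos hα hta ht0 n⟩
  · exact ⟨fun n _ => DiskCounting.analyticAt_logRemainder hα hta ht0 n u,
      DiskCounting.isBigO_mixedD_logRemainder hα hta ht0 u⟩
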